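/- Let $X$ be a compact complex analytic manifold of dimension $n$ and let $D\subset X$ be a nonempty divisor with simple normal crossings, with (smooth) irreducible components $D_1,\dots,D_m$, $m\ge 1$. For each $k$ let $s_k$ be a holomorphic section of the line bundle $\mathcal O(D_k)$ with $\operatorname{div}s_k=D_k$, and let $\|\cdot\|_k$ be a smooth hermitian metric on $\mathcal O(D_k)$ with $\|s_k\|_k^2\le e^{-e}$ on $X$. For every integer $N\ge 0$ put on $X\setminus D$ $$\Theta_N=\sum_{k=1}^m\bigl(\log\log\|s_k\|_k^{-2}\bigr)^N .$$ Let $\omega$ be a smooth positive $(1,1)$-form on $X$, and let $dd^c=\frac{i}{2\pi}\partial\bar\partial$. *Definitions.* An analytic chart $(V;z_1,\dots,z_n)$ is adapted to $D$ if $|z_i|<1/e$ on $V$ for all $i$ and $D\cap V=\{z_1\cdots z_r=0\}$ for some $0\le r\le n$; put $d\zeta_k=dz_k/(z_k\log|z_k|^{-1})$ for $k\le r$ and $d\zeta_k=dz_k$ for $k>r$. A smooth form on $X\setminus D$ has Poincaré growth (resp. log-log growth) along $D$ if in every adapted chart it is a linear combination of the exterior products of the $d\zeta_k$, $d\bar\zeta_k$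 with coefficients $g\in C^\infty(V\setminus D,\mathbb C)$ that are bounded on $V'\setminus D$ (resp. satisfy $|g|\le C\prod_{k\le r}(\log\log|z_k|^{-1})^N$ on $V'\setminus D$ for some constants $C$ and $N\in\mathbb Z_{\ge0}$ depending on $V'$ and $g$) for every relatively compact open $V'\subset\subset V$. A smooth function $f:X\setminus D\to\mathbb C$ is pre-log-log along $D$ if $f,\partial f,\bar\partial f,\partial\bar\partial f$ have log-log growth along $D$, and it is P-singular along $D$ if $df$ and $dd^cf$ have Poincaré growth along $D$. **Theorem.** Let $f:X\setminus D\to\mathbb R$ be pre-log-log along $D$. Then there exist pre-log-log functions $\varphi,\psi:X\setminus D\to\mathbb R_{\ge 0}$ along $D$, constants $A,B\ge 0$ and an integer $N\ge 0$ such that 1. $f=\varphi-\psi$; 2. on $X\setminus D$, $$dd^c(-\varphi)+B\,\Theta_N\bigl(dd^c(-\Theta_1)+A\omega\bigr)\ge 0,\qquad dd^c(-\psi)+B\,\Theta_N\bigl(dd^c(-\Theta_1)+A\omega\bigr)\ge 0;$$ 3. if moreover $f$ is P-singular along $D$, then these $\varphi,\psi,A,B,N$ can be chosen such that, in addition, $N=0$,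 the functions $\varphi,\psi$ are P-singular along $D$, and on $X\setminus D$ $$dd^c(-\varphi)+A\omega\ge 0,\qquad dd^c(-\psi)+A\omega\ge 0 .$$ -/

import Mathlib

open scoped Manifold ContDiff Topology Bundle

noncomputable section

namespace LogLog

/-- The model space `ℂⁿ` of complex manifolds of dimension `n`. -/
abbrev Cn (n : ℕ) : Type := Fin n → ℂ

section Forms

variable {n : ℕ} (X : Type*) [TopologicalSpace X] [ChartedSpace (Cn n) X]

/-- Complex valued differential forms of degree `k` on the real manifold underlying `X`, without any
regularity assumption: at every point an alternating `ℝ`-multilinear form on the (real) tangent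
space. Forms that only matter off a subset may take arbitrary values on that subset. -/
abbrev Form (k : ℕ) : Type _ :=
  ∀ x : X, (TangentSpace 𝓘(ℝ, Cn n) x) [⋀^Fin k]→L[ℝ] ℂ

variable {X}

/-- Multiplication by `i` on the real tangent space of a complex manifold. -/
def J (x : X) : TangentSpace 𝓘(ℝ, Cn n) x →L[ℝ] TangentSpace 𝓘(ℝ, Cn n) x :=
  (ContinuousLinearMap.lsmul ℝ ℂ Complex.I : Cn n →L[ℝ] Cn n)

/-- A field of `ℝ`-linear forms on the tangent spaces, as a differential form of degree one. -/
def oneForm (α : ∀ x : X, TangentSpace 𝓘(ℝ, Cn n) x →L[ℝ] ℂ) : Form (n := n) X 1 :=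
  fun x => ContinuousAlternatingMap.ofSubsingleton ℝ (TangentSpace 𝓘(ℝ, Cn n) x) ℂ (0 : Fin 1) (α x)

/-- The expression of a differential form in a chart: its pull-back under the inverse of the
chart. -/
def inChart {k : ℕ} (c : OpenPartialHomeomorph X (Cn n)) (α : Form (n := n) X k) (y : Cn n) :
    (Cn n) [⋀^Fin k]→L[ℝ] ℂ :=
  (α (c.symm y)).compContinuousLinearMap
    (mfderiv 𝓘(ℝ, Cn n) 𝓘(ℝ, Cn n) c.symm y :
      Cn n →L[ℝ] TangentSpace 𝓘(ℝ, Cn n) (c.symm y))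

/-- The exterior derivative of a differential form on `X`, computed at `x` in the preferred chart
at `x`. -/
def extD {k : ℕ} (α : Form (n := n) X k) : Form (n := n) X (k + 1) := fun x =>
  (extDeriv (inChart (chartAt (Cn n) x) α) (chartAt (Cn n) x x)).compContinuousLinearMap
    (mfderiv 𝓘(ℝ, Cn n) 𝓘(ℝ, Cn n) (chartAt (Cn n) x) x :
      TangentSpace 𝓘(ℝ, Cn n) x →L[ℝ] Cn n)

/-- The differential `df` of a function at `x`. -/
def dFun (f : X → ℂ) (x : X) : TangentSpace 𝓘(ℝ, Cn n) x →L[ℝ] ℂ :=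
  mfderiv 𝓘(ℝ, Cn n) 𝓘(ℝ, ℂ) f x

/-- `∂f`, the `ℂ`-linear part of `df`. -/
def del (f : X → ℂ) (x : X) : TangentSpace 𝓘(ℝ, Cn n) x →L[ℝ] ℂ :=
  (1 / 2 : ℂ) • (dFun f x - Complex.I • (dFun f x).comp (J x))

/-- `∂̄f`, the conjugate-linear part of `df`. -/
def delbar (f : X → ℂ) (x : X) : TangentSpace 𝓘(ℝ, Cn n) x →L[ℝ] ℂ :=
  (1 / 2 : ℂ) • (dFun f x + Complex.I • (dFun f x).comp (J x))

/-- `∂∂̄f`; on functions it is `d(∂̄f)`, because `∂̄∂̄ = 0`. -/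
def delDelbar (f : X → ℂ) : Form (n := n) X 2 := extD (oneForm (delbar f))

/-- The operator `dᶜ = (i / 4π) (∂̄ - ∂)` on functions. -/
def dc (f : X → ℂ) (x : X) : TangentSpace 𝓘(ℝ, Cn n) x →L[ℝ] ℂ :=
  (Complex.I / (4 * (Real.pi : ℂ))) • (delbar f x - del f x)

/-- The operator `ddᶜ = (i / 2π) ∂∂̄` on functions. -/
def ddc (f : X → ℂ) : Form (n := n) X 2 := extD (oneForm (dc f))

/-- A real `(1,1)`-form `η` at `x` is semi-positive: `η(v, i v)` is a nonnegative real number for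
every tangent vector `v`. (For example `i dz ∧ dz̄` is semi-positive.) -/
def SemipositiveAt (x : X) (η : (TangentSpace 𝓘(ℝ, Cn n) x) [⋀^Fin 2]→L[ℝ] ℂ) : Prop :=
  ∀ v : TangentSpace 𝓘(ℝ, Cn n) x, 0 ≤ (η ![v, J x v]).re ∧ (η ![v, J x v]).im = 0

/-- A smooth (strictly) positive `(1,1)`-form on `X`. -/
structure IsPositiveForm (η : Form (n := n) X 2) : Prop where
  smooth : ∀ c ∈ IsManifold.maximalAtlas 𝓘(ℂ, Cn n) ω X,
    ContDiffOn ℝ ∞ (inChart c η) c.target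
  type_one_one : ∀ (x : X) (v w : TangentSpace 𝓘(ℝ, Cn n) x), η x ![J x v, J x w] = η x ![v, w]
  pos : ∀ (x : X) (v : TangentSpace 𝓘(ℝ, Cn n) x), v ≠ 0 →
    0 < (η x ![v, J x v]).re ∧ (η x ![v, J x v]).im = 0

end Forms

section Divisors

variable {n : ℕ} {X : Type*} [TopologicalSpace X] [ChartedSpace (Cn n) X]

/-- `D ∩ V` is defined by `z_1 ⋯ z_r = 0`, where `(V; z_1, …, z_n)` is the chart `c` (coordinates
are numbered from zero in the code). For `r = 0` this says that `D ∩ V` is empty. -/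
def CutOutBy (D : Set X) (c : OpenPartialHomeomorph X (Cn n)) (r : ℕ) : Prop :=
  r ≤ n ∧ ∀ x ∈ c.source, x ∈ D ↔ ∃ j : Fin n, (j : ℕ) < r ∧ c x j = 0

/-- `D` is (the support of) a reduced divisor with normal crossings. -/
def IsNormalCrossings (D : Set X) : Prop :=
  ∀ x : X, ∃ c ∈ IsManifold.maximalAtlas 𝓘(ℂ, Cn n) ω X, x ∈ c.source ∧ ∃ r, CutOutBy D c r

/-- A closed smooth analytic hypersurface. -/
def IsSmoothHypersurface (S : Set X) : Prop :=
  IsClosed S ∧ ∀ x ∈ S, ∃ c ∈ IsManifold.maximalAtlas 𝓘(ℂ, Cn n) ω X, x ∈ c.source ∧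
    ∃ j : Fin n, ∀ y ∈ c.source, y ∈ S ↔ c y j = 0

/-- `D` is a divisor with simple normal crossings, and the `D_k` are its (pairwise distinct)
irreducible components, all of them smooth. A smooth hypersurface is irreducible when it is
nonempty and connected. -/
structure IsSNCDecomposition {m : ℕ} (D : Set X) (Dk : Fin m → Set X) : Prop where
  normalCrossings : IsNormalCrossings (n := n) D
  eq_iUnion : D = ⋃ k, Dk k
  smooth : ∀ k, IsSmoothHypersurface (n := n) (Dk k)
  irreducible : ∀ k, IsConnected (Dk k)
  distinct : Function.Injective Dk

/-- The chart `c` is adapted to `D`, and `D` is given in it by the first `r` coordinates. -/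
structure IsAdapted (D : Set X) (c : OpenPartialHomeomorph X (Cn n)) (r : ℕ) : Prop where
  mem_maximalAtlas : c ∈ IsManifold.maximalAtlas 𝓘(ℂ, Cn n) ω X
  cutOut : CutOutBy D c r
  small : ∀ x ∈ c.source, ∀ j, ‖c x j‖ < 1 / Real.exp 1

/-- `V' ⊂⊂ V` for an open subset `V'`. -/
def RelCompactOpen (V' V : Set X) : Prop :=
  IsOpen V' ∧ IsCompact (closure V') ∧ closure V' ⊆ V

end Divisors

section Growth

variable {n : ℕ} {X : Type*} [TopologicalSpace X] [ChartedSpace (Cn n) X]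

/-- The function `g` is smooth on `V ∖ D` and locally bounded on `V`, where `V` is the domain of
the chart `c`. -/
def BddCoeff (D : Set X) (c : OpenPartialHomeomorph X (Cn n)) (g : X → ℂ) : Prop :=
  ContMDiffOn 𝓘(ℝ, Cn n) 𝓘(ℝ, ℂ) ∞ g (c.source \ D) ∧
  ∀ V', RelCompactOpen V' c.source → ∃ C : ℝ, ∀ x ∈ V' \ D, ‖g x‖ ≤ C

/-- The function `g` is smooth on `V ∖ D` and satisfies, on every open `V' ⊂⊂ V`, an estimate
`|g| ≤ C ∏_{k ≤ r} (log log |z_k|⁻¹) ^ N`. -/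
def LogLogCoeff (D : Set X) (c : OpenPartialHomeomorph X (Cn n)) (r : ℕ) (g : X → ℂ) : Prop :=
  ContMDiffOn 𝓘(ℝ, Cn n) 𝓘(ℝ, ℂ) ∞ g (c.source \ D) ∧
  ∀ V', RelCompactOpen V' c.source → ∃ (N : ℕ) (C : ℝ), ∀ x ∈ V' \ D,
    ‖g x‖ ≤ C * ∏ k ∈ Finset.univ.filter (fun k : Fin n => (k : ℕ) < r),
        Real.log (Real.log (‖c x k‖⁻¹)) ^ N

/-- The form `dζ_k` at `x`: it is `dz_k / (z_k log |z_k|⁻¹)` for the first `r` indices and `dz_k`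
for the others. -/
def dZeta (c : OpenPartialHomeomorph X (Cn n)) (r : ℕ) (k : Fin n) (x : X)
    (v : TangentSpace 𝓘(ℝ, Cn n) x) : ℂ :=
  (if (k : ℕ) < r then (c x k * (Real.log (‖c x k‖⁻¹) : ℂ))⁻¹ else 1) *
    (mfderiv 𝓘(ℝ, Cn n) 𝓘(ℝ, Cn n) c x v : Cn n) k

/-- The forms `dζ_k` (left summand) and `dζ̄_k` (right summand). -/
def zetaFrame (c : OpenPartialHomeomorph X (Cn n)) (r : ℕ) (a : Fin n ⊕ Fin n) (x : X)
    (v : TangentSpace 𝓘(ℝ, Cn n) x) : ℂ :=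
  Sum.elim (fun k => dZeta c r k x v) (fun k => starRingEnd ℂ (dZeta c r k x v)) a

/-- The degree `p` part, on the domain of `c`, of the algebra of forms generated by the functions
satisfying `P` and the forms `dζ_k`, `dζ̄_k`: the form `α` is a combination, with coefficients
satisfying `P`, of the products `λ_1 ∧ ⋯ ∧ λ_p` with `λ_i ∈ {dζ_k, dζ̄_k}`. The value of such a
product on `(v_1, …, v_p)` is `det (λ_i (v_j))`. -/
def GeneratedBy (P : (X → ℂ) → Prop) (D : Set X) (c : OpenPartialHomeomorph X (Cn n)) (r : ℕ)
    {p : ℕ} (α : Form (n := n) X p) : Prop :=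
  ∃ γ : (Fin p → Fin n ⊕ Fin n) → X → ℂ, (∀ I, P (γ I)) ∧
    ∀ x ∈ c.source \ D, ∀ v : Fin p → TangentSpace 𝓘(ℝ, Cn n) x,
      α x v = ∑ I, γ I x * Matrix.det (Matrix.of fun i j => zetaFrame c r (I i) x (v j))

/-- Forms on `X ∖ D` with Poincaré growth along `D`. -/
def PoincareGrowth (D : Set X) {p : ℕ} (α : Form (n := n) X p) : Prop :=
  ∀ c r, IsAdapted D c r → GeneratedBy (BddCoeff D c) D c r α

/-- Forms on `X ∖ D` with log-log growth along `D`. -/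
def LogLogGrowth (D : Set X) {p : ℕ} (α : Form (n := n) X p) : Prop :=
  ∀ c r, IsAdapted D c r → GeneratedBy (LogLogCoeff D c r) D c r α

/-- Pre-log-log functions on `X ∖ D`: smooth functions `f` such that `f`, `∂f`, `∂̄f`, `∂∂̄f` have
log-log growth along `D`. (By the Leibniz rule these functions already form an algebra, so that
passing to the algebra generated by them adds nothing.) -/
structure PreLogLog (D : Set X) (f : X → ℂ) : Prop where
  smooth : ContMDiffOn 𝓘(ℝ, Cn n) 𝓘(ℝ, ℂ) ∞ f Dᶜ
  growth : ∀ (c : OpenPartialHomeomorph X (Cn n)) (r : ℕ), IsAdapted D c r → LogLogCoeff D c r f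
  growth_del : LogLogGrowth (n := n) D (oneForm (del f))
  growth_delbar : LogLogGrowth (n := n) D (oneForm (delbar f))
  growth_delDelbar : LogLogGrowth (n := n) D (delDelbar f)

/-- P-singular functions on `X ∖ D`: smooth functions `f` such that `df` and `ddᶜf` have Poincaré
growth along `D`. -/
structure PSingular (D : Set X) (f : X → ℂ) : Prop where
  smooth : ContMDiffOn 𝓘(ℝ, Cn n) 𝓘(ℝ, ℂ) ∞ f Dᶜ
  growth_d : PoincareGrowth (n := n) D (oneForm (dFun f))
  growth_ddc : PoincareGrowth (n := n) D (ddc f)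

end Growth

section LineBundles

variable {n : ℕ} {X : Type*} [TopologicalSpace X] [ChartedSpace (Cn n) X]
variable (L : X → Type*) [∀ x, AddCommGroup (L x)] [∀ x, Module ℂ (L x)]
  [∀ x, TopologicalSpace (L x)] [TopologicalSpace (Bundle.TotalSpace ℂ L)] [FiberBundle ℂ L]

/-- A smooth hermitian metric on a complex line bundle. Smoothness is that of the squared norm of
the local frames `x ↦ e.symm x 1` given by the local trivializations `e`. -/
structure HermitianMetric where
  inner : ∀ x, L x →ₗ⋆[ℂ] L x →ₗ[ℂ] ℂ
  conj_symm : ∀ x (v w : L x), starRingEnd ℂ (inner x v w) = inner x w v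
  pos : ∀ x (v : L x), v ≠ 0 → 0 < (inner x v v).re
  smooth : ∀ (e : Bundle.Trivialization ℂ (Bundle.TotalSpace.proj : Bundle.TotalSpace ℂ L → X))
    [MemTrivializationAtlas e],
    ContMDiffOn 𝓘(ℝ, Cn n) 𝓘(ℝ, ℝ) ∞
      (fun x => (inner x (e.symm x 1) (e.symm x 1)).re) e.baseSet

variable {L}

/-- The squared norm `‖v‖²` for a hermitian metric. -/
def HermitianMetric.normSq (h : HermitianMetric (n := n) L) {x : X} (v : L x) : ℝ :=
  (h.inner x v v).re

/-- The section `s` is holomorphic. -/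
def HolomorphicSection (s : ∀ x, L x) : Prop :=
  ContMDiff 𝓘(ℂ, Cn n) (𝓘(ℂ, Cn n).prod 𝓘(ℂ, ℂ)) ω
    (fun x => (⟨x, s x⟩ : Bundle.TotalSpace ℂ L))

/-- `div s = S` as a reduced divisor: the section `s` vanishes on `S`, and in a trivialization it
generates, at every point `x`, the ideal of all germs of holomorphic functions that vanish
on `S`. -/
def HasDivisor (s : ∀ x, L x) (S : Set X) : Prop :=
  (∀ x ∈ S, s x = 0) ∧
  ∀ (x : X) (g : X → ℂ), ContMDiffAt 𝓘(ℂ, Cn n) 𝓘(ℂ, ℂ) ω g x →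
    (∀ᶠ y in 𝓝 x, y ∈ S → g y = 0) →
    ∃ q : X → ℂ, ContMDiffAt 𝓘(ℂ, Cn n) 𝓘(ℂ, ℂ) ω q x ∧
      ∀ᶠ y in 𝓝 x, g y = q y * (trivializationAt ℂ L x ⟨y, s y⟩).2

end LineBundles

/-- The function `Θ_N = ∑_k (log log ‖s_k‖⁻²) ^ N`, for hermitian line bundles `(L_k, h_k)` with
sections `s_k`. -/
def Theta {n m : ℕ} {X : Type*} [TopologicalSpace X] [ChartedSpace (Cn n) X]
    {L : Fin m → X → Type*} [∀ k x, AddCommGroup (L k x)] [∀ k x, Module ℂ (L k x)]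
    [∀ k x, TopologicalSpace (L k x)] [∀ k, TopologicalSpace (Bundle.TotalSpace ℂ (L k))]
    [∀ k, FiberBundle ℂ (L k)]
    (h : ∀ k, HermitianMetric (n := n) (L k)) (s : ∀ k x, L k x) (N : ℕ) (x : X) : ℝ :=
  ∑ k, Real.log (Real.log ((h k).normSq (s k x))⁻¹) ^ N

/-- Semi-positivity, at every point of `X ∖ D`, of
`ddᶜ(-φ) + B Θ_N (ddᶜ(-Θ_1) + A η)`, where `ΘN`, `Θ1` stand for the functions `Θ_N`, `Θ_1`. -/
def WeightedBound {n : ℕ} {X : Type*} [TopologicalSpace X] [ChartedSpace (Cn n) X] (D : Set X)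
    (η : Form (n := n) X 2) (ΘN Θ1 : X → ℝ) (A B : ℝ) (φ : X → ℝ) : Prop :=
  ∀ x ∉ D, SemipositiveAt x
    (ddc (n := n) (fun y => ((-φ y : ℝ) : ℂ)) x +
      (B * ΘN x) • (ddc (n := n) (fun y => ((-Θ1 y : ℝ) : ℂ)) x + A • η x))

/-- Semi-positivity of `ddᶜ(-φ) + A η` at every point of `X ∖ D`. -/
def PlainBound {n : ℕ} {X : Type*} [TopologicalSpace X] [ChartedSpace (Cn n) X] (D : Set X)
    (η : Form (n := n) X 2) (A : ℝ) (φ : X → ℝ) : Prop :=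
  ∀ x ∉ D, SemipositiveAt x (ddc (n := n) (fun y => ((-φ y : ℝ) : ℂ)) x + A • η x)

end LogLog

end

/-! Put u_k = log ‖s_k‖⁻² ≥ e and T = Θ_1 = ∑ log u_k, so that T ≥ 1 off D. The whole proof measures
growth by powers of this one global function T.

In an adapted chart each u_k is either smooth near a given point or equals -log |z_i|² plus a smooth
function, for a single i ≤ r (`IsSNCDecomposition.isLogSystem`). Since log |z_i| is pluriharmonic,
ddᶜu_k is bounded, and ddᶜ(-log u_k) = -ddᶜu_k / u_k + (du_k ∧ dᶜu_k) / u_k². The first term is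
bounded by a multiple of ω. The second is semipositive and, where u_k has a pole along z_i = 0, it
dominates |dζ_i|² up to a multiple of ω. Every branch of D through a point is the pole of some u_k,
so for A large ddᶜ(-T) + Aω dominates the Poincaré metric ∑ |dζ_k|² up to a constant
(`IsLogSystem.levi_lower`, and globally by compactness `IsLogSystem.exists_twistedForm_lower`).

Locally T and ∏ log log |z_k|⁻¹ are each bounded by a multiple of a power of the other, so log-log
growth means "bounded by a power of T" and Poincaré growth means "bounded by T⁰". Hence if ddᶜg has
log-log (resp. Poincaré) growth, then |ddᶜg| ≤ C Tᴺ (ddᶜ(-T) + Aω) for some N (resp. N = 0); this is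
`IsLogSystem.leviForm_bound`. Moreover Tᴺ ≤ mᴺ Θ_N.

It remains to make f nonnegative by adding a function of T. The components of dT and ddᶜT in the
dζ-frame are bounded, so T is P-singular and every Tᴹ is pre-log-log. If |f| ≤ K Tᴹ, then φ = f + (1
+ K) Tᴹ and ψ = (1 + K) Tᴹ work.

If f is P-singular, M = 1 is possible: df is bounded in the Poincaré metric, in which the radial
distance to z_k = 0 grows like log log |z_k|⁻¹, and integrating along radial paths gives |f| ≤ K T
(`exists_radial_bound`, `IsLogSystem.locBound_of_deriv`). Enlarging K so that it also exceeds the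
constant in ddᶜf ≤ C (ddᶜ(-T) + Aω), the summand (1 + K) T absorbs the singular part of ddᶜf and
leaves a multiple of ω. -/

namespace LogLog

open IsManifold

/-! ### Holomorphic charts as charts of the underlying real manifold. -/

section Charts

variable {n : ℕ} {X : Type*} [TopologicalSpace X] [ChartedSpace (Cn n) X]

theorem mem_contDiffGroupoid_iff (𝕜 : Type*) [NontriviallyNormedField 𝕜] [NormedSpace 𝕜 (Cn n)]
    (e : OpenPartialHomeomorph (Cn n) (Cn n)) :
    e ∈ contDiffGroupoid ω 𝓘(𝕜, Cn n) ↔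
      ContDiffOn 𝕜 ω e e.source ∧ ContDiffOn 𝕜 ω e.symm e.target := by
  rw [contDiffGroupoid, mem_groupoid_of_pregroupoid]
  simp [contDiffPregroupoid]

theorem contDiffGroupoid_restrictScalars {e : OpenPartialHomeomorph (Cn n) (Cn n)}
    (he : e ∈ contDiffGroupoid ω 𝓘(ℂ, Cn n)) : e ∈ contDiffGroupoid ω 𝓘(ℝ, Cn n) := by
  rw [mem_contDiffGroupoid_iff] at he ⊢
  exact ⟨he.1.restrict_scalars ℝ, he.2.restrict_scalars ℝ⟩

theorem isManifold_real [IsManifold 𝓘(ℂ, Cn n) ω X] : IsManifold 𝓘(ℝ, Cn n) ω X where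
  compatible he he' := contDiffGroupoid_restrictScalars
    ((contDiffGroupoid ω 𝓘(ℂ, Cn n)).compatible he he')

theorem mem_maximalAtlas_real {c : OpenPartialHomeomorph X (Cn n)}
    (hc : c ∈ maximalAtlas 𝓘(ℂ, Cn n) ω X) : c ∈ maximalAtlas 𝓘(ℝ, Cn n) ω X := by
  rw [IsManifold.mem_maximalAtlas_iff, _root_.mem_maximalAtlas_iff] at hc ⊢
  intro e he
  exact ⟨contDiffGroupoid_restrictScalars (hc e he).1, contDiffGroupoid_restrictScalars (hc e he).2⟩

theorem contDiffAt_coordChange {c c' : OpenPartialHomeomorph X (Cn n)}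
    (hc : c ∈ maximalAtlas 𝓘(ℂ, Cn n) ω X) (hc' : c' ∈ maximalAtlas 𝓘(ℂ, Cn n) ω X) {x : X}
    (hx : x ∈ c.source) (hx' : x ∈ c'.source) :
    ContDiffAt ℂ ω (fun y => c' (c.symm y)) (c x) := by
  have h := compatible_of_mem_maximalAtlas hc hc'
  rw [mem_contDiffGroupoid_iff] at h
  refine h.1.contDiffAt ((c.symm.trans c').open_source.mem_nhds ?_)
  simp [hx, hx']

variable [IsManifold 𝓘(ℂ, Cn n) ω X]

variable {c : OpenPartialHomeomorph X (Cn n)} (hc : c ∈ maximalAtlas 𝓘(ℂ, Cn n) ω X)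

include hc in
theorem contMDiffAt_chart {x : X} (hx : x ∈ c.source) {k : ℕ∞ω} :
    ContMDiffAt 𝓘(ℝ, Cn n) 𝓘(ℝ, Cn n) k c x := by
  have := isManifold_real (n := n) (X := X)
  exact (contMDiffAt_of_mem_maximalAtlas (mem_maximalAtlas_real hc) hx).of_le le_top

include hc in
theorem contMDiffAt_chart_symm {y : Cn n} (hy : y ∈ c.target) {k : ℕ∞ω} :
    ContMDiffAt 𝓘(ℝ, Cn n) 𝓘(ℝ, Cn n) k c.symm y := by
  have := isManifold_real (n := n) (X := X)
  exact (contMDiffAt_symm_of_mem_maximalAtlas (mem_maximalAtlas_real hc) hy).of_le le_top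

include hc in
theorem mdifferentiable_chart :
    OpenPartialHomeomorph.MDifferentiable 𝓘(ℝ, Cn n) 𝓘(ℝ, Cn n) c :=
  ⟨fun _ hx => ((contMDiffAt_chart (k := 1) hc hx).mdifferentiableAt
      one_ne_zero).mdifferentiableWithinAt,
    fun _ hy => ((contMDiffAt_chart_symm (k := 1) hc hy).mdifferentiableAt
      one_ne_zero).mdifferentiableWithinAt⟩

/-- The derivative of the chart `c` at `x`, as a linear map on the model space. -/
noncomputable def chartDeriv (c : OpenPartialHomeomorph X (Cn n)) (x : X) : Cn n →L[ℝ] Cn n :=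
  mfderiv 𝓘(ℝ, Cn n) 𝓘(ℝ, Cn n) c x

/-- The derivative of the inverse of the chart `c` at `y`, as a linear map on the model space. -/
noncomputable def chartDerivSymm (c : OpenPartialHomeomorph X (Cn n)) (y : Cn n) :
    Cn n →L[ℝ] Cn n :=
  mfderiv 𝓘(ℝ, Cn n) 𝓘(ℝ, Cn n) c.symm y

include hc in
theorem chartDeriv_eq {x : X} (hx : x ∈ c.source) :
    chartDeriv c x = fderiv ℝ (fun y => c ((chartAt (Cn n) x).symm y)) (chartAt (Cn n) x x) := by
  have h := (contMDiffAt_chart (k := 1) hc hx).mdifferentiableAt one_ne_zero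
  refine Eq.trans (b := fderivWithin ℝ (writtenInExtChartAt 𝓘(ℝ, Cn n) 𝓘(ℝ, Cn n) x c)
    (Set.range 𝓘(ℝ, Cn n)) (extChartAt 𝓘(ℝ, Cn n) x x)) h.mfderiv ?_
  simp [writtenInExtChartAt, Function.comp_def, extChartAt, OpenPartialHomeomorph.extend]
  rfl

include hc in
-- The coordinate change from the preferred chart is holomorphic, so its real derivative is complex
-- linear. This is what lets `J` be read as multiplication by i in every chart of the atlas.
theorem chartDeriv_I_smul {x : X} (hx : x ∈ c.source) (v : Cn n) :
    chartDeriv c x (Complex.I • v) = Complex.I • chartDeriv c x v := by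
  rw [chartDeriv_eq hc hx]
  have hd := (contDiffAt_coordChange (subset_maximalAtlas (chart_mem_atlas (Cn n) x)) hc
    (mem_chart_source _ x) hx).differentiableAt (by simp)
  rw [hd.fderiv_restrictScalars ℝ]
  simp

include hc in
theorem chartDerivSymm_chartDeriv {x : X} (hx : x ∈ c.source) (v : Cn n) :
    chartDerivSymm c (c x) (chartDeriv c x v) = v := by
  have h := (mdifferentiable_chart hc).symm_comp_deriv hx
  exact DFunLike.congr_fun h v

include hc in
theorem chartDeriv_chartDerivSymm {x : X} (hx : x ∈ c.source) (v : Cn n) :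
    chartDeriv c x (chartDerivSymm c (c x) v) = v := by
  have h := (mdifferentiable_chart hc).comp_symm_deriv (c.map_source hx)
  have h2 := DFunLike.congr_fun h v
  rw [c.left_inv hx] at h2
  exact h2

end Charts

/-! ### Exterior derivatives of a dF + b dF ∘ i on ℂⁿ. -/

section LeviForm

variable {n : ℕ}

/-- Multiplication by `i` on the model space. -/
noncomputable def mulI : Cn n →L[ℝ] Cn n := ContinuousLinearMap.lsmul ℝ ℂ Complex.I

@[simp] theorem mulI_apply (v : Cn n) : mulI v = Complex.I • v := rfl

/-- The antisymmetrization of `D²F (v, i w)`; up to a constant factor this is `ddᶜF`. -/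
noncomputable def lev (F : Cn n → ℝ) (y v w : Cn n) : ℝ :=
  fderiv ℝ (fderiv ℝ F) y v (Complex.I • w) - fderiv ℝ (fderiv ℝ F) y w (Complex.I • v)

/-- The complex one-form `a dF + b dF ∘ i`. -/
noncomputable def mixedForm (a b : ℂ) (F : Cn n → ℝ) (y : Cn n) : Cn n →L[ℝ] ℂ :=
  a • Complex.ofRealCLM.comp (fderiv ℝ F y) + b • Complex.ofRealCLM.comp ((fderiv ℝ F y).comp mulI)

theorem mixedForm_apply (a b : ℂ) (F : Cn n → ℝ) (y v : Cn n) :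
    mixedForm a b F y v = a * (fderiv ℝ F y v : ℝ) + b * (fderiv ℝ F y (Complex.I • v) : ℝ) := by
  simp [mixedForm]

theorem ContDiffAt.differentiableAt_fderiv {F : Cn n → ℝ} {y : Cn n} (hF : ContDiffAt ℝ ∞ F y) :
    DifferentiableAt ℝ (fderiv ℝ F) y :=
  (hF.fderiv_right (m := 1) (by norm_cast)).differentiableAt one_ne_zero

theorem ContDiffAt.second_fderiv_symm {F : Cn n → ℝ} {y : Cn n} (hF : ContDiffAt ℝ ∞ F y)
    (v w : Cn n) : fderiv ℝ (fderiv ℝ F) y v w = fderiv ℝ (fderiv ℝ F) y w v :=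
  (hF.isSymmSndFDerivAt (by simp; norm_cast)).eq v w

theorem differentiableAt_mixedForm (a b : ℂ) {F : Cn n → ℝ} {y : Cn n} (hF : ContDiffAt ℝ ∞ F y) :
    DifferentiableAt ℝ (mixedForm a b F) y := by
  have h := ContDiffAt.differentiableAt_fderiv hF
  unfold mixedForm
  fun_prop

theorem fderiv_mixedForm (a b : ℂ) {F : Cn n → ℝ} {y : Cn n} (hF : ContDiffAt ℝ ∞ F y)
    (v w : Cn n) :
    fderiv ℝ (fun z => mixedForm a b F z w) y v =
      a * (fderiv ℝ (fderiv ℝ F) y v w : ℝ) +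
        b * (fderiv ℝ (fderiv ℝ F) y v (Complex.I • w) : ℝ) := by
  have h := (ContDiffAt.differentiableAt_fderiv hF).hasFDerivAt
  have h1 (u : Cn n) := (Complex.ofRealCLM.hasFDerivAt (x := fderiv ℝ F y u)).comp y
    (h.clm_apply (hasFDerivAt_const u y))
  have h2 := ((h1 w).const_smul a).add ((h1 (Complex.I • w)).const_smul b)
  have h3 : (fun z => mixedForm a b F z w) =
    (a • (Complex.ofRealCLM ∘ fun z => fderiv ℝ F z w)) +
      (b • (Complex.ofRealCLM ∘ fun z => fderiv ℝ F z (Complex.I • w))) := by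
    ext z; simp [mixedForm_apply]
  rw [h3, h2.fderiv]
  simp

theorem extDeriv_ofSubsingleton {A : Cn n → Cn n →L[ℝ] ℂ} {y : Cn n} (hA : DifferentiableAt ℝ A y)
    (v w : Cn n) :
    extDeriv (fun z => ContinuousAlternatingMap.ofSubsingleton ℝ (Cn n) ℂ (0 : Fin 1) (A z)) y
      ![v, w] = fderiv ℝ (fun z => A z w) y v - fderiv ℝ (fun z => A z v) y w := by
  have h : DifferentiableAt ℝ
      (fun z => ContinuousAlternatingMap.ofSubsingleton ℝ (Cn n) ℂ (0 : Fin 1) (A z)) y :=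
    (ContinuousAlternatingMap.ofSubsingletonLIE (𝕜 := ℝ) (E := Cn n) (F := ℂ)
    (ι := Fin 1) (i := 0)).differentiableAt.comp y hA
  rw [extDeriv_apply h]
  simp [Fin.sum_univ_two, Fin.removeNth, sub_eq_add_neg]

/-- The `a`-part is exact and disappears by symmetry of the second derivative. Since d, ∂, ∂̄ and dᶜ
are all of this shape, ∂∂̄ and ddᶜ are constant multiples of one real form. -/
theorem extDeriv_mixedForm (a b : ℂ) {F : Cn n → ℝ} {y : Cn n} (hF : ContDiffAt ℝ ∞ F y)
    (v w : Cn n) :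
    extDeriv (fun z => ContinuousAlternatingMap.ofSubsingleton ℝ (Cn n) ℂ (0 : Fin 1)
      (mixedForm a b F z)) y ![v, w] = b * (lev F y v w : ℝ) := by
  rw [extDeriv_ofSubsingleton (differentiableAt_mixedForm a b hF), fderiv_mixedForm a b hF,
    fderiv_mixedForm a b hF, ContDiffAt.second_fderiv_symm hF v w, lev]
  push_cast
  ring

end LeviForm

theorem eventually_of_chart {X : Type*} [TopologicalSpace X] {n : ℕ}
    {c : OpenPartialHomeomorph X (Cn n)} {x : X} (hx : x ∈ c.source) {p : X → Prop}
    (h : ∀ᶠ z in 𝓝 x, p z) :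
    ∀ᶠ y in 𝓝 (c x), p (c.symm y) := by
  have h1 := c.continuousAt_symm (c.map_source hx)
  rw [ContinuousAt, c.left_inv hx] at h1
  exact h1.eventually h

/-! ### Chart expressions of df, dᶜf and ddᶜf. -/

section FormsInCharts

variable {n : ℕ} {X : Type*} [TopologicalSpace X] [ChartedSpace (Cn n) X]
  [IsManifold 𝓘(ℂ, Cn n) ω X] {c : OpenPartialHomeomorph X (Cn n)}
  (hc : c ∈ maximalAtlas 𝓘(ℂ, Cn n) ω X)

include hc in
theorem contDiffAt_comp_symm {f : X → ℝ} {x : X} (hx : x ∈ c.source)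
    (hf : ContMDiffAt 𝓘(ℝ, Cn n) 𝓘(ℝ, ℝ) ∞ f x) : ContDiffAt ℝ ∞ (fun y => f (c.symm y)) (c x) := by
  rw [← contMDiffAt_iff_contDiffAt]
  refine ContMDiffAt.comp (c x) (g := f) ?_ (contMDiffAt_chart_symm hc (c.map_source hx))
  rwa [c.left_inv hx]

include hc in
theorem contMDiffAt_comp_chart {F : Cn n → ℝ} {x : X} (hx : x ∈ c.source)
    (hF : ContDiffAt ℝ ∞ F (c x)) : ContMDiffAt 𝓘(ℝ, Cn n) 𝓘(ℝ, ℝ) ∞ (fun z => F (c z)) x :=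
  ContMDiffAt.comp x (g := F) (contMDiffAt_iff_contDiffAt.2 hF) (contMDiffAt_chart hc hx)

include hc in
theorem dFun_eq {f : X → ℝ} {x : X} (hx : x ∈ c.source)
    (hf : ContMDiffAt 𝓘(ℝ, Cn n) 𝓘(ℝ, ℝ) ∞ f x) (v : Cn n) :
    dFun (n := n) (fun z => (f z : ℂ)) x v =
      (fderiv ℝ (fun y => f (c.symm y)) (c x) (chartDeriv c x v) : ℝ) := by
  have h1 : HasFDerivAt (fun y => (f (c.symm y) : ℂ))
      (Complex.ofRealCLM.comp (fderiv ℝ (fun y => f (c.symm y)) (c x))) (c x) :=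
    (Complex.ofRealCLM.hasFDerivAt).comp (c x)
      ((contDiffAt_comp_symm hc hx hf).differentiableAt (by simp)).hasFDerivAt
  have h2 := ((contMDiffAt_chart (k := 1) hc hx).mdifferentiableAt one_ne_zero).hasMFDerivAt
  have h3 := HasMFDerivAt.comp x h1.hasMFDerivAt h2
  have h4 : (fun z => (f z : ℂ)) =ᶠ[𝓝 x] (fun y => (f (c.symm y) : ℂ)) ∘ c := by
    filter_upwards [c.open_source.mem_nhds hx] with z hz
    simp [c.left_inv hz]
  have h5 := (h3.congr_of_eventuallyEq h4).mfderiv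
  exact DFunLike.congr_fun h5 v

/-- The one-form `a df + b df ∘ J`. -/
noncomputable def mixedOneForm (a b : ℂ) (f : X → ℝ) (x : X) :
    TangentSpace 𝓘(ℝ, Cn n) x →L[ℝ] ℂ :=
  a • dFun (fun z => (f z : ℂ)) x + b • (dFun (fun z => (f z : ℂ)) x).comp (J x)

include hc in
theorem mixedOneForm_apply (a b : ℂ) {f : X → ℝ} {x : X} (hx : x ∈ c.source)
    (hf : ContMDiffAt 𝓘(ℝ, Cn n) 𝓘(ℝ, ℝ) ∞ f x) (v : Cn n) :
    mixedOneForm (n := n) a b f x v =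
      mixedForm a b (fun y => f (c.symm y)) (c x) (chartDeriv c x v) := by
  rw [mixedForm_apply, ← chartDeriv_I_smul hc hx, ← dFun_eq hc hx hf, ← dFun_eq hc hx hf]
  rfl

include hc in
theorem inChart_mixedOneForm (a b : ℂ) {f : X → ℝ} {x : X} (hx : x ∈ c.source)
    (hf : ContMDiffAt 𝓘(ℝ, Cn n) 𝓘(ℝ, ℝ) ∞ f x) :
    inChart c (oneForm (mixedOneForm (n := n) a b f)) (c x) =
      ContinuousAlternatingMap.ofSubsingleton ℝ (Cn n) ℂ (0 : Fin 1)
        (mixedForm a b (fun y => f (c.symm y)) (c x)) := by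
  ext v
  have h := mixedOneForm_apply (x := c.symm (c x)) hc a b (by rwa [c.left_inv hx])
    (by rwa [c.left_inv hx]) (chartDerivSymm c (c x) (v 0))
  rw [c.left_inv hx] at h
  rw [chartDeriv_chartDerivSymm hc hx] at h
  refine Eq.trans ?_ h
  rw [← c.left_inv hx]
  simp only [c.left_inv hx]
  rfl

include hc in
theorem eventually_inChart_mixedOneForm (a b : ℂ) {f : X → ℝ} {x : X} (hx : x ∈ c.source)
    (hf : ∀ᶠ z in 𝓝 x, ContMDiffAt 𝓘(ℝ, Cn n) 𝓘(ℝ, ℝ) ∞ f z) :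
    inChart c (oneForm (mixedOneForm (n := n) a b f)) =ᶠ[𝓝 (c x)]
      fun y => ContinuousAlternatingMap.ofSubsingleton ℝ (Cn n) ℂ (0 : Fin 1)
        (mixedForm a b (fun y => f (c.symm y)) y) := by
  filter_upwards [eventually_of_chart hx hf, c.open_target.mem_nhds (c.map_source hx)]
    with y hy hyt
  have h := inChart_mixedOneForm hc a b (c.map_target hyt) hy
  rwa [c.right_inv hyt] at h

include hc in
-- `extD` is computed in the preferred chart, whereas estimates live in adapted charts. The exterior
-- derivative commutes with pull-back, and a holomorphic coordinate change has derivative commuting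
-- with i, so it pulls mixed forms back to mixed forms with the same coefficients.
theorem extD_mixedOneForm (a b : ℂ) {f : X → ℝ} {x : X} (hx : x ∈ c.source)
    (hf : ∀ᶠ z in 𝓝 x, ContMDiffAt 𝓘(ℝ, Cn n) 𝓘(ℝ, ℝ) ∞ f z) (v w : TangentSpace 𝓘(ℝ, Cn n) x) :
    extD (oneForm (mixedOneForm (n := n) a b f)) x ![v, w] =
      b * (lev (fun y => f (c.symm y)) (c x) (chartDeriv c x v) (chartDeriv c x w) : ℝ) := by
  set c₀ := chartAt (Cn n) x with hc₀def
  have hc₀ : c₀ ∈ maximalAtlas 𝓘(ℂ, Cn n) ω X := subset_maximalAtlas (chart_mem_atlas (Cn n) x)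
  have hx₀ : x ∈ c₀.source := mem_chart_source _ x
  set φ : Cn n → Cn n := fun y => c (c₀.symm y) with hφdef
  have hφx : φ (c₀ x) = c x := by simp [hφdef, c₀.left_inv hx₀]
  set F : Cn n → ℝ := fun y => f (c.symm y) with hFdef
  have hF : ContDiffAt ℝ ∞ F (c x) := contDiffAt_comp_symm hc hx hf.self_of_nhds
  have hφ : ContDiffAt ℂ ω φ (c₀ x) := contDiffAt_coordChange hc₀ hc hx₀ hx
  have hφ' : ∀ᶠ y in 𝓝 (c₀ x), ContDiffAt ℂ ω φ y := hφ.eventually (by simp)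
  have hsrc : ∀ᶠ y in 𝓝 (c₀ x), c₀.symm y ∈ c.source :=
    eventually_of_chart hx₀ (c.open_source.mem_nhds hx)
  have hFe : ∀ᶠ y in 𝓝 (c x), ContDiffAt ℝ ∞ F y := by
    filter_upwards [eventually_of_chart hx hf, c.open_target.mem_nhds (c.map_source hx)]
      with y hy hyt
    have h := contDiffAt_comp_symm hc (c.map_target hyt) hy
    rwa [c.right_inv hyt] at h
  have hpull : (fun y => ContinuousAlternatingMap.ofSubsingleton ℝ (Cn n) ℂ (0 : Fin 1)
        (mixedForm a b (fun y => f (c₀.symm y)) y)) =ᶠ[𝓝 (c₀ x)]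
      fun y => (ContinuousAlternatingMap.ofSubsingleton ℝ (Cn n) ℂ (0 : Fin 1)
        (mixedForm a b F (φ y))).compContinuousLinearMap (fderiv ℝ φ y) := by
    have hcont : Filter.Tendsto φ (𝓝 (c₀ x)) (𝓝 (c x)) := by
      have := hφ.continuousAt; rwa [ContinuousAt, hφx] at this
    have hFc : (fun y => f (c₀.symm y)) =ᶠ[𝓝 (c₀ x)] fun y => F (φ y) := by
      filter_upwards [hsrc] with y hy
      simp [hFdef, hφdef, c.left_inv hy]
    filter_upwards [hφ', hcont.eventually hFe, hFc.eventuallyEq_nhds] with y hy hy2 hy3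
    ext v
    have hd := hy.differentiableAt (by simp)
    have hd' := (hy2.differentiableAt (by simp)).hasFDerivAt.comp y
      (hd.restrictScalars ℝ).hasFDerivAt
    have he : fderiv ℝ (fun y => f (c₀.symm y)) y = (fderiv ℝ F (φ y)).comp (fderiv ℝ φ y) := by
      rw [hy3.fderiv_eq]; exact hd'.fderiv
    have hI : fderiv ℝ φ y (Complex.I • v 0) = Complex.I • fderiv ℝ φ y (v 0) := by
      rw [hd.fderiv_restrictScalars ℝ]; simp
    simp [mixedForm_apply, he, hI]
  have hdiff : DifferentiableAt ℝ (fun y => ContinuousAlternatingMap.ofSubsingleton ℝ (Cn n) ℂ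
      (0 : Fin 1) (mixedForm a b F y)) (φ (c₀ x)) := by
    rw [hφx]
    exact (ContinuousAlternatingMap.ofSubsingletonLIE (𝕜 := ℝ) (E := Cn n) (F := ℂ)
    (ι := Fin 1) (i := 0)).differentiableAt.comp _ (differentiableAt_mixedForm a b hF)
  have key : extDeriv (inChart c₀ (oneForm (mixedOneForm (n := n) a b f))) (c₀ x) =
      (extDeriv (fun y => ContinuousAlternatingMap.ofSubsingleton ℝ (Cn n) ℂ
      (0 : Fin 1) (mixedForm a b F y)) (c x)).compContinuousLinearMap (fderiv ℝ φ (c₀ x)) := by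
    rw [((eventually_inChart_mixedOneForm hc₀ a b hx₀ hf).trans hpull).extDeriv_eq,
      extDeriv_pullback hdiff (hφ.restrict_scalars ℝ) (by simp), hφx]
  -- `mfderiv` at `x` is itself written in the preferred chart, so the derivative of that chart is
  -- the identity.
  have hD (u : Cn n) : fderiv ℝ φ (c₀ x) (chartDeriv c₀ x u) = chartDeriv c x u := by
    have : chartDeriv c₀ x u = u := by
      rw [chartDeriv_eq hc₀ hx₀]
      have : (fun y => c₀ (c₀.symm y)) =ᶠ[𝓝 (c₀ x)] id := by
        filter_upwards [c₀.open_target.mem_nhds (c₀.map_source hx₀)] with y hy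
        exact c₀.right_inv hy
      rw [this.fderiv_eq]; simp
    rw [this, chartDeriv_eq hc hx]
  have h1 : extD (oneForm (mixedOneForm (n := n) a b f)) x ![v, w] =
      extDeriv (inChart c₀ (oneForm (mixedOneForm (n := n) a b f))) (c₀ x)
        ![chartDeriv c₀ x v, chartDeriv c₀ x w] := by
    rw [extD]
    refine Eq.trans (ContinuousAlternatingMap.compContinuousLinearMap_apply _ _ _) ?_
    congr 1
    ext i
    fin_cases i <;> rfl
  rw [h1, key, ContinuousAlternatingMap.compContinuousLinearMap_apply, ← hD v, ← hD w,
    ← extDeriv_mixedForm a b hF]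
  congr 1
  ext i
  fin_cases i <;> rfl

end FormsInCharts

/-! ### Local bounds by powers of a weight, and their globalization by compactness. -/

section LocalBounds

variable {X : Type*} [TopologicalSpace X]

/-- Near `x` and off `D`, the function `h` is bounded by a multiple of `T ^ N` for some `N ∈ E`. -/
def LocBound (D : Set X) (T : X → ℝ) (E : Set ℕ) (x : X) (h : X → ℝ) : Prop :=
  ∃ N ∈ E, ∃ C : ℝ, 0 ≤ C ∧ ∀ᶠ z in 𝓝 x, z ∉ D → h z ≤ C * T z ^ N

variable {D : Set X} {T : X → ℝ} {E : Set ℕ} {x : X} {h h' : X → ℝ}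

theorem LocBound.mono (hh : LocBound D T E x h) (hle : ∀ᶠ z in 𝓝 x, z ∉ D → h' z ≤ h z) :
    LocBound D T E x h' := by
  obtain ⟨N, hN, C, hC, hb⟩ := hh
  refine ⟨N, hN, C, hC, ?_⟩
  filter_upwards [hb, hle] with z h1 h2 hz using (h2 hz).trans (h1 hz)

theorem LocBound.add (hT : ∀ z ∉ D, 1 ≤ T z) (hh : LocBound D T E x h)
    (hh' : LocBound D T E x h') : LocBound D T E x (fun z => h z + h' z) := by
  obtain ⟨N, hN, C, hC, hb⟩ := hh
  obtain ⟨N', hN', C', hC', hb'⟩ := hh'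
  refine ⟨max N N', by rcases max_choice N N' with h | h <;> rwa [h], C + C', by positivity, ?_⟩
  filter_upwards [hb, hb'] with z h1 h2 hz
  have h3 := pow_le_pow_right₀ (hT z hz) (le_max_left N N')
  have h4 := pow_le_pow_right₀ (hT z hz) (le_max_right N N')
  have h5 := mul_le_mul_of_nonneg_left h3 hC
  have h6 := mul_le_mul_of_nonneg_left h4 hC'
  linarith [h1 hz, h2 hz]

theorem LocBound.const_mul (hh : LocBound D T E x h) {a : ℝ} (ha : 0 ≤ a) :
    LocBound D T E x (fun z => a * h z) := by
  obtain ⟨N, hN, C, hC, hb⟩ := hh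
  refine ⟨N, hN, a * C, by positivity, ?_⟩
  filter_upwards [hb] with z h1 hz
  rw [mul_assoc]
  exact mul_le_mul_of_nonneg_left (h1 hz) ha

theorem LocBound.zero (hE : E.Nonempty) :
    LocBound D T E x (fun _ => 0) := by
  obtain ⟨N, hN⟩ := hE
  exact ⟨N, hN, 0, le_rfl, by simp⟩

theorem LocBound.sum (hT : ∀ z ∉ D, 1 ≤ T z) (hE : E.Nonempty) {ι : Type*} (s : Finset ι)
    {h : ι → X → ℝ} (hh : ∀ i ∈ s, LocBound D T E x (h i)) :
    LocBound D T E x (fun z => ∑ i ∈ s, h i z) := by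
  classical
  induction s using Finset.induction_on with
  | empty => simpa using LocBound.zero hE
  | insert i s hi ih =>
    simp only [Finset.sum_insert hi]
    exact (hh i (Finset.mem_insert_self _ _)).add hT
      (ih fun j hj => hh j (Finset.mem_insert_of_mem hj))

theorem LocBound.of_le_const (hT : ∀ z ∉ D, 1 ≤ T z) (hE : E.Nonempty) (C : ℝ)
    (hh : ∀ᶠ z in 𝓝 x, z ∉ D → h z ≤ C) : LocBound D T E x h := by
  obtain ⟨N, hN⟩ := hE
  refine ⟨N, hN, |C|, abs_nonneg _, ?_⟩
  filter_upwards [hh] with z h1 hz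
  calc h z ≤ |C| * 1 := by rw [mul_one]; exact (h1 hz).trans (le_abs_self C)
    _ ≤ |C| * T z ^ N := mul_le_mul_of_nonneg_left (one_le_pow₀ (hT z hz)) (abs_nonneg _)

/-- Two local bounds merge by taking the larger exponent, again in `E`, and adding the constants; `T
≥ 1` makes this legitimate. A general monotone predicate `P` is used so that bounds holding
simultaneously for all tangent vectors are covered. In the applications `E` is `{0}` for Poincaré
growth, `Set.univ` for log-log growth and `{1}` for bounds linear in `T`. -/
theorem exists_uniform_of_isCompact (hT : ∀ z ∉ D, 1 ≤ T z) (hE : E.Nonempty) {K : Set X}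
    (hK : IsCompact K) {P : X → ℝ → Prop} (hP : ∀ z s t, s ≤ t → P z s → P z t)
    (hh : ∀ x ∈ K, ∃ N ∈ E, ∃ C : ℝ, 0 ≤ C ∧ ∀ᶠ z in 𝓝 x, z ∉ D → P z (C * T z ^ N)) :
    ∃ N ∈ E, ∃ C : ℝ, 0 ≤ C ∧ ∀ z ∈ K, z ∉ D → P z (C * T z ^ N) := by
  refine hK.induction_on (p := fun s => ∃ N ∈ E, ∃ C : ℝ, 0 ≤ C ∧
    ∀ z ∈ s, z ∉ D → P z (C * T z ^ N)) ?_ ?_ ?_ ?_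
  · obtain ⟨N, hN⟩ := hE
    exact ⟨N, hN, 0, le_rfl, by simp⟩
  · rintro s t hst ⟨N, hN, C, hC, hb⟩
    exact ⟨N, hN, C, hC, fun z hz => hb z (hst hz)⟩
  · rintro s t ⟨N, hN, C, hC, hb⟩ ⟨N', hN', C', hC', hb'⟩
    refine ⟨max N N', by rcases max_choice N N' with h | h <;> rwa [h], C + C', by positivity, ?_⟩
    intro z hz hzD
    have h3 := pow_le_pow_right₀ (hT z hzD) (le_max_left N N')
    have h4 := pow_le_pow_right₀ (hT z hzD) (le_max_right N N')
    have h5 := mul_le_mul_of_nonneg_left h3 hC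
    have h6 := mul_le_mul_of_nonneg_left h4 hC'
    have h7 : 0 ≤ T z ^ max N N' := (zero_le_one.trans (one_le_pow₀ (hT z hzD)))
    have h8 := mul_nonneg hC h7
    have h9 := mul_nonneg hC' h7
    rcases hz with hz | hz
    · exact hP z _ _ (by linarith) (hb z hz hzD)
    · exact hP z _ _ (by linarith) (hb' z hz hzD)
  · intro x hx
    obtain ⟨N, hN, C, hC, hb⟩ := hh x hx
    exact ⟨_, mem_nhdsWithin_of_mem_nhds hb, N, hN, C, hC, fun z hz => hz⟩

theorem exists_bound_of_isCompact (hT : ∀ z ∉ D, 1 ≤ T z) (hE : E.Nonempty) {K : Set X}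
    (hK : IsCompact K) (hh : ∀ x ∈ K, LocBound D T E x h) :
    ∃ N ∈ E, ∃ C : ℝ, 0 ≤ C ∧ ∀ z ∈ K, z ∉ D → h z ≤ C * T z ^ N :=
  exists_uniform_of_isCompact (P := fun z t => h z ≤ t) hT hE hK
    (fun _ _ _ hst h => h.trans hst) hh

end LocalBounds

/-! ### Growth classes of coefficients and forms, expressed by powers of T. -/

section Tame

variable {n : ℕ} {X : Type*} [TopologicalSpace X] [ChartedSpace (Cn n) X]

/-- Smooth functions on `V ∖ D`, with `V` the domain of `c`, that are locally on `V` bounded by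
multiples of `T ^ N` with `N ∈ E`. -/
structure Tame (D : Set X) (T : X → ℝ) (E : Set ℕ) (c : OpenPartialHomeomorph X (Cn n))
    (g : X → ℂ) : Prop where
  smooth : ContMDiffOn 𝓘(ℝ, Cn n) 𝓘(ℝ, ℂ) ∞ g (c.source \ D)
  bound : ∀ x ∈ c.source, LocBound D T E x (fun z => ‖g z‖)

variable {D : Set X} {T : X → ℝ} {E : Set ℕ} {c : OpenPartialHomeomorph X (Cn n)} {g g' : X → ℂ}

theorem Tame.add (hT : ∀ z ∉ D, 1 ≤ T z) (hg : Tame D T E c g) (hg' : Tame D T E c g') :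
    Tame D T E c (fun z => g z + g' z) where
  smooth := hg.smooth.add hg'.smooth
  bound x hx := ((hg.bound x hx).add hT (hg'.bound x hx)).mono
    (Filter.Eventually.of_forall fun _ _ => norm_add_le _ _)

theorem Tame.const_mul (hg : Tame D T E c g) (a : ℂ) : Tame D T E c (fun z => a * g z) where
  smooth := by
    have h : ContDiff ℝ ∞ fun w : ℂ => a * w := contDiff_const.mul contDiff_id
    exact h.contMDiff.comp_contMDiffOn hg.smooth
  bound x hx := ((hg.bound x hx).const_mul (norm_nonneg a)).mono
    (Filter.Eventually.of_forall fun z _ => (norm_mul _ _).le)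

theorem exists_relCompactOpen [LocallyCompactSpace X] [RegularSpace X] {V : Set X} (hV : IsOpen V)
    {x : X} (hx : x ∈ V) : ∃ V', RelCompactOpen V' V ∧ x ∈ V' := by
  obtain ⟨U, hU, hxU, hUV, hc⟩ := exists_open_between_and_isCompact_closure
    (isCompact_singleton (x := x)) hV (by simpa using hx)
  exact ⟨U, ⟨hU, hc, hUV⟩, by simpa using hxU⟩

theorem tame_iff_bddCoeff [LocallyCompactSpace X] [RegularSpace X] (hT : ∀ z ∉ D, 1 ≤ T z) :
    Tame D T {0} c g ↔ BddCoeff D c g := by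
  constructor
  · rintro ⟨h1, h2⟩
    refine ⟨h1, fun V' hV' => ?_⟩
    obtain ⟨N, hN, C, -, hb⟩ := exists_bound_of_isCompact hT (Set.singleton_nonempty 0) hV'.2.1
      (fun x hx => h2 x (hV'.2.2 hx))
    rw [Set.mem_singleton_iff] at hN
    subst hN
    exact ⟨C, fun x hx => by simpa using hb x (subset_closure hx.1) hx.2⟩
  · rintro ⟨h1, h2⟩
    refine ⟨h1, fun x hx => ?_⟩
    obtain ⟨V', hV', hxV'⟩ := exists_relCompactOpen c.open_source hx
    obtain ⟨C, hC⟩ := h2 V' hV'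
    refine LocBound.of_le_const hT (Set.singleton_nonempty 0) C ?_
    filter_upwards [hV'.1.mem_nhds hxV'] with z hz hzD using hC z ⟨hz, hzD⟩

/-- The product of the `log log |z_k|⁻¹` over the coordinates defining `D`. -/
noncomputable def logLogProd (c : OpenPartialHomeomorph X (Cn n)) (r : ℕ) (x : X) : ℝ :=
  ∏ k ∈ Finset.univ.filter (fun k : Fin n => (k : ℕ) < r), Real.log (Real.log (‖c x k‖⁻¹))

/-- The chart-dependent weight can be traded for the global one: as the exponent in log-log growth
is free, it suffices that each weight is locally bounded by a multiple of a power of the other. -/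
theorem tame_iff_logLogCoeff [LocallyCompactSpace X] [RegularSpace X] (hT : ∀ z ∉ D, 1 ≤ T z)
    {r : ℕ} (hpos : ∀ z ∈ c.source, z ∉ D → 0 < logLogProd c r z)
    (h1 : ∀ x ∈ c.source, ∃ C, ∀ᶠ z in 𝓝 x, z ∉ D → T z ≤ C * logLogProd c r z)
    (h2 : ∀ x ∈ c.source, ∃ C, ∃ M : ℕ, ∀ᶠ z in 𝓝 x, z ∉ D → logLogProd c r z ≤ C * T z ^ M) :
    Tame D T Set.univ c g ↔ LogLogCoeff D c r g := by
  constructor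
  · rintro ⟨hs, hb⟩
    refine ⟨hs, fun V' hV' => ?_⟩
    obtain ⟨N, -, C, hC, hb⟩ := exists_bound_of_isCompact hT Set.univ_nonempty hV'.2.1
      (fun x hx => hb x (hV'.2.2 hx))
    -- Exponent set `{0}` applied to the quotient of the two weights turns the local comparison
    -- constants into a single one on the compact closure.
    obtain ⟨N', hN', C', hC', hb'⟩ := exists_bound_of_isCompact (E := {0})
      (h := fun z => T z / logLogProd c r z) hT
      (Set.singleton_nonempty 0) hV'.2.1 (fun x hx => by
        obtain ⟨C, hC⟩ := h1 x (hV'.2.2 hx)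
        refine LocBound.of_le_const hT (Set.singleton_nonempty 0) C ?_
        filter_upwards [hC, c.open_source.mem_nhds (hV'.2.2 hx)] with z hz hzs hzD
        rw [div_le_iff₀ (hpos z hzs hzD)]
        exact hz hzD)
    rw [Set.mem_singleton_iff] at hN'
    subst hN'
    refine ⟨N, C * C' ^ N, fun x hx => (hb x (subset_closure hx.1) hx.2).trans ?_⟩
    have hp := hpos x (hV'.2.2 (subset_closure hx.1)) hx.2
    have h3 := hb' x (subset_closure hx.1) hx.2
    rw [pow_zero, mul_one, div_le_iff₀ hp] at h3
    rw [Finset.prod_pow, mul_assoc, ← mul_pow]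
    exact mul_le_mul_of_nonneg_left
      (pow_le_pow_left₀ (zero_le_one.trans (hT x hx.2)) h3 N) hC
  · rintro ⟨hs, hb⟩
    refine ⟨hs, fun x hx => ?_⟩
    obtain ⟨V', hV', hxV'⟩ := exists_relCompactOpen c.open_source hx
    obtain ⟨N, C, hC⟩ := hb V' hV'
    obtain ⟨C', M, hC'⟩ := h2 x hx
    refine ⟨M * N, Set.mem_univ _, |C| * |C'| ^ N, by positivity, ?_⟩
    filter_upwards [hV'.1.mem_nhds hxV', hC', c.open_source.mem_nhds hx] with z hz h3 hzs hzD
    have h4 := hC z ⟨hz, hzD⟩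
    rw [Finset.prod_pow] at h4
    have hp := hpos z hzs hzD
    have hTp : 0 ≤ T z ^ M := pow_nonneg (zero_le_one.trans (hT z hzD)) M
    calc ‖g z‖ ≤ C * logLogProd c r z ^ N := h4
      _ ≤ |C| * logLogProd c r z ^ N :=
        mul_le_mul_of_nonneg_right (le_abs_self C) (pow_nonneg hp.le N)
      _ ≤ |C| * (|C'| * T z ^ M) ^ N := by
        refine mul_le_mul_of_nonneg_left (pow_le_pow_left₀ hp.le ?_ N) (abs_nonneg _)
        exact (h3 hzD).trans (mul_le_mul_of_nonneg_right (le_abs_self C') hTp)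
      _ = |C| * |C'| ^ N * T z ^ (M * N) := by rw [mul_pow, pow_mul]; ring

theorem GeneratedBy.congr_iff {P Q : (X → ℂ) → Prop} {r p : ℕ} {α : Form (n := n) X p}
    (h : ∀ g, P g ↔ Q g) : GeneratedBy P D c r α ↔ GeneratedBy Q D c r α := by
  have : P = Q := funext fun g => propext (h g)
  rw [this]

theorem GeneratedBy.add {P : (X → ℂ) → Prop} (hP : ∀ g g', P g → P g' → P (fun z => g z + g' z))
    {r p : ℕ} {α β γ : Form (n := n) X p} (hα : GeneratedBy P D c r α)
    (hβ : GeneratedBy P D c r β) (hγ : ∀ x ∈ c.source \ D, γ x = α x + β x) :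
    GeneratedBy P D c r γ := by
  obtain ⟨a, ha, ha'⟩ := hα
  obtain ⟨b, hb, hb'⟩ := hβ
  refine ⟨fun I z => a I z + b I z, fun I => hP _ _ (ha I) (hb I), fun x hx v => ?_⟩
  rw [hγ x hx]
  simp only [add_mul, Finset.sum_add_distrib, ← ha' x hx v, ← hb' x hx v]
  rfl

theorem GeneratedBy.const_smul {P : (X → ℂ) → Prop} {a : ℂ}
    (hP : ∀ g, P g → P (fun z => a * g z))
    {r p : ℕ} {α γ : Form (n := n) X p} (hα : GeneratedBy P D c r α)
    (hγ : ∀ x ∈ c.source \ D, γ x = a • α x) :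
    GeneratedBy P D c r γ := by
  obtain ⟨b, hb, hb'⟩ := hα
  refine ⟨fun I z => a * b I z, fun I => hP _ (hb I), fun x hx v => ?_⟩
  rw [hγ x hx]
  simp only [mul_assoc, ← Finset.mul_sum, ← hb' x hx v]
  rfl

theorem norm_zetaFrame_le (r : ℕ) (a : Fin n ⊕ Fin n) (x : X)
    (v : TangentSpace 𝓘(ℝ, Cn n) x) :
    ‖zetaFrame c r a x v‖ ^ 2 ≤ ∑ k, ‖dZeta c r k x v‖ ^ 2 := by
  rcases a with k | k
  · exact Finset.single_le_sum (f := fun k => ‖dZeta c r k x v‖ ^ 2) (fun _ _ => by positivity)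
      (Finset.mem_univ k)
  · have : ‖zetaFrame c r (Sum.inr k) x v‖ = ‖dZeta c r k x v‖ := by simp [zetaFrame]
    rw [this]
    exact Finset.single_le_sum (f := fun k => ‖dZeta c r k x v‖ ^ 2) (fun _ _ => by positivity)
      (Finset.mem_univ k)

theorem norm_zetaFrame_le_sum (r : ℕ) (a : Fin n ⊕ Fin n) (x : X)
    (v : TangentSpace 𝓘(ℝ, Cn n) x) :
    ‖zetaFrame c r a x v‖ ≤ ∑ k, ‖dZeta c r k x v‖ := by
  rcases a with k | k
  · exact Finset.single_le_sum (f := fun k => ‖dZeta c r k x v‖) (fun _ _ => by positivity)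
      (Finset.mem_univ k)
  · have : ‖zetaFrame c r (Sum.inr k) x v‖ = ‖dZeta c r k x v‖ := by simp [zetaFrame]
    rw [this]
    exact Finset.single_le_sum (f := fun k => ‖dZeta c r k x v‖) (fun _ _ => by positivity)
      (Finset.mem_univ k)

theorem dZeta_eq (r : ℕ) (k : Fin n) (x : X) (v : TangentSpace 𝓘(ℝ, Cn n) x) :
    dZeta c r k x v = (if (k : ℕ) < r then (c x k * (Real.log (‖c x k‖⁻¹) : ℂ))⁻¹ else 1) *
      chartDeriv c x v k := rfl

theorem norm_dZeta_J [IsManifold 𝓘(ℂ, Cn n) ω X] (hc : c ∈ maximalAtlas 𝓘(ℂ, Cn n) ω X) {x : X}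
    (hx : x ∈ c.source) (r : ℕ) (k : Fin n) (v : TangentSpace 𝓘(ℝ, Cn n) x) :
    ‖dZeta c r k x (J x v)‖ = ‖dZeta c r k x v‖ := by
  have : chartDeriv c x (J x v) = Complex.I • chartDeriv c x v := chartDeriv_I_smul hc hx v
  rw [dZeta_eq, dZeta_eq, this, norm_mul, norm_mul]
  simp

theorem GeneratedBy.bound_oneForm (hT : ∀ z ∉ D, 1 ≤ T z) (hE : E.Nonempty) {r : ℕ}
    {α : Form (n := n) X 1} (hα : GeneratedBy (Tame D T E c) D c r α) {x : X} (hx : x ∈ c.source) :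
    ∃ N ∈ E, ∃ C : ℝ, 0 ≤ C ∧ ∀ᶠ z in 𝓝 x, z ∉ D → ∀ v : Fin 1 → TangentSpace 𝓘(ℝ, Cn n) z,
      ‖α z v‖ ≤ C * T z ^ N * ∑ k, ‖dZeta c r k z (v 0)‖ := by
  obtain ⟨γ, hγ, hα⟩ := hα
  obtain ⟨N, hN, C, hC, hb⟩ := LocBound.sum hT hE Finset.univ (fun I _ => (hγ I).bound x hx)
  refine ⟨N, hN, C, hC, ?_⟩
  filter_upwards [hb, c.open_source.mem_nhds hx] with z hz hzs hzD v
  rw [hα z ⟨hzs, hzD⟩]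
  calc _ ≤ ∑ I, ‖γ I z * (Matrix.of fun i j => zetaFrame c r (I i) z (v j)).det‖ :=
        norm_sum_le _ _
    _ ≤ ∑ I, ‖γ I z‖ * ∑ k, ‖dZeta c r k z (v 0)‖ := by
      refine Finset.sum_le_sum fun I _ => ?_
      rw [norm_mul, Matrix.det_fin_one]
      exact mul_le_mul_of_nonneg_left (norm_zetaFrame_le_sum r _ z (v 0)) (norm_nonneg _)
    _ ≤ _ := by
      rw [← Finset.sum_mul]
      exact mul_le_mul_of_nonneg_right (hz hzD) (Finset.sum_nonneg fun _ _ => norm_nonneg _)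

/-- Each dζ_k is complex linear, so `J` does not change its absolute value on a vector. A 2 × 2
determinant is then at most 2|a||b| ≤ |a|² + |b|², and both squares are bounded by the squared
Poincaré length of `v`. -/
theorem GeneratedBy.bound_twoForm [IsManifold 𝓘(ℂ, Cn n) ω X]
    (hc : c ∈ maximalAtlas 𝓘(ℂ, Cn n) ω X) (hT : ∀ z ∉ D, 1 ≤ T z) (hE : E.Nonempty)
    {r : ℕ} {α : Form (n := n) X 2} (hα : GeneratedBy (Tame D T E c) D c r α) {x : X}
    (hx : x ∈ c.source) :
    ∃ N ∈ E, ∃ C : ℝ, 0 ≤ C ∧ ∀ᶠ z in 𝓝 x, z ∉ D → ∀ v : TangentSpace 𝓘(ℝ, Cn n) z,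
      ‖α z ![v, J z v]‖ ≤ C * T z ^ N * ∑ k, ‖dZeta c r k z v‖ ^ 2 := by
  obtain ⟨γ, hγ, hα⟩ := hα
  obtain ⟨N, hN, C, hC, hb⟩ := LocBound.sum hT hE Finset.univ (fun I _ => (hγ I).bound x hx)
  refine ⟨N, hN, 2 * C, by positivity, ?_⟩
  filter_upwards [hb, c.open_source.mem_nhds hx] with z hz hzs hzD v
  rw [hα z ⟨hzs, hzD⟩]
  have hnJ (a : Fin n ⊕ Fin n) : ‖zetaFrame c r a z (J z v)‖ = ‖zetaFrame c r a z v‖ := by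
    rcases a with k | k <;> simp [zetaFrame, norm_dZeta_J hc hzs]
  calc _ ≤ ∑ I, ‖γ I z * (Matrix.of fun i j =>
          zetaFrame c r (I i) z ((![v, J z v] : Fin 2 → TangentSpace 𝓘(ℝ, Cn n) z) j)).det‖ :=
        norm_sum_le _ _
    _ ≤ ∑ I, ‖γ I z‖ * (2 * ∑ k, ‖dZeta c r k z v‖ ^ 2) := by
      refine Finset.sum_le_sum fun I _ => ?_
      rw [norm_mul, Matrix.det_fin_two]
      refine mul_le_mul_of_nonneg_left ?_ (norm_nonneg _)
      have h0 := norm_zetaFrame_le (c := c) r (I 0) z v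
      have h1 := norm_zetaFrame_le (c := c) r (I 1) z v
      refine (norm_sub_le _ _).trans ?_
      simp only [Matrix.of_apply, Matrix.cons_val_zero, Matrix.cons_val_one, norm_mul, hnJ]
      nlinarith [sq_nonneg (‖zetaFrame c r (I 0) z v‖ - ‖zetaFrame c r (I 1) z v‖)]
    _ ≤ _ := by
      rw [← Finset.sum_mul]
      have h3 : 0 ≤ ∑ k, ‖dZeta c r k z v‖ ^ 2 := Finset.sum_nonneg fun _ _ => by positivity
      calc _ ≤ (C * T z ^ N) * (2 * ∑ k, ‖dZeta c r k z v‖ ^ 2) :=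
            mul_le_mul_of_nonneg_right (hz hzD) (by positivity)
        _ = _ := by ring

end Tame

/-! ### The frame dual to the forms dζ_k. -/

section Frame

variable {n : ℕ}

/-- The scaling factors relating the forms `dz_k` and `dζ_k`. -/
noncomputable def tau (r : ℕ) (k : Fin n) (y : Cn n) : ℂ :=
  if (k : ℕ) < r then y k * (Real.log (‖y k‖⁻¹) : ℂ) else 1

/-- The vectors dual to the forms `dζ_k`, multiplied by the scalar `ε`. -/
noncomputable def frameVec (r : ℕ) (k : Fin n) (ε : ℂ) (y : Cn n) : Cn n :=
  Pi.single k (ε * tau r k y)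

/-- The coefficients of a real linear form in the basis of the `τ_k⁻¹ dz_k` and their
conjugates. -/
noncomputable def frameCoeff (τ : Fin n → ℂ) (A : Cn n → ℂ) : Fin n ⊕ Fin n → ℂ :=
  Sum.elim
    (fun k => (1 / 2) * A (Pi.single k (1 * τ k)) +
      (-(Complex.I / 2)) * A (Pi.single k (Complex.I * τ k)))
    (fun k => (1 / 2) * A (Pi.single k (1 * τ k)) +
      (Complex.I / 2) * A (Pi.single k (Complex.I * τ k)))

/-- The values of the forms `τ_k⁻¹ dz_k` and of their conjugates. -/
noncomputable def frameForm (τ : Fin n → ℂ) (a : Fin n ⊕ Fin n) (u : Cn n) : ℂ :=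
  Sum.elim (fun k => (τ k)⁻¹ * u k) (fun k => starRingEnd ℂ ((τ k)⁻¹ * u k)) a

/-- The vectors τ_k e_k and iτ_k e_k form a real basis of ℂⁿ. Splitting the coordinate z = u_k/τ_k
into (z ± z̄)/2 produces the coefficients (A(τ_k e_k) ∓ i A(iτ_k e_k))/2 of z and z̄. -/
theorem sum_frame {τ : Fin n → ℂ} (hτ : ∀ k, τ k ≠ 0) (A : Cn n →ₗ[ℝ] ℂ) (u : Cn n) :
    A u = ∑ a, frameForm τ a u * frameCoeff τ A a := by
  have hu : u = ∑ k, (((τ k)⁻¹ * u k).re • (Pi.single k (1 * τ k) : Cn n) +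
      ((τ k)⁻¹ * u k).im • (Pi.single k (Complex.I * τ k) : Cn n)) := by
    ext j
    rw [Finset.sum_apply, Finset.sum_eq_single j]
    · have h := Complex.re_add_im ((τ j)⁻¹ * u j)
      simp only [Pi.add_apply, Pi.smul_apply, Pi.single_eq_same, Complex.real_smul]
      have h2 : u j = ((τ j)⁻¹ * u j) * τ j := by field_simp [hτ j]
      conv_lhs => rw [h2, ← h]
      ring
    · intro k _ hk
      simp [hk.symm]
    · simp
  conv_lhs => rw [hu]
  rw [map_sum, Fintype.sum_sum_type, ← Finset.sum_add_distrib]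
  refine Finset.sum_congr rfl fun k _ => ?_
  simp only [frameForm, frameCoeff, Sum.elim_inl, Sum.elim_inr, map_add, map_smul,
    Complex.real_smul]
  generalize A (Pi.single k (1 * τ k)) = A1
  generalize A (Pi.single k (Complex.I * τ k)) = A2
  generalize (τ k)⁻¹ * u k = z
  have h' : starRingEnd ℂ z = (z.re : ℂ) - (z.im : ℂ) * Complex.I := by
    apply Complex.ext <;> simp
  have h : z = (z.re : ℂ) + (z.im : ℂ) * Complex.I := (Complex.re_add_im z).symm
  rw [h']
  generalize (z.re : ℂ) = p at h ⊢
  generalize (z.im : ℂ) = q at h ⊢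
  rw [h]
  linear_combination (q * A2) * Complex.I_sq

theorem contDiffAt_tau {r : ℕ} {k : Fin n} {y : Cn n} (hy : (k : ℕ) < r → y k ≠ 0) :
    ContDiffAt ℝ ∞ (tau r k) y := by
  unfold tau
  by_cases hk : (k : ℕ) < r
  · simp only [hk, if_true]
    have h1 : ContDiffAt ℝ ∞ (fun y : Cn n => y k) y := (contDiff_apply ℝ ℂ k).contDiffAt
    have h2 : ContDiffAt ℝ ∞ (fun y : Cn n => Real.log (‖y k‖⁻¹)) y :=
      ((h1.norm ℝ (hy hk)).inv (norm_ne_zero_iff.2 (hy hk))).log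
        (inv_ne_zero (norm_ne_zero_iff.2 (hy hk)))
    exact h1.mul (Complex.ofRealCLM.contDiff.contDiffAt.comp y h2)
  · simp only [hk, if_false]
    exact contDiffAt_const

theorem contDiffAt_frameVec {r : ℕ} {k : Fin n} (ε : ℂ) {y : Cn n}
    (hy : (k : ℕ) < r → y k ≠ 0) : ContDiffAt ℝ ∞ (frameVec r k ε) y := by
  have h : ContDiffAt ℝ ∞ (fun y => ε * tau r k y) y := contDiffAt_const.mul (contDiffAt_tau hy)
  exact (ContinuousLinearMap.single ℝ (fun _ : Fin n => ℂ) k).contDiff.contDiffAt.comp y h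

theorem ContDiffAt.fderiv_frameVec {F : Cn n → ℝ} {r : ℕ} {k : Fin n} (ε : ℂ) {y : Cn n}
    (hF : ContDiffAt ℝ ∞ F y) (hy : (k : ℕ) < r → y k ≠ 0) :
    ContDiffAt ℝ ∞ (fun y => fderiv ℝ F y (frameVec r k ε y)) y :=
  (hF.fderiv_right (m := ∞) (by simp)).clm_apply (contDiffAt_frameVec ε hy)

theorem ContDiffAt.lev_frameVec {F : Cn n → ℝ} {r : ℕ} {k l : Fin n} (ε δ : ℂ) {y : Cn n}
    (hF : ContDiffAt ℝ ∞ F y) (hk : (k : ℕ) < r → y k ≠ 0) (hl : (l : ℕ) < r → y l ≠ 0) :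
    ContDiffAt ℝ ∞ (fun y => lev F y (frameVec r k ε y) (frameVec r l δ y)) y := by
  have h1 : ContDiffAt ℝ ∞ (fderiv ℝ (fderiv ℝ F)) y :=
    (hF.fderiv_right (m := ∞) (by simp)).fderiv_right (m := ∞) (by simp)
  have h2 := contDiffAt_frameVec ε hk
  have h3 := contDiffAt_frameVec δ hl
  have h4 : ContDiffAt ℝ ∞ (fun y => Complex.I • frameVec r k ε y) y :=
    mulI.contDiff.contDiffAt.comp y h2
  have h5 : ContDiffAt ℝ ∞ (fun y => Complex.I • frameVec r l δ y) y :=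
    mulI.contDiff.contDiffAt.comp y h3
  exact ((h1.clm_apply h2).clm_apply h5).sub ((h1.clm_apply h3).clm_apply h4)

theorem tau_ne_zero {r : ℕ} {k : Fin n} {y : Cn n} (h1 : ‖y k‖ < 1)
    (hy : (k : ℕ) < r → y k ≠ 0) : tau r k y ≠ 0 := by
  unfold tau
  split_ifs with h
  · have h0 : 0 < ‖y k‖ := norm_pos_iff.2 (hy h)
    refine mul_ne_zero (hy h) ?_
    have := Real.log_pos (one_lt_inv₀ h0 |>.2 h1)
    exact_mod_cast this.ne'
  · exact one_ne_zero

end Frame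

/-! ### Growth of a form read off from its values on the dual frame. -/

section Generation

variable {n : ℕ} {X : Type*} [TopologicalSpace X] [ChartedSpace (Cn n) X]
  {D : Set X} {T : X → ℝ} {E : Set ℕ} {c : OpenPartialHomeomorph X (Cn n)} {r : ℕ}

theorem IsAdapted.ne_zero (hc : IsAdapted D c r) {x : X} (hx : x ∈ c.source \ D) {k : Fin n}
    (hk : (k : ℕ) < r) : c x k ≠ 0 := fun h =>
  hx.2 ((hc.cutOut.2 x hx.1).2 ⟨k, hk, h⟩)

theorem IsAdapted.norm_lt_one (hc : IsAdapted D c r) {x : X} (hx : x ∈ c.source) (k : Fin n) :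
    ‖c x k‖ < 1 := by
  refine (hc.small x hx k).trans_le ?_
  rw [div_le_one (Real.exp_pos 1)]
  exact Real.one_le_exp zero_le_one

theorem IsAdapted.tau_ne_zero (hc : IsAdapted D c r) {x : X} (hx : x ∈ c.source \ D) (k : Fin n) :
    tau r k (c x) ≠ 0 :=
  LogLog.tau_ne_zero (hc.norm_lt_one hx.1 k) (hc.ne_zero hx)

theorem zetaFrame_eq (a : Fin n ⊕ Fin n) (x : X) (v : TangentSpace 𝓘(ℝ, Cn n) x) :
    zetaFrame c r a x v = frameForm (fun k => tau r k (c x)) a (chartDeriv c x v) := by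
  have h (k : Fin n) : dZeta c r k x v = (tau r k (c x))⁻¹ * chartDeriv c x v k := by
    rw [dZeta_eq, tau]
    split_ifs <;> simp
  rcases a with k | k <;> simp [zetaFrame, frameForm, h]

/-- The coefficients demanded by `GeneratedBy` are fixed linear combinations of the values on frame
vectors, so membership in the class `P` needs to be checked only for those values. -/
theorem generatedBy_one_of_frame {P : (X → ℂ) → Prop}
    (hadd : ∀ g g', P g → P g' → P (fun z => g z + g' z))
    (hmul : ∀ (a : ℂ) g, P g → P (fun z => a * g z)) (hc : IsAdapted D c r)
    {α : Form (n := n) X 1} (A : X → Cn n →ₗ[ℝ] ℂ)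
    (hα : ∀ x ∈ c.source \ D, ∀ v, α x v = A x (chartDeriv c x (v 0)))
    (hA : ∀ k, ∀ ε ∈ ({1, Complex.I} : Set ℂ), P (fun x => A x (frameVec r k ε (c x)))) :
    GeneratedBy P D c r α := by
  have hP (a : Fin n ⊕ Fin n) : P (fun x => frameCoeff (fun k => tau r k (c x)) (A x) a) := by
    rcases a with k | k <;>
    exact hadd _ _ (hmul _ _ (hA k 1 (by simp))) (hmul _ _ (hA k Complex.I (by simp)))
  refine ⟨fun I x => frameCoeff (fun k => tau r k (c x)) (A x) (I 0), fun I => hP (I 0),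
    fun x hx v => ?_⟩
  rw [hα x hx, sum_frame (hc.tau_ne_zero hx),
    ← (Equiv.funUnique (Fin 1) (Fin n ⊕ Fin n)).sum_comp]
  refine Finset.sum_congr rfl fun I _ => ?_
  rw [Matrix.det_fin_one, mul_comm]
  simp [zetaFrame_eq]

theorem generatedBy_two_of_frame {P : (X → ℂ) → Prop}
    (hadd : ∀ g g', P g → P g' → P (fun z => g z + g' z))
    (hmul : ∀ (a : ℂ) g, P g → P (fun z => a * g z)) (hc : IsAdapted D c r)
    {α : Form (n := n) X 2} (B : X → Cn n →ₗ[ℝ] Cn n →ₗ[ℝ] ℂ)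
    (hanti : ∀ x v w, B x v w = - B x w v)
    (hα : ∀ x ∈ c.source \ D, ∀ v, α x v = B x (chartDeriv c x (v 0)) (chartDeriv c x (v 1)))
    (hB : ∀ k l, ∀ ε ∈ ({1, Complex.I} : Set ℂ), ∀ δ ∈ ({1, Complex.I} : Set ℂ),
      P (fun x => B x (frameVec r k ε (c x)) (frameVec r l δ (c x)))) :
    GeneratedBy P D c r α := by
  set β : X → Fin n ⊕ Fin n → Fin n ⊕ Fin n → ℂ := fun x a b =>
    frameCoeff (fun k => tau r k (c x)) (fun u => frameCoeff (fun k => tau r k (c x)) (B x u) b) a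
    with hβdef
  have hβ (x : X) (hx : x ∈ c.source \ D) (v w : Cn n) :
      B x v w = ∑ a, ∑ b, β x a b * (frameForm (fun k => tau r k (c x)) a v *
        frameForm (fun k => tau r k (c x)) b w) := by
    have hτ := hc.tau_ne_zero hx
    set τ : Fin n → ℂ := fun k => tau r k (c x)
    have h1 (b : Fin n ⊕ Fin n) : ∃ L : Cn n →ₗ[ℝ] ℂ, ∀ u, L u = frameCoeff τ (B x u) b := by
      rcases b with k | k
      · exact ⟨(1 / 2 : ℂ) • (B x).flip (Pi.single k (1 * τ k)) +
          (-(Complex.I / 2)) • (B x).flip (Pi.single k (Complex.I * τ k)), fun u => by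
            simp [frameCoeff]⟩
      · exact ⟨(1 / 2 : ℂ) • (B x).flip (Pi.single k (1 * τ k)) +
          (Complex.I / 2) • (B x).flip (Pi.single k (Complex.I * τ k)), fun u => by
            simp [frameCoeff]⟩
    rw [sum_frame hτ (B x v), Finset.sum_comm]
    refine Finset.sum_congr rfl fun b _ => ?_
    obtain ⟨L, hL⟩ := h1 b
    rw [← hL, sum_frame hτ L, Finset.mul_sum]
    refine Finset.sum_congr rfl fun a _ => ?_
    have : (L : Cn n → ℂ) = fun u => frameCoeff τ (B x u) b := funext hL
    rw [this]
    simp only [hβdef]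
    ring
  have hPβ (a b : Fin n ⊕ Fin n) : P (fun x => β x a b) := by
    have h1 (k : Fin n) (ε : ℂ) (hε : ε ∈ ({1, Complex.I} : Set ℂ)) : P (fun x =>
        frameCoeff (fun k => tau r k (c x)) (B x (Pi.single k (ε * tau r k (c x)))) b) := by
      rcases b with l | l <;>
      exact hadd _ _ (hmul _ _ (hB k l ε hε 1 (by simp)))
        (hmul _ _ (hB k l ε hε Complex.I (by simp)))
    rcases a with k | k <;>
    exact hadd _ _ (hmul _ _ (h1 k 1 (by simp))) (hmul _ _ (h1 k Complex.I (by simp)))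
  -- The sum runs over ordered pairs and each determinant is already antisymmetrized, hence the
  -- factor 1/2.
  refine ⟨fun I x => (1 / 2) * β x (I 0) (I 1), fun I => hmul _ _ (hPβ _ _), fun x hx v => ?_⟩
  rw [hα x hx, ← (finTwoArrowEquiv (Fin n ⊕ Fin n)).symm.sum_comp, Fintype.sum_prod_type]
  set v0 := chartDeriv c x (v 0) with hv0
  set v1 := chartDeriv c x (v 1) with hv1
  have h2 : B x v0 v1 = (1 / 2) * (B x v0 v1 - B x v1 v0) := by rw [hanti x v1 v0]; ring
  rw [h2, hβ x hx v0 v1, hβ x hx v1 v0, ← Finset.sum_sub_distrib, Finset.mul_sum]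
  refine Finset.sum_congr rfl fun a _ => ?_
  rw [← Finset.sum_sub_distrib, Finset.mul_sum]
  refine Finset.sum_congr rfl fun b _ => ?_
  rw [Matrix.det_fin_two]
  simp only [finTwoArrowEquiv_symm_apply, Matrix.cons_val_zero, Matrix.cons_val_one,
    Matrix.of_apply, zetaFrame_eq, ← hv0, ← hv1]
  ring

end Generation

/-! ### Calculus of the Levi form, and pluriharmonicity of log |z_i|. -/

section LevCalculus

variable {n : ℕ}

theorem ContDiffAt.eventually_differentiableAt {F : Cn n → ℝ} {y : Cn n}
    (hF : ContDiffAt ℝ ∞ F y) : ∀ᶠ z in 𝓝 y, DifferentiableAt ℝ F z := by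
  filter_upwards [(hF.of_le (m := 1) (by norm_cast)).eventually (by simp)] with z hz
  exact hz.differentiableAt one_ne_zero

theorem lev_eq_of_eventuallyEq {F G : Cn n → ℝ} {y : Cn n} (h : F =ᶠ[𝓝 y] G) :
    lev F y = lev G y := by
  ext v w
  rw [lev, lev, h.fderiv.fderiv_eq]

theorem lev_add {F G : Cn n → ℝ} {y : Cn n} (hF : ContDiffAt ℝ ∞ F y) (hG : ContDiffAt ℝ ∞ G y)
    (v w : Cn n) : lev (fun z => F z + G z) y v w = lev F y v w + lev G y v w := by
  have h : fderiv ℝ (fun z => F z + G z) =ᶠ[𝓝 y] fun z => fderiv ℝ F z + fderiv ℝ G z := by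
    filter_upwards [ContDiffAt.eventually_differentiableAt hF,
      ContDiffAt.eventually_differentiableAt hG] with z h1 h2
    exact fderiv_fun_add h1 h2
  rw [lev, h.fderiv_eq, fderiv_fun_add (ContDiffAt.differentiableAt_fderiv hF)
    (ContDiffAt.differentiableAt_fderiv hG), lev, lev]
  simp only [add_apply]
  ring

theorem lev_const_mul {F : Cn n → ℝ} {y : Cn n} (a : ℝ) (hF : ContDiffAt ℝ ∞ F y)
    (v w : Cn n) : lev (fun z => a * F z) y v w = a * lev F y v w := by
  have h : fderiv ℝ (fun z => a * F z) =ᶠ[𝓝 y] fun z => a • fderiv ℝ F z := by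
    filter_upwards [ContDiffAt.eventually_differentiableAt hF] with z h1
    exact fderiv_const_mul h1 a
  rw [lev, h.fderiv_eq, fderiv_fun_const_smul (ContDiffAt.differentiableAt_fderiv hF), lev]
  simp only [smul_apply, smul_eq_mul]
  ring

theorem lev_sum {ι : Type*} (s : Finset ι) {F : ι → Cn n → ℝ} {y : Cn n}
    (hF : ∀ i ∈ s, ContDiffAt ℝ ∞ (F i) y) (v w : Cn n) :
    lev (fun z => ∑ i ∈ s, F i z) y v w = ∑ i ∈ s, lev (F i) y v w := by
  classical
  induction s using Finset.induction_on with
  | empty => simp [lev]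
  | insert i s hi ih =>
    simp only [Finset.sum_insert hi]
    rw [lev_add (hF i (Finset.mem_insert_self _ _))
      (ContDiffAt.sum fun j hj => hF j (Finset.mem_insert_of_mem hj)),
      ih fun j hj => hF j (Finset.mem_insert_of_mem hj)]

theorem fderiv_comp_apply {F : Cn n → ℝ} {g : ℝ → ℝ} {y : Cn n} (hF : DifferentiableAt ℝ F y)
    {g' : ℝ} (hg : HasDerivAt g g' (F y)) (v : Cn n) :
    fderiv ℝ (fun z => g (F z)) y v = g' * fderiv ℝ F y v := by
  have := hg.comp_hasFDerivAt y hF.hasFDerivAt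
  rw [show (fun z => g (F z)) = g ∘ F from rfl, this.fderiv]
  simp

theorem lev_comp {F : Cn n → ℝ} {g g' : ℝ → ℝ} {y : Cn n} (hF : ContDiffAt ℝ ∞ F y)
    (hg : ∀ᶠ t in 𝓝 (F y), HasDerivAt g (g' t) t) {g'' : ℝ} (hg' : HasDerivAt g' g'' (F y))
    (v w : Cn n) :
    lev (fun z => g (F z)) y v w = g' (F y) * lev F y v w + g'' *
      (fderiv ℝ F y v * fderiv ℝ F y (Complex.I • w) -
        fderiv ℝ F y w * fderiv ℝ F y (Complex.I • v)) := by
  have h : fderiv ℝ (fun z => g (F z)) =ᶠ[𝓝 y] fun z => g' (F z) • fderiv ℝ F z := by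
    filter_upwards [ContDiffAt.eventually_differentiableAt hF,
      hF.continuousAt.eventually hg] with z h1 h2
    ext v
    rw [fderiv_comp_apply h1 h2]
    rfl
  have h1 := hg'.comp_hasFDerivAt y (hF.differentiableAt (by simp)).hasFDerivAt
  have h2 := h1.smul (ContDiffAt.differentiableAt_fderiv hF).hasFDerivAt
  have h3 : fderiv ℝ (fun z => g' (F z) • fderiv ℝ F z) y = _ := h2.fderiv
  rw [lev, h.fderiv_eq, h3, lev]
  simp only [add_apply, smul_apply, smul_eq_mul,
    ContinuousLinearMap.smulRight_apply, Function.comp_apply]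
  ring

theorem hasFDerivAt_log_norm {i : Fin n} {y : Cn n} (hy : y i ≠ 0) :
    HasFDerivAt (fun z : Cn n => Real.log ‖z i‖)
      (Complex.reCLM.comp ((y i)⁻¹ • (ContinuousLinearMap.proj (R := ℝ) i : Cn n →L[ℝ] ℂ))) y := by
  have h1 : HasFDerivAt (fun z : Cn n => z i)
      (ContinuousLinearMap.proj (R := ℝ) i : Cn n →L[ℝ] ℂ) y :=
    (ContinuousLinearMap.proj (R := ℝ) i : Cn n →L[ℝ] ℂ).hasFDerivAt
  have h2 := h1.norm_sq
  have h3 := (h2.log (by positivity)).const_mul (1 / 2 : ℝ)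
  refine (h3.congr_fderiv ?_).congr_of_eventuallyEq ?_
  · ext v
    have h0 : Complex.normSq (y i) ≠ 0 := by simpa using hy
    simp only [smul_apply, ContinuousLinearMap.comp_apply,
      ContinuousLinearMap.proj_apply, Complex.reCLM_apply, smul_eq_mul, Complex.mul_re,
      Complex.inv_re, Complex.inv_im, innerSL_apply_apply, Complex.inner, Complex.conj_re,
      Complex.conj_im, nsmul_eq_mul, ← Complex.normSq_eq_norm_sq]
    field_simp
    push_cast
    ring
  · refine Filter.Eventually.of_forall fun z => ?_
    simp only [Real.log_pow]
    push_cast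
    ring

theorem contDiffAt_log_norm {i : Fin n} {y : Cn n} (hy : y i ≠ 0) :
    ContDiffAt ℝ ∞ (fun z : Cn n => Real.log ‖z i‖) y := by
  have h1 : ContDiffAt ℝ ∞ (fun y : Cn n => y i) y := (contDiff_apply ℝ ℂ i).contDiffAt
  exact (h1.norm ℝ hy).log (norm_ne_zero_iff.2 hy)

/-- The second derivative of log |z_i| is the real part of the symmetric complex bilinear form -v_i
w_i / z_i². Moving i from one argument to the other does not change it, so the antisymmetrization
vanishes. -/
theorem lev_log_norm {i : Fin n} {y : Cn n} (hy : y i ≠ 0) (v w : Cn n) :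
    lev (fun z : Cn n => Real.log ‖z i‖) y v w = 0 := by
  have hev : ∀ᶠ z : Cn n in 𝓝 y, z i ≠ 0 := (continuous_apply i).continuousAt.eventually_ne hy
  have h : fderiv ℝ (fun z : Cn n => Real.log ‖z i‖) =ᶠ[𝓝 y] fun z =>
      Complex.reCLM.comp ((z i)⁻¹ • (ContinuousLinearMap.proj (R := ℝ) i : Cn n →L[ℝ] ℂ)) := by
    filter_upwards [hev] with z hz using (hasFDerivAt_log_norm hz).fderiv
  have h1 : HasFDerivAt (fun z : Cn n => (z i)⁻¹)
      ((-((y i) ^ 2)⁻¹) • (ContinuousLinearMap.proj (R := ℝ) i : Cn n →L[ℝ] ℂ)) y := by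
    have h2 := ((hasDerivAt_inv hy).hasFDerivAt.restrictScalars ℝ).comp y
      (ContinuousLinearMap.proj (R := ℝ) i : Cn n →L[ℝ] ℂ).hasFDerivAt
    refine h2.congr_fderiv ?_
    ext v
    simp [mul_comm]
  have key (v w : Cn n) : fderiv ℝ (fderiv ℝ (fun z : Cn n => Real.log ‖z i‖)) y v w =
      ((-((y i) ^ 2)⁻¹) * v i * w i).re := by
    have hd : DifferentiableAt ℝ (fderiv ℝ (fun z : Cn n => Real.log ‖z i‖)) y :=
      ContDiffAt.differentiableAt_fderiv (contDiffAt_log_norm hy)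
    have e1 : fderiv ℝ (fderiv ℝ (fun z : Cn n => Real.log ‖z i‖)) y v w =
        fderiv ℝ (fun z => fderiv ℝ (fun z : Cn n => Real.log ‖z i‖) z w) y v := by
      rw [(hd.hasFDerivAt.clm_apply (hasFDerivAt_const w y)).fderiv]
      simp
    have e2 : (fun z => fderiv ℝ (fun z : Cn n => Real.log ‖z i‖) z w) =ᶠ[𝓝 y]
        fun z => ((z i)⁻¹ * w i).re := by
      filter_upwards [h] with z hz
      rw [hz]
      simp
    have e3 := (Complex.reCLM.hasFDerivAt).comp y (h1.mul_const (w i))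
    have e4 : fderiv ℝ (fun z : Cn n => ((z i)⁻¹ * w i).re) y = _ := e3.fderiv
    rw [e1, e2.fderiv_eq, e4]
    simp [mul_comm, mul_left_comm]
  rw [lev, key, key]
  simp only [Pi.smul_apply, smul_eq_mul]
  rw [← Complex.sub_re, show -(y i ^ 2)⁻¹ * v i * (Complex.I * w i) -
    -(y i ^ 2)⁻¹ * w i * (Complex.I * v i) = 0 by ring, Complex.zero_re]

theorem lev_antisymm (F : Cn n → ℝ) (y v w : Cn n) : lev F y v w = - lev F y w v := by
  rw [lev, lev]; ring

/-- The form `lev` as a bilinear map. -/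
noncomputable def levBilin (F : Cn n → ℝ) (y : Cn n) : Cn n →ₗ[ℝ] Cn n →ₗ[ℝ] ℝ :=
  LinearMap.mk₂ ℝ (lev F y)
    (fun v v' w => by simp only [lev, map_add, add_apply, smul_add]; ring)
    (fun a v w => by
      simp only [lev, map_smul, smul_apply, smul_eq_mul, smul_comm Complex.I a]
      ring)
    (fun v w w' => by simp only [lev, map_add, add_apply, smul_add]; ring)
    (fun a v w => by
      simp only [lev, map_smul, smul_apply, smul_eq_mul, smul_comm Complex.I a]
      ring)

theorem eventually_norm_lt_add_one {α E : Type*} [TopologicalSpace α] [NormedAddCommGroup E]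
    {B : α → E} {x : α} (h : ContinuousAt B x) : ∀ᶠ y in 𝓝 x, ‖B y‖ < ‖B x‖ + 1 :=
  h.norm.eventually_lt continuousAt_const (lt_add_one _)

set_option synthInstance.maxHeartbeats 200000 in
-- Continuity bounds the value and the first two derivatives near the base point by their norms
-- there plus one; the factor 2 on the second derivative accounts for the two terms of `lev`.
theorem exists_bound_of_contDiffAt {b : Cn n → ℝ} {y₀ : Cn n}
    (hb' : ∀ᶠ y in 𝓝 y₀, ContDiffAt ℝ ∞ b y) :
    ∃ C : ℝ, 0 ≤ C ∧ ∀ᶠ y in 𝓝 y₀, ContDiffAt ℝ ∞ b y ∧ |b y| ≤ C ∧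
      (∀ v, |fderiv ℝ b y v| ≤ C * ‖v‖) ∧ ∀ v w, |lev b y v w| ≤ C * (‖v‖ * ‖w‖) := by
  have hb := hb'.self_of_nhds
  have hd : ContDiffAt ℝ ∞ (fderiv ℝ b) y₀ := hb.fderiv_right (m := ∞) (by simp)
  have hdd : ContDiffAt ℝ ∞ (fderiv ℝ (fderiv ℝ b)) y₀ := hd.fderiv_right (m := ∞) (by simp)
  have h0 := hb.continuousAt.norm.eventually_lt continuousAt_const (lt_add_one ‖b y₀‖)
  have h1 := hd.continuousAt.norm.eventually_lt continuousAt_const (lt_add_one ‖fderiv ℝ b y₀‖)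
  set B : Cn n → Cn n →L[ℝ] (Cn n →L[ℝ] ℝ) := fderiv ℝ (fderiv ℝ b) with hB
  have h2 : ∀ᶠ y in 𝓝 y₀, ‖B y‖ < ‖B y₀‖ + 1 :=
    eventually_norm_lt_add_one hdd.continuousAt
  set C0 := ‖b y₀‖ + 1
  set C1 := ‖fderiv ℝ b y₀‖ + 1
  set C2 := ‖B y₀‖ + 1
  have hC0 : 0 ≤ C0 := by positivity
  have hC1 : 0 ≤ C1 := by positivity
  have hC2 : 0 ≤ C2 := by positivity
  refine ⟨C0 + C1 + 2 * C2, by positivity, ?_⟩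
  filter_upwards [hb', h0, h1, h2] with y g g0 g1 g2
  refine ⟨g, ?_, fun v => ?_, fun v w => ?_⟩
  · rw [← Real.norm_eq_abs]; linarith
  · calc |fderiv ℝ b y v| ≤ ‖fderiv ℝ b y‖ * ‖v‖ := (fderiv ℝ b y).le_opNorm v
      _ ≤ _ := mul_le_mul_of_nonneg_right (by linarith) (norm_nonneg v)
  · have key (v w : Cn n) : |B y v (Complex.I • w)| ≤ C2 * (‖v‖ * ‖w‖) := by
      have h3 := (B y).le_opNorm₂ v (Complex.I • w)
      rw [norm_smul, Complex.norm_I, one_mul, mul_assoc] at h3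
      exact h3.trans (mul_le_mul_of_nonneg_right g2.le (by positivity))
    have h4 : 0 ≤ ‖v‖ * ‖w‖ := by positivity
    calc |lev b y v w| ≤ C2 * (‖v‖ * ‖w‖) + C2 * (‖w‖ * ‖v‖) :=
          (abs_sub _ _).trans (add_le_add (key v w) (key w v))
      _ ≤ _ := by nlinarith [mul_nonneg hC0 h4, mul_nonneg hC1 h4]

/-- From t log(1/t) ≤ 1 - t. The dual frame being bounded, forms that are smooth across D have
bounded components in it. -/
theorem norm_frameVec_le {r : ℕ} {k : Fin n} {ε : ℂ} (hε : ‖ε‖ ≤ 1) {y : Cn n} (hy : ‖y k‖ < 1) :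
    ‖frameVec r k ε y‖ ≤ 1 := by
  rw [frameVec, Pi.norm_single, norm_mul]
  refine mul_le_one₀ hε (norm_nonneg _) ?_
  unfold tau
  split_ifs with h
  · rw [norm_mul, Complex.norm_real, Real.norm_eq_abs]
    rcases eq_or_ne (y k) 0 with h0 | h0
    · simp [h0]
    · have hp : 0 < ‖y k‖ := norm_pos_iff.2 h0
      have h1 : 0 ≤ Real.log (‖y k‖⁻¹) := Real.log_nonneg (one_le_inv₀ hp |>.2 hy.le)
      rw [abs_of_nonneg h1]
      have h2 := Real.log_le_sub_one_of_pos (inv_pos.2 hp)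
      calc ‖y k‖ * Real.log (‖y k‖⁻¹) ≤ ‖y k‖ * (‖y k‖⁻¹ - 1) :=
            mul_le_mul_of_nonneg_left h2 hp.le
        _ = 1 - ‖y k‖ := by field_simp
        _ ≤ 1 := by linarith
  · simp

end LevCalculus

/-! ### Local models of log ‖s_k‖⁻² and the positivity of ddᶜ(-log u). -/

section LogModels

variable {n : ℕ} {X : Type*} [TopologicalSpace X]

/-- Near `x` and off `D`, the function `u` extends smoothly in the chart `c`. -/
def RegularIn (D : Set X) (c : OpenPartialHomeomorph X (Cn n)) (x : X) (u : X → ℝ) : Prop :=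
  ∃ b : Cn n → ℝ, (∀ᶠ y in 𝓝 (c x), ContDiffAt ℝ ∞ b y) ∧ ∀ᶠ z in 𝓝 x, z ∉ D → u z = b (c z)

/-- Near `x` and off `D`, the function `u` is the sum of `-log |z_i|²` and a smooth function. -/
def LogPoleIn (D : Set X) (c : OpenPartialHomeomorph X (Cn n)) (i : Fin n) (x : X) (u : X → ℝ) :
    Prop :=
  ∃ b : Cn n → ℝ, (∀ᶠ y in 𝓝 (c x), ContDiffAt ℝ ∞ b y) ∧
    ∀ᶠ z in 𝓝 x, z ∉ D → u z = -2 * Real.log ‖c z i‖ + b (c z)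

variable {D : Set X} {c : OpenPartialHomeomorph X (Cn n)} {x : X} {u : X → ℝ}

theorem eventually_germ_eq (hD : IsClosed D) (hx : x ∈ c.source) {G : Cn n → ℝ}
    (h : ∀ᶠ z in 𝓝 x, z ∉ D → u z = G (c z)) :
    ∀ᶠ z in 𝓝 x, z ∉ D → (fun y => u (c.symm y)) =ᶠ[𝓝 (c z)] G := by
  filter_upwards [h.eventually_nhds, c.open_source.mem_nhds hx] with z hz hzs hzD
  have h1 : ∀ᶠ z' in 𝓝 z, u z' = G (c z') := by
    filter_upwards [hz, hD.isOpen_compl.mem_nhds hzD] with z' h2 h3 using h2 h3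
  filter_upwards [eventually_of_chart hzs h1, c.open_target.mem_nhds (c.map_source hzs)]
    with y hy hyt
  rw [hy, c.right_inv hyt]

theorem RegularIn.bounds (hD : IsClosed D) (hx : x ∈ c.source) (h : RegularIn D c x u) :
    ∃ C : ℝ, 0 ≤ C ∧ ∀ᶠ z in 𝓝 x, z ∉ D → |u z| ≤ C ∧
      (∀ v, |fderiv ℝ (fun y => u (c.symm y)) (c z) v| ≤ C * ‖v‖) ∧
      ∀ v w, |lev (fun y => u (c.symm y)) (c z) v w| ≤ C * (‖v‖ * ‖w‖) := by
  obtain ⟨b, hb, hu⟩ := h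
  obtain ⟨C, hC, hbd⟩ := exists_bound_of_contDiffAt hb
  refine ⟨C, hC, ?_⟩
  filter_upwards [(c.continuousAt hx).eventually hbd, eventually_germ_eq hD hx hu, hu]
    with z h1 h2 h3 hzD
  rw [(h2 hzD).fderiv_eq, lev_eq_of_eventuallyEq (h2 hzD), h3 hzD]
  exact ⟨h1.2.1, h1.2.2.1, h1.2.2.2⟩

/-- The pole is pluriharmonic: it enters the value and the first derivative, while `lev` sees only
the smooth remainder. -/
theorem LogPoleIn.bounds {i : Fin n} (hD : IsClosed D) (hx : x ∈ c.source)
    (hi : ∀ z ∈ c.source, z ∉ D → c z i ≠ 0) (h : LogPoleIn D c i x u) :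
    ∃ C : ℝ, 0 ≤ C ∧ ∀ᶠ z in 𝓝 x, z ∉ D → |u z + 2 * Real.log ‖c z i‖| ≤ C ∧
      (∀ v, |fderiv ℝ (fun y => u (c.symm y)) (c z) v + 2 * ((c z i)⁻¹ * v i).re| ≤ C * ‖v‖) ∧
      ∀ v w, |lev (fun y => u (c.symm y)) (c z) v w| ≤ C * (‖v‖ * ‖w‖) := by
  obtain ⟨b, hb, hu⟩ := h
  obtain ⟨C, hC, hbd⟩ := exists_bound_of_contDiffAt hb
  refine ⟨C, hC, ?_⟩
  filter_upwards [(c.continuousAt hx).eventually hbd, c.open_source.mem_nhds hx, hu,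
    eventually_germ_eq (G := fun y => -2 * Real.log ‖y i‖ + b y) hD hx hu] with z h1 hzs h3 h2 hzD
  have hz0 := hi z hzs hzD
  have hlog := contDiffAt_log_norm hz0
  rw [(h2 hzD).fderiv_eq, lev_eq_of_eventuallyEq (h2 hzD), h3 hzD]
  refine ⟨by simpa using h1.2.1, fun v => ?_, fun v w => ?_⟩
  · rw [fderiv_fun_add ((hlog.differentiableAt (by simp)).const_mul _)
      (h1.1.differentiableAt (by simp)), fderiv_const_mul (hlog.differentiableAt (by simp)),
      (hasFDerivAt_log_norm hz0).fderiv]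
    refine le_trans (le_of_eq ?_) (h1.2.2.1 v)
    congr 1
    simp only [add_apply, smul_apply, ContinuousLinearMap.comp_apply, Complex.reCLM_apply,
      ContinuousLinearMap.proj_apply, smul_eq_mul]
    ring
  · rw [lev_add (contDiffAt_const.mul hlog) h1.1, lev_const_mul _ hlog, lev_log_norm hz0]
    simpa using h1.2.2.2 v w

theorem I_smul_frameVec {r : ℕ} (k : Fin n) (ε : ℂ) (y : Cn n) :
    Complex.I • frameVec r k ε y = frameVec r k (Complex.I * ε) y := by
  ext j
  by_cases h : j = k
  · subst h; simp [frameVec, mul_assoc]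
  · simp [frameVec, h]

variable [ChartedSpace (Cn n) X] {r : ℕ}

theorem IsAdapted.one_lt_log (hc : IsAdapted D c r) {z : X} (hz : z ∈ c.source) (hzD : z ∉ D)
    {i : Fin n} (hi : (i : ℕ) < r) : 1 < Real.log (‖c z i‖⁻¹) := by
  have h0 : 0 < ‖c z i‖ := norm_pos_iff.2 (hc.ne_zero ⟨hz, hzD⟩ hi)
  have h1 := hc.small z hz i
  rw [Real.lt_log_iff_exp_lt (inv_pos.2 h0)]
  rwa [lt_inv_comm₀ (Real.exp_pos 1) h0, ← one_div]

/-- In an adapted chart the function `u` is either smooth or has a logarithmic pole. -/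
def LogModel (D : Set X) (c : OpenPartialHomeomorph X (Cn n)) (r : ℕ) (x : X) (u : X → ℝ) : Prop :=
  RegularIn D c x u ∨ ∃ i : Fin n, (i : ℕ) < r ∧ LogPoleIn D c i x u

/-- On the i-th frame vector dz_i/z_i takes the value ε log |z_i|⁻¹, which is of the same order as
`u`. Thus du is O(u) in the frame, and dividing by `u` will make d log u bounded. -/
theorem LogModel.frame_bounds (hD : IsClosed D) (hc : IsAdapted D c r) (hx : x ∈ c.source)
    (hu : ∀ z ∉ D, 1 ≤ u z) (h : LogModel D c r x u) :
    ∃ C : ℝ, 0 ≤ C ∧ ∀ᶠ z in 𝓝 x, z ∉ D →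
      (∀ k ε, ‖ε‖ ≤ 1 →
        |fderiv ℝ (fun y => u (c.symm y)) (c z) (frameVec r k ε (c z))| ≤ C * u z) ∧
      (∀ v w, |lev (fun y => u (c.symm y)) (c z) v w| ≤ C * (‖v‖ * ‖w‖)) := by
  rcases h with h | ⟨i, hi, h⟩
  · obtain ⟨C, hC, hb⟩ := h.bounds hD hx
    refine ⟨C, hC, ?_⟩
    filter_upwards [hb, c.open_source.mem_nhds hx] with z hz hzs hzD
    refine ⟨fun k ε hε => ?_, (hz hzD).2.2⟩
    have h1 := norm_frameVec_le (r := r) hε (hc.norm_lt_one hzs k)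
    calc _ ≤ C * ‖frameVec r k ε (c z)‖ := (hz hzD).2.1 _
      _ ≤ C * u z := mul_le_mul_of_nonneg_left (h1.trans (hu z hzD)) hC
  · obtain ⟨C, hC, hb⟩ := h.bounds hD hx (fun z hz hzD => hc.ne_zero ⟨hz, hzD⟩ hi)
    -- With L = log |z_i|⁻¹, the derivative is at most 2L + C and 2L ≤ u + C; then u ≥ 1 absorbs the
    -- remaining 2C.
    refine ⟨1 + 2 * C, by positivity, ?_⟩
    filter_upwards [hb, c.open_source.mem_nhds hx] with z hz hzs hzD
    obtain ⟨h1, h2, h3⟩ := hz hzD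
    refine ⟨fun k ε hε => ?_, fun v w => (h3 v w).trans ?_⟩
    · have h4 := norm_frameVec_le (r := r) hε (hc.norm_lt_one hzs k)
      have h5 := hc.one_lt_log hzs hzD hi
      have h6 : |((c z i)⁻¹ * frameVec r k ε (c z) i).re| ≤ Real.log (‖c z i‖⁻¹) := by
        refine (Complex.abs_re_le_norm _).trans ?_
        by_cases hki : i = k
        · subst hki
          have h0 := hc.ne_zero ⟨hzs, hzD⟩ hi
          rw [frameVec, Pi.single_eq_same, tau, if_pos hi,
            show (c z i)⁻¹ * (ε * (c z i * (Real.log (‖c z i‖⁻¹) : ℂ))) =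
              ε * (Real.log (‖c z i‖⁻¹) : ℂ) by field_simp, norm_mul, Complex.norm_real,
            Real.norm_eq_abs, abs_of_pos (by linarith)]
          exact mul_le_of_le_one_left (by linarith) hε
        · simp only [frameVec, ne_eq, hki, not_false_eq_true, Pi.single_eq_of_ne, mul_zero,
          norm_zero]
          linarith
      rw [Real.log_inv] at h6
      have h7 := h2 (frameVec r k ε (c z))
      have h8 : C * ‖frameVec r k ε (c z)‖ ≤ C := mul_le_of_le_one_right hC h4
      have h9 := hu z hzD
      have h10 : C ≤ C * u z := le_mul_of_one_le_right hC h9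
      rw [abs_le] at *
      constructor <;> nlinarith
    · nlinarith [mul_nonneg (norm_nonneg v) (norm_nonneg w)]

theorem lev_log {F : Cn n → ℝ} {y : Cn n} (hF : ContDiffAt ℝ ∞ F y) (hy : 0 < F y)
    (v w : Cn n) : lev (fun z => Real.log (F z)) y v w = lev F y v w / F y -
      (fderiv ℝ F y v * fderiv ℝ F y (Complex.I • w) -
        fderiv ℝ F y w * fderiv ℝ F y (Complex.I • v)) / F y ^ 2 := by
  have h := lev_comp (g := Real.log) (g' := fun t => t⁻¹) hF
    ((eventually_ne_nhds hy.ne').mono fun t ht => Real.hasDerivAt_log ht)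
    (hasDerivAt_inv hy.ne') v w
  rw [h]
  ring

/-- On (w, iw) the form `lev` is minus the trace of the real Hessian over the complex line of w.
Hence concavity of the logarithm contributes the squared gradient with a plus sign, which is the
source of all positivity in the proof. -/
theorem lev_log_self {F : Cn n → ℝ} {y : Cn n} (hF : ContDiffAt ℝ ∞ F y) (hy : 0 < F y)
    (w : Cn n) : lev (fun z => Real.log (F z)) y w (Complex.I • w) =
      lev F y w (Complex.I • w) / F y +
      (fderiv ℝ F y w ^ 2 + fderiv ℝ F y (Complex.I • w) ^ 2) / F y ^ 2 := by
  rw [lev_log hF hy, smul_smul, Complex.I_mul_I]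
  simp only [neg_smul, one_smul, map_neg]
  ring

/-- In either model `lev` of `u` is bounded, and u ≥ 1, so the term (lev u)/u costs only a multiple
of ‖w‖². -/
theorem LogModel.levi_lower (hD : IsClosed D) (hc : IsAdapted D c r) (hx : x ∈ c.source)
    (hu : ∀ z ∉ D, 1 ≤ u z)
    (hs : ∀ z ∈ c.source, z ∉ D → ContDiffAt ℝ ∞ (fun y => u (c.symm y)) (c z))
    (h : LogModel D c r x u) :
    ∃ A : ℝ, 0 ≤ A ∧ ∀ᶠ z in 𝓝 x, z ∉ D → ∀ w,
      (fderiv ℝ (fun y => u (c.symm y)) (c z) w ^ 2 +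
        fderiv ℝ (fun y => u (c.symm y)) (c z) (Complex.I • w) ^ 2) / u z ^ 2 ≤
      lev (fun y => Real.log (u (c.symm y))) (c z) w (Complex.I • w) + A * ‖w‖ ^ 2 := by
  obtain ⟨C, hC, hb⟩ := h.frame_bounds hD hc hx hu
  refine ⟨C, hC, ?_⟩
  filter_upwards [hb, c.open_source.mem_nhds hx] with z hz hzs hzD w
  have h1 := (hz hzD).2 w (Complex.I • w)
  have h2 := hu z hzD
  have huz : u (c.symm (c z)) = u z := by rw [c.left_inv hzs]
  rw [lev_log_self (hs z hzs hzD) (by rw [huz]; linarith), huz]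
  rw [norm_smul, Complex.norm_I, one_mul] at h1
  have h3 : |lev (fun y => u (c.symm y)) (c z) w (Complex.I • w) / u z| ≤ C * ‖w‖ ^ 2 := by
    rw [abs_div, abs_of_pos (by linarith : 0 < u z), div_le_iff₀ (by linarith)]
    have : 0 ≤ C * ‖w‖ ^ 2 := by positivity
    nlinarith
  have := (abs_le.1 h3).1
  linarith

/-- With p = w_i/z_i, du(w) and du(iw) are -2 Re p and 2 Im p up to O(‖w‖), so together they recover
|p|. Dividing by log |z_i|⁻¹, which is bounded below by a multiple of `u`, gives |dζ_i(w)|. -/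
theorem LogPoleIn.pole_lower {i : Fin n} (hD : IsClosed D) (hc : IsAdapted D c r)
    (hx : x ∈ c.source) (hi : (i : ℕ) < r) (hu : ∀ z ∉ D, 1 ≤ u z) (h : LogPoleIn D c i x u) :
    ∃ A : ℝ, 0 ≤ A ∧ ∀ᶠ z in 𝓝 x, z ∉ D → ∀ w : Cn n,
      ‖(tau r i (c z))⁻¹ * w i‖ ^ 2 ≤ A * ((fderiv ℝ (fun y => u (c.symm y)) (c z) w ^ 2 +
        fderiv ℝ (fun y => u (c.symm y)) (c z) (Complex.I • w) ^ 2) / u z ^ 2 + ‖w‖ ^ 2) := by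
  obtain ⟨C, hC, hb⟩ := h.bounds hD hx (fun z hz hzD => hc.ne_zero ⟨hz, hzD⟩ hi)
  -- The first square comes from u ≤ (2 + C) log |z_i|⁻¹, the second from the smooth part of du.
  refine ⟨(2 + C) ^ 2 + C ^ 2, by positivity, ?_⟩
  filter_upwards [hb, c.open_source.mem_nhds hx] with z hz hzs hzD w
  obtain ⟨h1, h2, -⟩ := hz hzD
  have hL := hc.one_lt_log hzs hzD hi
  have h0 := hc.ne_zero ⟨hzs, hzD⟩ hi
  have hu1 := hu z hzD
  set L := Real.log (‖c z i‖⁻¹) with hLdef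
  have hlog : Real.log ‖c z i‖ = -L := by rw [hLdef, Real.log_inv, neg_neg]
  rw [hlog] at h1
  set p := (c z i)⁻¹ * w i with hp
  set a := fderiv ℝ (fun y => u (c.symm y)) (c z) w with ha
  set b := fderiv ℝ (fun y => u (c.symm y)) (c z) (Complex.I • w) with hb'
  have g1 : |a + 2 * p.re| ≤ C * ‖w‖ := h2 w
  have g2 : |b - 2 * p.im| ≤ C * ‖w‖ := by
    have := h2 (Complex.I • w)
    rw [norm_smul, Complex.norm_I, one_mul] at this
    have e : ((c z i)⁻¹ * (Complex.I • w) i).re = -p.im := by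
      rw [Pi.smul_apply, smul_eq_mul, show (c z i)⁻¹ * (Complex.I * w i) = Complex.I * p by
        rw [hp]; ring, Complex.I_mul_re]
    rw [e] at this
    convert this using 2
    ring
  have hpn : ‖p‖ ^ 2 ≤ a ^ 2 + b ^ 2 + C ^ 2 * ‖w‖ ^ 2 := by
    rw [← Complex.normSq_eq_norm_sq, Complex.normSq_apply]
    have e1 := sq_le_sq' (abs_le.1 g1).1 (abs_le.1 g1).2
    have e2 := sq_le_sq' (abs_le.1 g2).1 (abs_le.1 g2).2
    nlinarith [sq_nonneg (a - (-(a + 2 * p.re))), sq_nonneg (2 * a + 2 * p.re),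
      sq_nonneg (2 * b - 2 * p.im), mul_nonneg (sq_nonneg C) (sq_nonneg ‖w‖)]
  have hτ : (tau r i (c z))⁻¹ * w i = p * (L : ℂ)⁻¹ := by
    rw [tau, if_pos hi, mul_inv, hp]; ring
  have huL : u z ≤ (2 + C) * L := by
    have := (abs_le.1 h1).2
    nlinarith
  have hLp : 0 < L := by linarith
  have hup : 0 < u z := by linarith
  rw [hτ, norm_mul, norm_inv, Complex.norm_real, Real.norm_eq_abs, abs_of_pos hLp, mul_pow,
    inv_pow, ← div_eq_mul_inv]
  have hq : 0 ≤ a ^ 2 + b ^ 2 := by positivity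
  have k1 : (a ^ 2 + b ^ 2) / L ^ 2 ≤ (2 + C) ^ 2 * ((a ^ 2 + b ^ 2) / u z ^ 2) := by
    rw [mul_div_assoc', div_le_div_iff₀ (by positivity) (by positivity)]
    have : u z ^ 2 ≤ ((2 + C) * L) ^ 2 := pow_le_pow_left₀ hup.le huL 2
    nlinarith
  have k2 : C ^ 2 * ‖w‖ ^ 2 / L ^ 2 ≤ C ^ 2 * ‖w‖ ^ 2 :=
    div_le_self (by positivity) (one_le_pow₀ hL.le)
  have k3 : ‖p‖ ^ 2 / L ^ 2 ≤ (a ^ 2 + b ^ 2) / L ^ 2 + C ^ 2 * ‖w‖ ^ 2 / L ^ 2 := by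
    rw [← add_div]
    exact div_le_div_of_nonneg_right hpn (by positivity)
  have k4 : 0 ≤ (a ^ 2 + b ^ 2) / u z ^ 2 := by positivity
  have k5 : 0 ≤ ‖w‖ ^ 2 := by positivity
  nlinarith [mul_nonneg (sq_nonneg C) k4, mul_nonneg (sq_nonneg (2 + C)) k5]

end LogModels

/-! ### The function T = ∑ log u_k: bounds for its derivatives, positivity, comparison with log log
|z_i|⁻¹. -/

section LogSystem

variable {n : ℕ} {X : Type*} [TopologicalSpace X] [ChartedSpace (Cn n) X]

/-- The functions `u` have, in adapted charts, simple logarithmic poles along the branches of `D`,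
and every branch of `D` is a pole of one of them. -/
structure IsLogSystem {m : ℕ} (D : Set X) (u : Fin m → X → ℝ) : Prop where
  closed : IsClosed D
  ge : ∀ k, ∀ z ∉ D, Real.exp 1 ≤ u k z
  smooth : ∀ k, ∀ z ∉ D, ContMDiffAt 𝓘(ℝ, Cn n) 𝓘(ℝ, ℝ) ∞ (u k) z
  model : ∀ c r, IsAdapted (n := n) D c r → ∀ x ∈ c.source, ∀ k, LogModel D c r x (u k)
  cover : ∀ c r, IsAdapted (n := n) D c r → ∀ x ∈ c.source, ∀ i : Fin n, (i : ℕ) < r → c x i = 0 →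
    ∃ k, LogPoleIn D c i x (u k)

/-- The function `∑_k log u_k`. -/
noncomputable def logSum {m : ℕ} (u : Fin m → X → ℝ) (x : X) : ℝ := ∑ k, Real.log (u k x)

variable {m : ℕ} {D : Set X} {u : Fin m → X → ℝ} {c : OpenPartialHomeomorph X (Cn n)} {r : ℕ}
  {x : X}

theorem IsLogSystem.one_le (h : IsLogSystem (n := n) D u) (k : Fin m) : ∀ z ∉ D, 1 ≤ u k z :=
  fun z hz => (Real.one_le_exp zero_le_one).trans (h.ge k z hz)

theorem IsLogSystem.one_le_log (h : IsLogSystem (n := n) D u) (k : Fin m) {z : X} (hz : z ∉ D) :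
    1 ≤ Real.log (u k z) := by
  rw [Real.le_log_iff_exp_le (by linarith [h.one_le k z hz])]
  exact h.ge k z hz

theorem IsLogSystem.log_le_logSum (h : IsLogSystem (n := n) D u) (k : Fin m) {z : X} (hz : z ∉ D) :
    Real.log (u k z) ≤ logSum u z :=
  Finset.single_le_sum (f := fun k => Real.log (u k z))
    (fun j _ => zero_le_one.trans (h.one_le_log j hz)) (Finset.mem_univ k)

theorem IsLogSystem.one_le_logSum (h : IsLogSystem (n := n) D u) (hm : 0 < m) {z : X}
    (hz : z ∉ D) : 1 ≤ logSum u z :=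
  (h.one_le_log ⟨0, hm⟩ hz).trans (h.log_le_logSum ⟨0, hm⟩ hz)

theorem IsLogSystem.contMDiffAt_logSum (h : IsLogSystem (n := n) D u) {z : X} (hz : z ∉ D) :
    ContMDiffAt 𝓘(ℝ, Cn n) 𝓘(ℝ, ℝ) ∞ (logSum u) z := by
  refine contMDiffAt_finsetSum fun k _ => ?_
  have h1 : ContDiffAt ℝ ∞ Real.log (u k z) :=
    Real.contDiffAt_log.2 (by linarith [h.one_le k z hz])
  exact ContMDiffAt.comp z (g := Real.log) h1.contMDiffAt (h.smooth k z hz)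

/-- The components of `df` and of `ddᶜf` with respect to the forms `dζ_k` are locally bounded by
multiples of `T ^ N`, with `N ∈ E`. -/
structure FrameBounded (D : Set X) (T : X → ℝ) (E : Set ℕ) (c : OpenPartialHomeomorph X (Cn n))
    (r : ℕ) (f : X → ℝ) : Prop where
  deriv : ∀ x ∈ c.source, ∀ k ε, ‖ε‖ ≤ 1 → LocBound D T E x (fun z =>
    |fderiv ℝ (fun y => f (c.symm y)) (c z) (frameVec r k ε (c z))|)
  lev : ∀ x ∈ c.source, ∀ k l ε δ, ‖ε‖ ≤ 1 → ‖δ‖ ≤ 1 → LocBound D T E x (fun z =>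
    |lev (fun y => f (c.symm y)) (c z) (frameVec r k ε (c z)) (frameVec r l δ (c z))|)

theorem IsLogSystem.contDiffAt [IsManifold 𝓘(ℂ, Cn n) ω X] (h : IsLogSystem (n := n) D u)
    (hc : IsAdapted D c r) (k : Fin m) {z : X} (hz : z ∈ c.source) (hzD : z ∉ D) :
    ContDiffAt ℝ ∞ (fun y => u k (c.symm y)) (c z) :=
  contDiffAt_comp_symm hc.mem_maximalAtlas hz (h.smooth k z hzD)

theorem IsLogSystem.contDiffAt_log [IsManifold 𝓘(ℂ, Cn n) ω X] (h : IsLogSystem (n := n) D u)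
    (hc : IsAdapted D c r) (k : Fin m) {z : X} (hz : z ∈ c.source) (hzD : z ∉ D) :
    ContDiffAt ℝ ∞ (fun y => Real.log (u k (c.symm y))) (c z) :=
  (h.contDiffAt hc k hz hzD).log (by
    rw [c.left_inv hz]; linarith [h.one_le k z hzD])

theorem IsLogSystem.frameBounded_logSum [IsManifold 𝓘(ℂ, Cn n) ω X]
    (h : IsLogSystem (n := n) D u) (hm : 0 < m) (hc : IsAdapted D c r) :
    FrameBounded D (logSum u) {0} c r (logSum u) where
  deriv := by
    intro x hx k ε hε
    have hT : ∀ z ∉ D, 1 ≤ logSum u z := fun z hz => h.one_le_logSum hm hz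
    refine LocBound.mono (h := fun z => ∑ j, |fderiv ℝ (fun y => Real.log (u j (c.symm y))) (c z)
      (frameVec r k ε (c z))|) ?_ ?_
    · refine LocBound.sum hT (Set.singleton_nonempty 0) _ fun j _ => ?_
      obtain ⟨C, hC, hb⟩ := (h.model c r hc x hx j).frame_bounds h.closed hc hx (h.one_le j)
      refine LocBound.of_le_const hT (Set.singleton_nonempty 0) C ?_
      filter_upwards [hb, c.open_source.mem_nhds hx] with z hz hzs hzD
      have h1 := (hz hzD).1 k ε hε
      have hu := h.one_le j z hzD
      have hlog : HasDerivAt Real.log (u j z)⁻¹ (u j (c.symm (c z))) := by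
        rw [c.left_inv hzs]
        exact Real.hasDerivAt_log (by linarith)
      rw [fderiv_comp_apply (F := fun y => u j (c.symm y))
        ((h.contDiffAt hc j hzs hzD).differentiableAt (by simp)) hlog, abs_mul,
        abs_inv, abs_of_pos (by linarith : 0 < u j z), inv_mul_le_iff₀ (by linarith)]
      linarith
    · filter_upwards [c.open_source.mem_nhds hx] with z hzs hzD
      have e : (fun y => logSum u (c.symm y)) = fun y => ∑ j, Real.log (u j (c.symm y)) := rfl
      rw [e, fderiv_fun_sum fun j _ => (h.contDiffAt_log hc j hzs hzD).differentiableAt (by simp),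
        sum_apply]
      exact Finset.abs_sum_le_sum_abs _ _
  lev := by
    intro x hx k l ε δ hε hδ
    have hT : ∀ z ∉ D, 1 ≤ logSum u z := fun z hz => h.one_le_logSum hm hz
    refine LocBound.mono (h := fun z => ∑ j, |LogLog.lev (fun y => Real.log (u j (c.symm y))) (c z)
      (frameVec r k ε (c z)) (frameVec r l δ (c z))|) ?_ ?_
    · refine LocBound.sum hT (Set.singleton_nonempty 0) _ fun j _ => ?_
      obtain ⟨C, hC, hb⟩ := (h.model c r hc x hx j).frame_bounds h.closed hc hx (h.one_le j)
      -- `C` bounds (lev u)/u, and each of the two products of first derivatives divided by u² is at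
      -- most C².
      refine LocBound.of_le_const hT (Set.singleton_nonempty 0) (C + 2 * C ^ 2) ?_
      filter_upwards [hb, c.open_source.mem_nhds hx] with z hz hzs hzD
      obtain ⟨h1, h2⟩ := hz hzD
      have hu := h.one_le j z hzD
      have huz : u j (c.symm (c z)) = u j z := by rw [c.left_inv hzs]
      have hIε : ‖Complex.I * ε‖ ≤ 1 := by simpa using hε
      have hIδ : ‖Complex.I * δ‖ ≤ 1 := by simpa using hδ
      rw [LogLog.lev_log (h.contDiffAt hc j hzs hzD) (by rw [huz]; linarith), huz, I_smul_frameVec,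
        I_smul_frameVec]
      have g1 := h2 (frameVec r k ε (c z)) (frameVec r l δ (c z))
      have g2 := h1 k ε hε
      have g3 := h1 l δ hδ
      have g4 := h1 k _ hIε
      have g5 := h1 l _ hIδ
      have n1 := norm_frameVec_le (r := r) hε (hc.norm_lt_one hzs k)
      have n2 := norm_frameVec_le (r := r) hδ (hc.norm_lt_one hzs l)
      have hup : 0 < u j z := by linarith
      have hCu : 0 ≤ C * u j z := by positivity
      refine (abs_sub _ _).trans (add_le_add ?_ ?_)
      · rw [abs_div, abs_of_pos hup, div_le_iff₀ hup]
        have : ‖frameVec r k ε (c z)‖ * ‖frameVec r l δ (c z)‖ ≤ 1 :=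
          mul_le_one₀ n1 (norm_nonneg _) n2
        calc _ ≤ C * 1 := g1.trans (mul_le_mul_of_nonneg_left this hC)
          _ ≤ C * u j z := mul_le_mul_of_nonneg_left hu hC
      · rw [abs_div, abs_of_pos (pow_pos hup 2), div_le_iff₀ (pow_pos hup 2)]
        refine (abs_sub _ _).trans ?_
        rw [abs_mul, abs_mul]
        have e1 := mul_le_mul g2 g5 (abs_nonneg _) hCu
        have e2 := mul_le_mul g3 g4 (abs_nonneg _) hCu
        calc _ ≤ C * u j z * (C * u j z) + C * u j z * (C * u j z) := add_le_add e1 e2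
          _ = _ := by ring
    · filter_upwards [c.open_source.mem_nhds hx] with z hzs hzD
      have e : (fun y => logSum u (c.symm y)) = fun y => ∑ j, Real.log (u j (c.symm y)) := rfl
      rw [e, lev_sum _ fun j _ => (h.contDiffAt_log hc j hzs hzD)]
      exact Finset.abs_sum_le_sum_abs _ _

theorem norm_inv_tau_le (hc : IsAdapted D c r) (hx : x ∈ c.source) {i : Fin n}
    (hi : (i : ℕ) < r → c x i ≠ 0) :
    ∃ C : ℝ, 0 ≤ C ∧ ∀ᶠ z in 𝓝 x, ‖(tau r i (c z))⁻¹‖ ≤ C := by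
  have h0 := tau_ne_zero (r := r) (hc.norm_lt_one hx i) hi
  have h1 : ContinuousAt (fun z => (tau r i (c z))⁻¹) x :=
    ((contDiffAt_tau hi).continuousAt.comp (c.continuousAt hx)).inv₀ h0
  exact ⟨_, by positivity, (eventually_norm_lt_add_one h1).mono fun z hz => hz.le⟩

theorem norm_apply_le_norm (w : Cn n) (i : Fin n) : ‖w i‖ ≤ ‖w‖ := norm_le_pi_norm w i

/-- A branch z_i = 0 through `x` is the pole of some u_k, whose gradient term controls |dζ_i|². For
every other coordinate 1/τ_i is bounded near `x`, and ‖w‖² alone suffices. -/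
theorem IsLogSystem.levi_lower [IsManifold 𝓘(ℂ, Cn n) ω X]
    (h : IsLogSystem (n := n) D u) (hc : IsAdapted D c r) (hx : x ∈ c.source) :
    ∃ A C : ℝ, 0 ≤ A ∧ 0 ≤ C ∧ ∀ᶠ z in 𝓝 x, z ∉ D → ∀ w : Cn n,
      0 ≤ lev (fun y => logSum u (c.symm y)) (c z) w (Complex.I • w) + A * ‖w‖ ^ 2 ∧
      ∑ i, ‖(tau r i (c z))⁻¹ * w i‖ ^ 2 ≤
        C * (lev (fun y => logSum u (c.symm y)) (c z) w (Complex.I • w) + A * ‖w‖ ^ 2) := by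
  choose a ha hab using fun k => (h.model c r hc x hx k).levi_lower h.closed hc hx (h.one_le k)
    (fun z hz hzD => h.contDiffAt hc k hz hzD)
  set A := ∑ k, a k with hA
  have hA0 : 0 ≤ A := Finset.sum_nonneg fun k _ => ha k
  have main : ∀ᶠ z in 𝓝 x, z ∉ D → ∀ w : Cn n, ∀ k,
      (fderiv ℝ (fun y => u k (c.symm y)) (c z) w ^ 2 +
        fderiv ℝ (fun y => u k (c.symm y)) (c z) (Complex.I • w) ^ 2) / u k z ^ 2 ≤
      lev (fun y => logSum u (c.symm y)) (c z) w (Complex.I • w) + A * ‖w‖ ^ 2 := by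
    filter_upwards [Filter.eventually_all.2 hab, c.open_source.mem_nhds hx] with z hz hzs hzD w k
    have e : (fun y => logSum u (c.symm y)) = fun y => ∑ j, Real.log (u j (c.symm y)) := rfl
    rw [e, lev_sum _ fun j _ => (h.contDiffAt_log hc j hzs hzD), hA, Finset.sum_mul,
      ← Finset.sum_add_distrib]
    refine (hz k hzD w).trans (Finset.single_le_sum (f := fun j =>
      LogLog.lev (fun y => Real.log (u j (c.symm y))) (c z) w (Complex.I • w) + a j * ‖w‖ ^ 2)
      (fun j _ => le_trans (by positivity) (hz j hzD w)) (Finset.mem_univ k))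
  have term : ∀ i : Fin n, ∃ C : ℝ, 0 ≤ C ∧ ∀ᶠ z in 𝓝 x, z ∉ D → ∀ w : Cn n, ∀ q : ℝ, 0 ≤ q →
      (∀ k, (fderiv ℝ (fun y => u k (c.symm y)) (c z) w ^ 2 +
        fderiv ℝ (fun y => u k (c.symm y)) (c z) (Complex.I • w) ^ 2) / u k z ^ 2 ≤ q) →
      ‖(tau r i (c z))⁻¹ * w i‖ ^ 2 ≤ C * (q + ‖w‖ ^ 2) := by
    intro i
    by_cases hi : (i : ℕ) < r ∧ c x i = 0
    · obtain ⟨k, hk⟩ := h.cover c r hc x hx i hi.1 hi.2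
      obtain ⟨B, hB, hb⟩ := hk.pole_lower h.closed hc hx hi.1 (h.one_le k)
      refine ⟨B, hB, ?_⟩
      filter_upwards [hb] with z hz hzD w q _ hq'
      exact (hz hzD w).trans (mul_le_mul_of_nonneg_left (add_le_add_left (hq' k) _) hB)
    · obtain ⟨B, hB, hb⟩ := norm_inv_tau_le (i := i) hc hx (fun h1 h2 => hi ⟨h1, h2⟩)
      refine ⟨B ^ 2, by positivity, ?_⟩
      filter_upwards [hb] with z hz _ w q hq _
      rw [norm_mul, mul_pow]
      refine mul_le_mul (pow_le_pow_left₀ (norm_nonneg _) hz 2) ?_ (by positivity) (by positivity)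
      have := pow_le_pow_left₀ (norm_nonneg _) (norm_apply_le_norm w i) 2
      linarith
  choose B hB hBb using term
  -- `A` makes the form nonnegative; the additional 1 supplies the summand ‖w‖² in the
  -- coordinatewise estimates.
  refine ⟨A + 1, ∑ i, B i, by positivity, Finset.sum_nonneg fun i _ => hB i, ?_⟩
  by_cases hm : Nonempty (Fin m)
  · obtain ⟨k₀⟩ := hm
    filter_upwards [main, Filter.eventually_all.2 hBb] with z h1 h2 hzD w
    have h0 : 0 ≤ lev (fun y => logSum u (c.symm y)) (c z) w (Complex.I • w) + A * ‖w‖ ^ 2 :=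
      le_trans (by positivity) (h1 hzD w k₀)
    refine ⟨h0.trans (by nlinarith [sq_nonneg ‖w‖]), ?_⟩
    rw [Finset.sum_mul]
    refine Finset.sum_le_sum fun i _ => ?_
    refine (h2 i hzD w _ h0 (h1 hzD w)).trans (le_of_eq ?_)
    ring
  -- Without components no index is available to give nonnegativity, but then T vanishes
  -- identically.
  · have hS : ∀ z, logSum u z = 0 := fun z =>
      Finset.sum_eq_zero fun k _ => (hm ⟨k⟩).elim
    filter_upwards [Filter.eventually_all.2 hBb] with z h2 hzD w
    refine ⟨?_, ?_⟩
    · simp only [hS, LogLog.lev, fderiv_fun_const]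
      simp
      positivity
    rw [Finset.sum_mul]
    refine Finset.sum_le_sum fun i _ => (h2 i hzD w 0 le_rfl fun k => (hm ⟨k⟩).elim).trans ?_
    simp only [hS, LogLog.lev, fderiv_fun_const]
    refine mul_le_mul_of_nonneg_left ?_ (hB i)
    have : 0 ≤ A * ‖w‖ ^ 2 := by positivity
    simp
    nlinarith

/-- Rescaling each factor by max(1, 1/b_i) makes it at least 1, so the remaining factors can be
dropped from the product. This is needed because log log |z_i|⁻¹ is positive but not at least 1. -/
theorem exists_le_const_mul_prod {ι : Type*} (s : Finset ι) {b : ι → ℝ} (hb : ∀ i ∈ s, 0 < b i) :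
    ∃ K : ℝ, 0 ≤ K ∧ ∀ a : ι → ℝ, (∀ i ∈ s, b i ≤ a i) →
      1 ≤ K * ∏ i ∈ s, a i ∧ ∀ i ∈ s, a i ≤ K * ∏ i ∈ s, a i := by
  classical
  refine ⟨∏ i ∈ s, max 1 (b i)⁻¹, Finset.prod_nonneg fun _ _ => by positivity, fun a ha => ?_⟩
  rw [← Finset.prod_mul_distrib]
  have h1 : ∀ i ∈ s, 1 ≤ max 1 (b i)⁻¹ * a i := fun i hi => by
    calc 1 = (b i)⁻¹ * b i := (inv_mul_cancel₀ (hb i hi).ne').symm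
      _ ≤ max 1 (b i)⁻¹ * a i :=
        mul_le_mul (le_max_right _ _) (ha i hi) (hb i hi).le (by positivity)
  have h2 (t : Finset ι) (ht : t ⊆ s) : 1 ≤ ∏ i ∈ t, (max 1 (b i)⁻¹ * a i) := by
    refine (Finset.prod_const_one (s := t)).symm.le.trans ?_
    exact Finset.prod_le_prod (fun _ _ => zero_le_one) fun i hi => h1 i (ht hi)
  refine ⟨h2 s subset_rfl, fun i hi => ?_⟩
  rw [← Finset.mul_prod_erase s _ hi]
  have h3 := h2 (s.erase i) (Finset.erase_subset _ _)
  have h4 : a i ≤ max 1 (b i)⁻¹ * a i :=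
    le_mul_of_one_le_left ((hb i hi).le.trans (ha i hi)) (le_max_left _ _)
  have h5 := h1 i hi
  nlinarith

theorem IsAdapted.logLogProd_pos (hc : IsAdapted D c r) {z : X} (hz : z ∈ c.source) (hzD : z ∉ D) :
    0 < logLogProd c r z :=
  Finset.prod_pos fun _ hk => Real.log_pos (hc.one_lt_log hz hzD (Finset.mem_filter.1 hk).2)

/-- log log |z_i|⁻¹ tends to 0 as |z_i| tends to 1/e, but near `x` the coordinate stays below some ρ
< 1/e. -/
theorem IsAdapted.exists_le_logLog (hc : IsAdapted D c r) (hx : x ∈ c.source) (i : Fin n)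
    (hi : (i : ℕ) < r) :
    ∃ b : ℝ, 0 < b ∧ ∀ᶠ z in 𝓝 x, z ∉ D → b ≤ Real.log (Real.log (‖c z i‖⁻¹)) := by
  obtain ⟨ρ, h1, h2⟩ := exists_between (hc.small x hx i)
  have hρ : 0 < ρ := (norm_nonneg _).trans_lt h1
  have h3 : 1 < Real.log ρ⁻¹ := by
    rw [Real.lt_log_iff_exp_lt (inv_pos.2 hρ), lt_inv_comm₀ (Real.exp_pos 1) hρ, ← one_div]
    exact h2
  refine ⟨Real.log (Real.log ρ⁻¹), Real.log_pos h3, ?_⟩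
  have hcont : ContinuousAt (fun z => ‖c z i‖) x :=
    ((continuous_apply i).continuousAt.comp (c.continuousAt hx)).norm
  filter_upwards [hcont.eventually_lt continuousAt_const h1, c.open_source.mem_nhds hx]
    with z hz hzs hzD
  have h0 : 0 < ‖c z i‖ := norm_pos_iff.2 (hc.ne_zero ⟨hzs, hzD⟩ hi)
  exact Real.log_le_log (by linarith) (Real.log_le_log (inv_pos.2 hρ) (inv_anti₀ h0 hz.le))

theorem LogModel.log_le (hD : IsClosed D) (hc : IsAdapted D c r)
    (hx : x ∈ c.source) {f : X → ℝ} (hf : ∀ z ∉ D, 1 ≤ f z) (h : LogModel D c r x f) :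
    ∃ C : ℝ, ∀ᶠ z in 𝓝 x, z ∉ D → Real.log (f z) ≤ C * logLogProd c r z := by
  have hex : ∀ i : Fin n, ∃ b : ℝ, (i : ℕ) < r → 0 < b ∧
      ∀ᶠ z in 𝓝 x, z ∉ D → b ≤ Real.log (Real.log (‖c z i‖⁻¹)) := fun i => by
    by_cases hi : (i : ℕ) < r
    · obtain ⟨b, hb⟩ := hc.exists_le_logLog hx i hi
      exact ⟨b, fun _ => hb⟩
    · exact ⟨0, fun h => (hi h).elim⟩
  choose b hb using hex
  obtain ⟨K, hK, hKb⟩ := exists_le_const_mul_prod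
    (Finset.univ.filter fun i : Fin n => (i : ℕ) < r)
    (fun i hi => (hb i (Finset.mem_filter.1 hi).2).1)
  have hev : ∀ᶠ z in 𝓝 x, z ∉ D → ∀ i ∈ Finset.univ.filter (fun i : Fin n => (i : ℕ) < r),
      b i ≤ Real.log (Real.log (‖c z i‖⁻¹)) := by
    have : ∀ i : Fin n, ∀ᶠ z in 𝓝 x, z ∉ D → (i : ℕ) < r →
        b i ≤ Real.log (Real.log (‖c z i‖⁻¹)) := fun i => by
      by_cases hi : (i : ℕ) < r
      · filter_upwards [(hb i hi).2] with z hz hzD _ using hz hzD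
      · exact Filter.Eventually.of_forall fun _ _ h => (hi h).elim
    filter_upwards [Filter.eventually_all.2 this] with z hz hzD i hi
    exact hz i hzD (Finset.mem_filter.1 hi).2
  rcases h with h | ⟨i, hi, h⟩
  · obtain ⟨C, hC, hbd⟩ := h.bounds hD hx
    refine ⟨C * K, ?_⟩
    filter_upwards [hbd, hev] with z h1 h2 hzD
    have h3 := (hKb _ (h2 hzD)).1
    have h4 := Real.log_le_sub_one_of_pos (by linarith [hf z hzD] : 0 < f z)
    have h5 := (abs_le.1 (h1 hzD).1).2
    calc Real.log (f z) ≤ C * 1 := by linarith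
      _ ≤ C * (K * logLogProd c r z) := mul_le_mul_of_nonneg_left h3 hC
      _ = _ := by ring
  · obtain ⟨C, hC, hbd⟩ := h.bounds hD hx (fun z hz hzD => hc.ne_zero ⟨hz, hzD⟩ hi)
    refine ⟨(2 + C) * K, ?_⟩
    filter_upwards [hbd, hev, c.open_source.mem_nhds hx] with z h1 h2 hzs hzD
    have hL := hc.one_lt_log hzs hzD hi
    obtain ⟨h3, h4⟩ := hKb _ (h2 hzD)
    have h4 := h4 i (by simp [hi])
    have h5 := (abs_le.1 (h1 hzD).1).2
    set L := Real.log (‖c z i‖⁻¹) with hLdef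
    have hlog : Real.log ‖c z i‖ = -L := by rw [hLdef, Real.log_inv, neg_neg]
    rw [hlog] at h5
    have hfp : 0 < f z := by linarith [hf z hzD]
    have h6 : Real.log (f z) ≤ Real.log ((2 + C) * L) := Real.log_le_log hfp (by nlinarith)
    rw [Real.log_mul (by positivity) (by linarith)] at h6
    have h7 := Real.log_le_sub_one_of_pos (by positivity : 0 < 2 + C)
    have h8 : logLogProd c r z = ∏ k ∈ Finset.univ.filter (fun k : Fin n => (k : ℕ) < r),
      Real.log (Real.log (‖c z k‖⁻¹)) := rfl
    rw [h8]
    nlinarith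

theorem IsLogSystem.logSum_le_logLogProd (h : IsLogSystem (n := n) D u) (hc : IsAdapted D c r)
    (hx : x ∈ c.source) :
    ∃ C, ∀ᶠ z in 𝓝 x, z ∉ D → logSum u z ≤ C * logLogProd c r z := by
  choose C hC using fun k => (h.model c r hc x hx k).log_le h.closed hc hx (h.one_le k)
  refine ⟨∑ k, C k, ?_⟩
  filter_upwards [Filter.eventually_all.2 hC] with z hz hzD
  rw [Finset.sum_mul]
  exact Finset.sum_le_sum fun k _ => hz k hzD

/-- If z_i vanishes at `x`, a u_k with pole there is at least of the order of log |z_i|⁻¹. Otherwise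
the left side is bounded near `x` and T ≥ 1 is enough. -/
theorem IsLogSystem.logLog_le_logSum (h : IsLogSystem (n := n) D u) (hm : 0 < m)
    (hc : IsAdapted D c r) (hx : x ∈ c.source) (i : Fin n) (hi : (i : ℕ) < r) :
    ∃ C : ℝ, 0 ≤ C ∧
      ∀ᶠ z in 𝓝 x, z ∉ D → Real.log (Real.log (‖c z i‖⁻¹)) ≤ C * logSum u z := by
  by_cases hxi : c x i = 0
  · obtain ⟨k, hk⟩ := h.cover c r hc x hx i hi hxi
    obtain ⟨C, hC, hb⟩ := hk.bounds h.closed hx (fun z hz hzD => hc.ne_zero ⟨hz, hzD⟩ hi)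
    refine ⟨1 + C, by positivity, ?_⟩
    filter_upwards [hb, c.open_source.mem_nhds hx] with z h1 hzs hzD
    have hL := hc.one_lt_log hzs hzD hi
    have h5 := (abs_le.1 (h1 hzD).1).1
    set L := Real.log (‖c z i‖⁻¹) with hLdef
    have hlog : Real.log ‖c z i‖ = -L := by rw [hLdef, Real.log_inv, neg_neg]
    rw [hlog] at h5
    have hu := h.one_le k z hzD
    have h6 : Real.log L ≤ Real.log ((1 + C) * u k z) := Real.log_le_log (by linarith)
      (by nlinarith)
    rw [Real.log_mul (by positivity) (by linarith)] at h6
    have h7 := Real.log_le_sub_one_of_pos (by positivity : 0 < 1 + C)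
    have h8 := h.log_le_logSum k hzD
    have h9 := h.one_le_logSum hm hzD
    nlinarith
  · have hcont : ContinuousAt (fun z => Real.log (‖c z i‖⁻¹)) x := by
      have h1 : ContinuousAt (fun z => ‖c z i‖) x :=
        ((continuous_apply i).continuousAt.comp (c.continuousAt hx)).norm
      exact (h1.inv₀ (norm_ne_zero_iff.2 hxi)).log (inv_ne_zero (norm_ne_zero_iff.2 hxi))
    refine ⟨‖Real.log (‖c x i‖⁻¹)‖ + 1, by positivity, ?_⟩
    filter_upwards [eventually_norm_lt_add_one hcont, c.open_source.mem_nhds hx] with z h1 hzs hzD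
    have hL := hc.one_lt_log hzs hzD hi
    have h2 := Real.log_le_sub_one_of_pos (by linarith : 0 < Real.log (‖c z i‖⁻¹))
    have h9 := h.one_le_logSum hm hzD
    have h3 := le_abs_self (Real.log (‖c z i‖⁻¹))
    rw [← Real.norm_eq_abs] at h3
    refine le_trans ?_ (le_mul_of_one_le_right (by positivity) h9)
    linarith

theorem IsLogSystem.logLogProd_le_logSum (h : IsLogSystem (n := n) D u) (hm : 0 < m)
    (hc : IsAdapted D c r) (hx : x ∈ c.source) :
    ∃ C, ∃ M : ℕ, ∀ᶠ z in 𝓝 x, z ∉ D → logLogProd c r z ≤ C * logSum u z ^ M := by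
  have hex : ∀ i : Fin n, ∃ C : ℝ, (i : ℕ) < r →
      ∀ᶠ z in 𝓝 x, z ∉ D → Real.log (Real.log (‖c z i‖⁻¹)) ≤ C * logSum u z := fun i => by
    by_cases hi : (i : ℕ) < r
    · obtain ⟨b, hb⟩ := h.logLog_le_logSum hm hc hx i hi
      exact ⟨b, fun _ => hb.2⟩
    · exact ⟨0, fun h => (hi h).elim⟩
  choose C hC using hex
  refine ⟨∏ i ∈ Finset.univ.filter (fun i : Fin n => (i : ℕ) < r), C i,
    (Finset.univ.filter (fun i : Fin n => (i : ℕ) < r)).card, ?_⟩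
  have : ∀ i : Fin n, ∀ᶠ z in 𝓝 x, z ∉ D → (i : ℕ) < r →
      Real.log (Real.log (‖c z i‖⁻¹)) ≤ C i * logSum u z := fun i => by
    by_cases hi : (i : ℕ) < r
    · filter_upwards [(hC i hi)] with z hz hzD _ using hz hzD
    · exact Filter.Eventually.of_forall fun _ _ h => (hi h).elim
  filter_upwards [Filter.eventually_all.2 this, c.open_source.mem_nhds hx] with z hz hzs hzD
  rw [← Finset.prod_const, ← Finset.prod_mul_distrib]
  refine Finset.prod_le_prod (fun i hi => ?_) fun i hi => hz i hzD (Finset.mem_filter.1 hi).2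
  exact (Real.log_pos (hc.one_lt_log hzs hzD (Finset.mem_filter.1 hi).2)).le

end LogSystem

/-! ### Growth of df and ddᶜf from bounds on frame components; linear combinations; powers of T. -/

section Growth

variable {n : ℕ} {X : Type*} [TopologicalSpace X] [ChartedSpace (Cn n) X]
  {D : Set X} {T : X → ℝ} {E : Set ℕ} {c : OpenPartialHomeomorph X (Cn n)} {r : ℕ}

theorem del_ofReal (f : X → ℝ) :
    del (n := n) (fun x => (f x : ℂ)) = mixedOneForm (1 / 2) (-(Complex.I / 2)) f := by
  ext x v
  simp only [del, mixedOneForm, add_apply, smul_apply, sub_apply, smul_eq_mul]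
  ring

theorem delbar_ofReal (f : X → ℝ) :
    delbar (n := n) (fun x => (f x : ℂ)) = mixedOneForm (1 / 2) (Complex.I / 2) f := by
  ext x v
  simp only [delbar, mixedOneForm, add_apply, smul_apply, smul_eq_mul]
  ring

theorem dFun_ofReal (f : X → ℝ) :
    dFun (n := n) (fun x => (f x : ℂ)) = mixedOneForm 1 0 f := by
  ext x v
  simp [mixedOneForm]

theorem dc_ofReal (f : X → ℝ) :
    dc (n := n) (fun x => (f x : ℂ)) = mixedOneForm 0 (-(4 * (Real.pi : ℂ))⁻¹) f := by
  ext x v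
  simp only [dc, delbar, del, mixedOneForm, add_apply, smul_apply, sub_apply, smul_eq_mul]
  linear_combination ((4 * (Real.pi : ℂ))⁻¹ *
    (((dFun (fun x => (f x : ℂ)) x).comp (J x)) v)) * Complex.I_sq

theorem contMDiffAt_ofReal {f : X → ℝ} {x : X}
    (hf : ContMDiffAt 𝓘(ℝ, Cn n) 𝓘(ℝ, ℝ) ∞ f x) :
    ContMDiffAt 𝓘(ℝ, Cn n) 𝓘(ℝ, ℂ) ∞ (fun x => (f x : ℂ)) x :=
  ContMDiffAt.comp x (g := Complex.ofRealCLM) Complex.ofRealCLM.contDiff.contMDiff.contMDiffAt hf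

theorem contMDiffAt_of_ofReal {f : X → ℝ} {x : X}
    (hf : ContMDiffAt 𝓘(ℝ, Cn n) 𝓘(ℝ, ℂ) ∞ (fun x => (f x : ℂ)) x) :
    ContMDiffAt 𝓘(ℝ, Cn n) 𝓘(ℝ, ℝ) ∞ f x :=
  ContMDiffAt.comp x (g := Complex.reCLM) Complex.reCLM.contDiff.contMDiff.contMDiffAt hf

theorem contMDiffOn_ofReal_iff (hD : IsClosed D) {f : X → ℝ} :
    ContMDiffOn 𝓘(ℝ, Cn n) 𝓘(ℝ, ℂ) ∞ (fun x => (f x : ℂ)) Dᶜ ↔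
      ∀ x ∉ D, ContMDiffAt 𝓘(ℝ, Cn n) 𝓘(ℝ, ℝ) ∞ f x :=
  ⟨fun h _ hx => contMDiffAt_of_ofReal (h.contMDiffAt (hD.isOpen_compl.mem_nhds hx)),
    fun h _ hx => (contMDiffAt_ofReal (h _ hx)).contMDiffWithinAt⟩

theorem eventually_contMDiffAt (hD : IsClosed D) {f : X → ℝ}
    (hf : ∀ x ∉ D, ContMDiffAt 𝓘(ℝ, Cn n) 𝓘(ℝ, ℝ) ∞ f x) {x : X} (hx : x ∉ D) :
    ∀ᶠ z in 𝓝 x, ContMDiffAt 𝓘(ℝ, Cn n) 𝓘(ℝ, ℝ) ∞ f z := by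
  filter_upwards [hD.isOpen_compl.mem_nhds hx] with z hz using hf z hz

theorem contMDiffAt_add_const_mul {f g : X → ℝ} {x : X}
    (hf : ContMDiffAt 𝓘(ℝ, Cn n) 𝓘(ℝ, ℝ) ∞ f x) (hg : ContMDiffAt 𝓘(ℝ, Cn n) 𝓘(ℝ, ℝ) ∞ g x)
    (K : ℝ) : ContMDiffAt 𝓘(ℝ, Cn n) 𝓘(ℝ, ℝ) ∞ (fun z => f z + K * g z) x :=
  hf.add (contMDiffAt_const.mul hg)

theorem twoForm_ext {x : X} {α β : (TangentSpace 𝓘(ℝ, Cn n) x) [⋀^Fin 2]→L[ℝ] ℂ}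
    (h : ∀ v w, α ![v, w] = β ![v, w]) : α = β := by
  ext v
  have : v = ![v 0, v 1] := by ext i; fin_cases i <;> rfl
  rw [this]
  exact h _ _

variable [IsManifold 𝓘(ℂ, Cn n) ω X]

theorem mixedOneForm_add_const_mul (hc : c ∈ maximalAtlas 𝓘(ℂ, Cn n) ω X) (a b : ℂ)
    {f g : X → ℝ} {x : X} (hx : x ∈ c.source)
    (hf : ContMDiffAt 𝓘(ℝ, Cn n) 𝓘(ℝ, ℝ) ∞ f x) (hg : ContMDiffAt 𝓘(ℝ, Cn n) 𝓘(ℝ, ℝ) ∞ g x)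
    (K : ℝ) : mixedOneForm (n := n) a b (fun z => f z + K * g z) x =
      mixedOneForm a b f x + (K : ℂ) • mixedOneForm a b g x := by
  ext v
  refine ((mixedOneForm_apply hc a b hx (contMDiffAt_add_const_mul hf hg K) v).trans ?_).trans
    (congrArg₂ (· + ·) (mixedOneForm_apply hc a b hx hf v).symm
      (congrArg ((K : ℂ) * ·) (mixedOneForm_apply hc a b hx hg v).symm))
  have h1 := (contDiffAt_comp_symm hc hx hf).differentiableAt (by simp)
  have h2 := (contDiffAt_comp_symm hc hx hg).differentiableAt (by simp)
  simp only [mixedForm_apply, fderiv_fun_add h1 (h2.const_mul K), fderiv_const_mul h2, add_apply,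
    smul_apply, smul_eq_mul]
  push_cast
  ring

theorem lev_add_const_mul (hc : c ∈ maximalAtlas 𝓘(ℂ, Cn n) ω X)
    {f g : X → ℝ} {x : X} (hx : x ∈ c.source)
    (hf : ContMDiffAt 𝓘(ℝ, Cn n) 𝓘(ℝ, ℝ) ∞ f x) (hg : ContMDiffAt 𝓘(ℝ, Cn n) 𝓘(ℝ, ℝ) ∞ g x)
    (K : ℝ) (v w : Cn n) : lev (fun y => f (c.symm y) + K * g (c.symm y)) (c x) v w =
      lev (fun y => f (c.symm y)) (c x) v w + K * lev (fun y => g (c.symm y)) (c x) v w := by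
  have h1 := contDiffAt_comp_symm hc hx hf
  have h2 := contDiffAt_comp_symm hc hx hg
  rw [lev_add h1 (contDiffAt_const.mul h2), lev_const_mul K h2]

theorem GeneratedBy.mixedOneForm_add {P : (X → ℂ) → Prop}
    (hadd : ∀ g g', P g → P g' → P (fun z => g z + g' z))
    (hmul : ∀ (a : ℂ) g, P g → P (fun z => a * g z)) (hc : c ∈ maximalAtlas 𝓘(ℂ, Cn n) ω X)
    {a b : ℂ}
    {f g : X → ℝ} (hf : ∀ x ∉ D, ContMDiffAt 𝓘(ℝ, Cn n) 𝓘(ℝ, ℝ) ∞ f x)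
    (hg : ∀ x ∉ D, ContMDiffAt 𝓘(ℝ, Cn n) 𝓘(ℝ, ℝ) ∞ g x) (K : ℝ)
    (h1 : GeneratedBy P D c r (oneForm (mixedOneForm (n := n) a b f)))
    (h2 : GeneratedBy P D c r (oneForm (mixedOneForm (n := n) a b g))) :
    GeneratedBy P D c r (oneForm (mixedOneForm (n := n) a b fun z => f z + K * g z)) := by
  refine h1.add hadd (h2.const_smul (a := K) (γ := fun x => (K : ℂ) •
    oneForm (mixedOneForm (n := n) a b g) x) (hmul K) fun _ _ => rfl) fun x hx => ?_
  ext v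
  have := DFunLike.congr_fun
    (mixedOneForm_add_const_mul hc a b hx.1 (hf x hx.2) (hg x hx.2) K) (v 0)
  exact this

theorem GeneratedBy.extD_add {P : (X → ℂ) → Prop} (hD : IsClosed D)
    (hadd : ∀ g g', P g → P g' → P (fun z => g z + g' z))
    (hmul : ∀ (a : ℂ) g, P g → P (fun z => a * g z)) (hc : c ∈ maximalAtlas 𝓘(ℂ, Cn n) ω X)
    {a b : ℂ}
    {f g : X → ℝ} (hf : ∀ x ∉ D, ContMDiffAt 𝓘(ℝ, Cn n) 𝓘(ℝ, ℝ) ∞ f x)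
    (hg : ∀ x ∉ D, ContMDiffAt 𝓘(ℝ, Cn n) 𝓘(ℝ, ℝ) ∞ g x) (K : ℝ)
    (h1 : GeneratedBy P D c r (extD (oneForm (mixedOneForm (n := n) a b f))))
    (h2 : GeneratedBy P D c r (extD (oneForm (mixedOneForm (n := n) a b g)))) :
    GeneratedBy P D c r (extD (oneForm (mixedOneForm (n := n) a b fun z => f z + K * g z))) := by
  refine h1.add hadd (h2.const_smul (a := K) (γ := fun x => (K : ℂ) •
    extD (oneForm (mixedOneForm (n := n) a b g)) x) (hmul K) fun _ _ => rfl) fun x hx => ?_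
  refine twoForm_ext fun v w => ?_
  rw [extD_mixedOneForm hc a b hx.1 (eventually_contMDiffAt hD
      (fun z hz => contMDiffAt_add_const_mul (hf z hz) (hg z hz) K) hx.2),
    lev_add_const_mul hc hx.1 (hf x hx.2) (hg x hx.2)]
  refine Eq.trans ?_ (congrArg₂ (· + ·)
    (extD_mixedOneForm hc a b hx.1 (eventually_contMDiffAt hD hf hx.2) v w).symm
    (congrArg ((K : ℂ) * ·)
      (extD_mixedOneForm hc a b hx.1 (eventually_contMDiffAt hD hg hx.2) v w).symm))
  push_cast
  ring

/-- Both forms are multiples, with factors `b` and `b'`, of the same real form. This converts bounds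
on ∂∂̄f into bounds on ddᶜf. -/
theorem GeneratedBy.extD_mixedOneForm_of {P : (X → ℂ) → Prop} (hD : IsClosed D)
    (hmul : ∀ (a : ℂ) g, P g → P (fun z => a * g z)) (hc : c ∈ maximalAtlas 𝓘(ℂ, Cn n) ω X)
    {a b a' b' : ℂ} (hb : b ≠ 0) {f : X → ℝ}
    (hf : ∀ x ∉ D, ContMDiffAt 𝓘(ℝ, Cn n) 𝓘(ℝ, ℝ) ∞ f x)
    (h : GeneratedBy P D c r (extD (oneForm (mixedOneForm (n := n) a b f)))) :
    GeneratedBy P D c r (extD (oneForm (mixedOneForm (n := n) a' b' f))) := by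
  refine h.const_smul (a := b' / b) (hmul _) fun x hx => twoForm_ext fun v w => ?_
  rw [extD_mixedOneForm hc a' b' hx.1 (eventually_contMDiffAt hD hf hx.2)]
  refine Eq.trans ?_ (congrArg (b' / b * ·)
    (extD_mixedOneForm hc a b hx.1 (eventually_contMDiffAt hD hf hx.2) v w).symm)
  field_simp

theorem Tame.ofReal (hc : c ∈ maximalAtlas 𝓘(ℂ, Cn n) ω X) {G : Cn n → ℝ}
    (hG : ∀ z ∈ c.source \ D, ContDiffAt ℝ ∞ G (c z))
    (hb : ∀ x ∈ c.source, LocBound D T E x fun z => |G (c z)|) :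
    Tame D T E c fun z => (G (c z) : ℂ) where
  smooth z hz := (contMDiffAt_ofReal (contMDiffAt_comp_chart hc hz.1 (hG z hz))).contMDiffWithinAt
  bound x hx := by simpa using hb x hx

theorem FrameBounded.generated_one (hT : ∀ z ∉ D, 1 ≤ T z) (hc : IsAdapted D c r) {f : X → ℝ}
    (hf : ∀ x ∉ D, ContMDiffAt 𝓘(ℝ, Cn n) 𝓘(ℝ, ℝ) ∞ f x) (h : FrameBounded D T E c r f) (a b : ℂ) :
    GeneratedBy (Tame D T E c) D c r (oneForm (mixedOneForm (n := n) a b f)) := by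
  refine generatedBy_one_of_frame (fun g g' => Tame.add hT) (fun a g hg => hg.const_mul a) hc
    (fun x => (mixedForm a b (fun y => f (c.symm y)) (c x)).toLinearMap) (fun x hx v =>
      mixedOneForm_apply hc.mem_maximalAtlas a b hx.1 (hf x hx.2) (v 0)) fun k ε hε => ?_
  have hε1 : ‖ε‖ ≤ 1 := by rcases hε with rfl | rfl <;> simp
  have hIε : ‖Complex.I * ε‖ ≤ 1 := by simpa using hε1
  have ht (δ : ℂ) (hδ : ‖δ‖ ≤ 1) : Tame D T E c fun z =>
      (fderiv ℝ (fun y => f (c.symm y)) (c z) (frameVec r k δ (c z)) : ℂ) :=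
    Tame.ofReal hc.mem_maximalAtlas
      (G := fun y => fderiv ℝ (fun y => f (c.symm y)) y (frameVec r k δ y))
      (fun z hz => ContDiffAt.fderiv_frameVec δ
        (contDiffAt_comp_symm hc.mem_maximalAtlas hz.1 (hf z hz.2)) (hc.ne_zero hz))
      (fun x hx => h.deriv x hx k δ hδ)
  have := ((ht ε hε1).const_mul a).add hT ((ht _ hIε).const_mul b)
  refine cast (congrArg _ (funext fun z => ?_)) this
  simp only [ContinuousLinearMap.coe_coe, mixedForm_apply, I_smul_frameVec]

theorem FrameBounded.generated_two (hD : IsClosed D) (hT : ∀ z ∉ D, 1 ≤ T z)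
    (hc : IsAdapted D c r) {f : X → ℝ}
    (hf : ∀ x ∉ D, ContMDiffAt 𝓘(ℝ, Cn n) 𝓘(ℝ, ℝ) ∞ f x) (h : FrameBounded D T E c r f) (a b : ℂ) :
    GeneratedBy (Tame D T E c) D c r (extD (oneForm (mixedOneForm (n := n) a b f))) := by
  refine generatedBy_two_of_frame (fun g g' => Tame.add hT) (fun a g hg => hg.const_mul a) hc
    (fun x => LinearMap.mk₂ ℝ
      (fun v w => b * (levBilin (fun y => f (c.symm y)) (c x) v w : ℂ))
      (fun v v' w => by simp [mul_add]) (fun s v w => by simp; ring)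
      (fun v w w' => by simp [mul_add]) (fun s v w => by simp; ring))
    (fun x v w => ?_) (fun x hx v => ?_) fun k l ε hε δ hδ => ?_
  · simp only [LinearMap.mk₂_apply, levBilin]
    rw [lev_antisymm]
    push_cast
    ring
  · have : v = ![v 0, v 1] := by ext i; fin_cases i <;> rfl
    conv_lhs => rw [this]
    rw [extD_mixedOneForm hc.mem_maximalAtlas a b hx.1 (eventually_contMDiffAt hD hf hx.2)]
    rfl
  · have hε1 : ‖ε‖ ≤ 1 := by rcases hε with rfl | rfl <;> simp
    have hδ1 : ‖δ‖ ≤ 1 := by rcases hδ with rfl | rfl <;> simp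
    exact (Tame.ofReal hc.mem_maximalAtlas
      (G := fun y => LogLog.lev (fun y => f (c.symm y)) y (frameVec r k ε y) (frameVec r l δ y))
      (fun z hz => ContDiffAt.lev_frameVec ε δ
        (contDiffAt_comp_symm hc.mem_maximalAtlas hz.1 (hf z hz.2)) (hc.ne_zero hz) (hc.ne_zero hz))
      (fun x hx => h.lev x hx k l ε δ hε1 hδ1)).const_mul b

/-- Differentiating Tᴹ leaves factors Tᴹ⁻¹ and Tᴹ⁻² next to bounded components of dT and ddᶜT, so
the exponent set grows from `{0}` to `Set.univ`: powers of T stay in the log-log class. -/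
theorem FrameBounded.pow (hT : ∀ z ∉ D, 1 ≤ T z) (hc : IsAdapted D c r)
    (hTs : ∀ x ∉ D, ContMDiffAt 𝓘(ℝ, Cn n) 𝓘(ℝ, ℝ) ∞ T x) (h : FrameBounded D T {0} c r T) (M : ℕ) :
    FrameBounded D T Set.univ c r (fun x => T x ^ M) where
  deriv := by
    intro x hx k ε hε
    obtain ⟨N, hN, C, hC, hb⟩ := h.deriv x hx k ε hε
    rw [Set.mem_singleton_iff] at hN
    subst hN
    refine ⟨M - 1, Set.mem_univ _, M * C, by positivity, ?_⟩
    filter_upwards [hb, c.open_source.mem_nhds hx] with z h1 hzs hzD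
    have hF := contDiffAt_comp_symm hc.mem_maximalAtlas hzs (hTs z hzD)
    rw [fderiv_comp_apply (g := fun t => t ^ M) (hF.differentiableAt (by simp))
      (hasDerivAt_pow M _), c.left_inv hzs, abs_mul, abs_mul, Nat.abs_cast,
      abs_of_nonneg (pow_nonneg (zero_le_one.trans (hT z hzD)) _)]
    have h2 := h1 hzD
    rw [pow_zero, mul_one] at h2
    have h3 : 0 ≤ (M : ℝ) * T z ^ (M - 1) :=
      mul_nonneg (Nat.cast_nonneg _) (pow_nonneg (zero_le_one.trans (hT z hzD)) _)
    calc _ ≤ (M : ℝ) * T z ^ (M - 1) * C := mul_le_mul_of_nonneg_left h2 h3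
      _ = _ := by ring
  lev := by
    intro x hx k l ε δ hε hδ
    have hIε : ‖Complex.I * ε‖ ≤ 1 := by simpa using hε
    have hIδ : ‖Complex.I * δ‖ ≤ 1 := by simpa using hδ
    have hd (k : Fin n) (ε : ℂ) (hε : ‖ε‖ ≤ 1) : ∃ C : ℝ, 0 ≤ C ∧ ∀ᶠ z in 𝓝 x, z ∉ D →
        |fderiv ℝ (fun y => T (c.symm y)) (c z) (frameVec r k ε (c z))| ≤ C := by
      obtain ⟨N, hN, C, hC, hb⟩ := h.deriv x hx k ε hε
      rw [Set.mem_singleton_iff] at hN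
      subst hN
      exact ⟨C, hC, by simpa using hb⟩
    obtain ⟨N, hN, C, hC, hb⟩ := h.lev x hx k l ε δ hε hδ
    rw [Set.mem_singleton_iff] at hN
    subst hN
    obtain ⟨C1, hC1, hb1⟩ := hd k ε hε
    obtain ⟨C2, hC2, hb2⟩ := hd l δ hδ
    obtain ⟨C3, hC3, hb3⟩ := hd k _ hIε
    obtain ⟨C4, hC4, hb4⟩ := hd l _ hIδ
    refine ⟨M, Set.mem_univ _, M * C + M * M * (C1 * C4 + C2 * C3), by positivity, ?_⟩
    filter_upwards [hb, hb1, hb2, hb3, hb4, c.open_source.mem_nhds hx]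
      with z g g1 g2 g3 g4 hzs hzD
    have hF := contDiffAt_comp_symm hc.mem_maximalAtlas hzs (hTs z hzD)
    have hTz := hT z hzD
    have hT0 : 0 ≤ T z := zero_le_one.trans hTz
    have hp := lev_comp (g := fun t => t ^ M) (g' := fun t => M * t ^ (M - 1)) hF
      (Filter.Eventually.of_forall fun t => hasDerivAt_pow M t)
      ((hasDerivAt_pow (M - 1) _).const_mul (M : ℝ))
      (frameVec r k ε (c z)) (frameVec r l δ (c z))
    rw [hp, c.left_inv hzs, I_smul_frameVec, I_smul_frameVec]
    have g := g hzD
    rw [pow_zero, mul_one] at g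
    have hpow1 : T z ^ (M - 1) ≤ T z ^ M := pow_le_pow_right₀ hTz (Nat.sub_le _ _)
    have hpow2 : T z ^ (M - 1 - 1) ≤ T z ^ M := pow_le_pow_right₀ hTz (by omega)
    have hM1 : ((M - 1 : ℕ) : ℝ) ≤ M := by exact_mod_cast Nat.sub_le _ _
    have q0 : 0 ≤ T z ^ (M - 1) := pow_nonneg hT0 _
    have q1 : 0 ≤ T z ^ (M - 1 - 1) := pow_nonneg hT0 _
    refine (abs_add_le _ _).trans ?_
    have e1 : |(M : ℝ) * T z ^ (M - 1) * LogLog.lev (fun y => T (c.symm y)) (c z) (frameVec r k ε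
      (c z))
        (frameVec r l δ (c z))| ≤ M * T z ^ M * C := by
      rw [abs_mul, abs_of_nonneg (by positivity)]
      exact mul_le_mul (mul_le_mul_of_nonneg_left hpow1 (Nat.cast_nonneg M)) g (abs_nonneg _)
        (by positivity)
    refine (add_le_add e1 (d := M * (M * T z ^ M) * (C1 * C4 + C2 * C3)) ?_).trans
      (le_of_eq (by ring))
    rw [abs_mul, abs_of_nonneg (by positivity)]
    refine mul_le_mul (mul_le_mul_of_nonneg_left (mul_le_mul hM1 hpow2 q1 (Nat.cast_nonneg M))
      (Nat.cast_nonneg M)) ?_ (abs_nonneg _) (by positivity)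
    refine (abs_sub _ _).trans ?_
    rw [abs_mul, abs_mul]
    exact add_le_add (mul_le_mul (g1 hzD) (g4 hzD) (abs_nonneg _) hC1)
      (mul_le_mul (g2 hzD) (g3 hzD) (abs_nonneg _) hC2)

end Growth

/-! ### Integration along radial paths in the Poincaré metric. -/

section Radial

variable {n : ℕ}

/-- The point `y` is joined to a compact set away from the relevant hyperplanes by moving the
coordinates that vanish at `y₀` outward along rays until they have modulus δ. When log log |z_k|⁻¹
is made affine in time, dζ_k of the velocity has constant modulus, so the mean value inequality
yields growth at most linear in log log. -/
theorem exists_radial_bound {F : Cn n → ℝ} {y₀ : Cn n} {δ C : ℝ} {r : ℕ} (hδ : 0 < δ) (hδ1 : δ < 1)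
    (h0 : ∀ k : Fin n, (k : ℕ) < r → y₀ k = 0 ∨ δ < ‖y₀ k‖)
    (hF : ∀ y ∈ Metric.closedBall y₀ δ, (∀ k : Fin n, (k : ℕ) < r → y k ≠ 0) →
      DifferentiableAt ℝ F y ∧ ∀ w, |fderiv ℝ F y w| ≤ C * ∑ k, ‖(tau r k y)⁻¹ * w k‖) :
    ∃ M : ℝ, 0 ≤ M ∧ ∀ y ∈ Metric.closedBall y₀ δ, (∀ k : Fin n, (k : ℕ) < r → y k ≠ 0) →
      |F y| ≤ M + |C| * ∑ k ∈ Finset.univ.filter (fun k : Fin n => (k : ℕ) < r ∧ y₀ k = 0),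
        (|Real.log (Real.log (‖y k‖⁻¹))| + M) := by
  classical
  set S := Finset.univ.filter (fun k : Fin n => (k : ℕ) < r ∧ y₀ k = 0) with hS
  have hmem (k : Fin n) : k ∈ S ↔ (k : ℕ) < r ∧ y₀ k = 0 := by simp [hS]
  have hother {y : Cn n} (hy : y ∈ Metric.closedBall y₀ δ) {k : Fin n} (hk : (k : ℕ) < r)
      (hkS : k ∉ S) : y k ≠ 0 := by
    intro hyk
    rcases h0 k hk with h | h
    · exact hkS ((hmem k).2 ⟨hk, h⟩)
    · have h1 := (dist_le_pi_dist y y₀ k).trans hy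
      rw [hyk, dist_zero_left] at h1
      linarith
  -- The endpoints of all paths lie in this compact set. Coordinates outside `S` stay nonzero on the
  -- ball by `h0`, so F is continuous, hence bounded, on it.
  set K := Metric.closedBall y₀ δ ∩ {y | ∀ k ∈ S, ‖y k‖ = δ} with hK
  have hKc : IsCompact K := by
    refine (isCompact_closedBall y₀ δ).inter_right ?_
    have : {y : Cn n | ∀ k ∈ S, ‖y k‖ = δ} = ⋂ k ∈ S, {y | ‖y k‖ = δ} := by ext; simp
    rw [this]
    exact isClosed_biInter fun k _ => isClosed_eq (continuous_apply k).norm continuous_const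
  have hKF : ContinuousOn F K := by
    rintro y ⟨hy, hyS⟩
    refine (hF y hy fun k hk => ?_).1.continuousAt.continuousWithinAt
    by_cases hkS : k ∈ S
    · intro h
      have := hyS k hkS
      rw [h, norm_zero] at this
      exact hδ.ne this
    · exact hother hy hk hkS
  obtain ⟨M, hM⟩ := hKc.exists_bound_of_continuousOn hKF
  set aδ := Real.log (Real.log δ⁻¹) with haδ
  have hLδ : 0 < Real.log δ⁻¹ := Real.log_pos ((one_lt_inv₀ hδ).2 hδ1)
  refine ⟨|M| + |aδ|, by positivity, fun y hy hy0 => ?_⟩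
  have hyS : ∀ k ∈ S, 0 < ‖y k‖ ∧ ‖y k‖ ≤ δ := fun k hk => by
    obtain ⟨h1, h2⟩ := (hmem k).1 hk
    refine ⟨norm_pos_iff.2 (hy0 k h1), ?_⟩
    have h3 := (dist_le_pi_dist y y₀ k).trans hy
    rwa [h2, dist_zero_right] at h3
  set a : Fin n → ℝ := fun k => Real.log (Real.log (‖y k‖⁻¹)) with ha
  have hLk : ∀ k ∈ S, Real.log δ⁻¹ ≤ Real.log (‖y k‖⁻¹) := fun k hk =>
    Real.log_le_log (inv_pos.2 hδ) (inv_anti₀ (hyS k hk).1 (hyS k hk).2)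
  have hak : ∀ k ∈ S, aδ ≤ a k := fun k hk => Real.log_le_log hLδ (hLk k hk)
  -- `s k t` is the prescribed value of log log |z_k|⁻¹ at time t, so the modulus must be exp(-exp
  -- s); the argument of the coordinate is kept.
  set s : Fin n → ℝ → ℝ := fun k t => a k + t * (aδ - a k) with hs
  set γ : ℝ → Cn n := fun t k => if k ∈ S then (y k / (‖y k‖ : ℂ)) *
    ((Real.exp (-Real.exp (s k t)) : ℝ) : ℂ) else y k with hγ
  set γ' : ℝ → Cn n := fun t k => if k ∈ S then (y k / (‖y k‖ : ℂ)) *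
    ((Real.exp (-Real.exp (s k t)) * (-(Real.exp (s k t) * (aδ - a k))) : ℝ) : ℂ) else 0 with hγ'
  have hunit : ∀ k ∈ S, ‖y k / (‖y k‖ : ℂ)‖ = 1 := fun k hk => by
    rw [norm_div, Complex.norm_real, norm_norm, div_self (hyS k hk).1.ne']
  have hnorm (t : ℝ) : ∀ k ∈ S, ‖γ t k‖ = Real.exp (-Real.exp (s k t)) := fun k hk => by
    simp only [hγ, hk, if_true]
    rw [norm_mul, hunit k hk, one_mul, Complex.norm_real, Real.norm_eq_abs,
      abs_of_pos (Real.exp_pos _)]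
  have hderiv (t : ℝ) : HasDerivAt γ (γ' t) t := by
    refine hasDerivAt_pi.2 fun k => ?_
    by_cases hk : k ∈ S
    · simp only [hγ, hγ', hk, if_true]
      have h1 : HasDerivAt (s k) (aδ - a k) t := by
        have h := ((hasDerivAt_id t).mul_const (aδ - a k)).const_add (a k)
        rwa [one_mul] at h
      exact (h1.exp.neg.exp.ofReal_comp).const_mul _
    · simp only [hγ, hγ', hk, if_false]
      exact hasDerivAt_const _ _
  have hexpδ : Real.exp (-Real.exp aδ) = δ := by
    rw [haδ, Real.exp_log hLδ, Real.log_inv, neg_neg, Real.exp_log hδ]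
  have hγball : ∀ t ∈ Set.Icc (0 : ℝ) 1, γ t ∈ Metric.closedBall y₀ δ := fun t ht => by
    rw [Metric.mem_closedBall, dist_pi_le_iff hδ.le]
    intro k
    by_cases hk : k ∈ S
    · rw [((hmem k).1 hk).2, dist_zero_right, hnorm t k hk]
      refine le_trans ?_ hexpδ.le
      rw [Real.exp_le_exp, neg_le_neg_iff, Real.exp_le_exp]
      have := hak k hk
      have h1 : 0 ≤ (1 - t) * (a k - aδ) := mul_nonneg (by linarith [ht.2]) (by linarith)
      simp only [hs]
      nlinarith
    · simp only [hγ, hk, if_false]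
      exact (dist_le_pi_dist y y₀ k).trans hy
  have hγ0 : ∀ t ∈ Set.Icc (0 : ℝ) 1, ∀ k : Fin n, (k : ℕ) < r → γ t k ≠ 0 := fun t ht k hk => by
    by_cases hkS : k ∈ S
    · rw [← norm_ne_zero_iff, hnorm t k hkS]
      exact (Real.exp_pos _).ne'
    · exact hother (hγball t ht) hk hkS
  have hspeed (t : ℝ) : ∀ k, ‖(tau r k (γ t))⁻¹ * γ' t k‖ ≤ if k ∈ S then |a k| + |aδ| else 0 := by
    intro k
    by_cases hk : k ∈ S
    · have e1 : tau r k (γ t) = γ t k * ((Real.exp (s k t) : ℝ) : ℂ) := by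
        rw [tau, if_pos ((hmem k).1 hk).1, hnorm t k hk, ← Real.exp_neg, neg_neg, Real.log_exp]
      have e2 : γ' t k = -(tau r k (γ t) * ((aδ - a k : ℝ) : ℂ)) := by
        rw [e1]
        simp only [hγ, hγ', hk, if_true]
        push_cast
        ring
      have e3 : tau r k (γ t) ≠ 0 := by
        rw [e1]
        refine mul_ne_zero ?_ (by exact_mod_cast (Real.exp_pos _).ne')
        rw [← norm_ne_zero_iff, hnorm t k hk]
        exact (Real.exp_pos _).ne'
      rw [e2, mul_neg, inv_mul_cancel_left₀ e3, norm_neg, Complex.norm_real, Real.norm_eq_abs,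
        if_pos hk, add_comm]
      exact abs_sub _ _
    · simp [hγ', hk]
  have hmvt := norm_image_sub_le_of_norm_deriv_le_segment_01' (f := fun t => F (γ t))
    (f' := fun t => fderiv ℝ F (γ t) (γ' t)) (C := |C| * ∑ k ∈ S, (|a k| + |aδ|))
    (fun t ht => ((hF (γ t) (hγball t ht) (hγ0 t ht)).1.hasFDerivAt.comp_hasDerivAt t
      (hderiv t)).hasDerivWithinAt) (fun t ht => by
        have ht' := Set.Ico_subset_Icc_self ht
        refine ((hF (γ t) (hγball t ht') (hγ0 t ht')).2 (γ' t)).trans ?_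
        refine mul_le_mul (le_abs_self C) ?_ (Finset.sum_nonneg fun _ _ => norm_nonneg _)
          (abs_nonneg C)
        refine (Finset.sum_le_sum fun k _ => hspeed t k).trans (le_of_eq ?_)
        rw [Finset.sum_ite_mem, Finset.univ_inter])
  have hγz : γ 0 = y := by
    ext k
    by_cases hk : k ∈ S
    · have h1 := hyS k hk
      have h2 : 0 < Real.log (‖y k‖⁻¹) := hLδ.trans_le (hLk k hk)
      simp only [hγ, hk, if_true, hs, ha, zero_mul, add_zero]
      rw [Real.exp_log h2, Real.log_inv, neg_neg, Real.exp_log h1.1]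
      have : (‖y k‖ : ℂ) ≠ 0 := by exact_mod_cast h1.1.ne'
      field_simp
    · simp [hγ, hk]
  have hγ1 : γ 1 ∈ K := by
    refine ⟨hγball 1 ⟨zero_le_one, le_rfl⟩, fun k hk => ?_⟩
    rw [hnorm 1 k hk]
    simp only [hs, one_mul, add_sub_cancel]
    exact hexpδ
  have h1 := hM _ hγ1
  simp only [hγz, Real.norm_eq_abs] at hmvt h1
  have h2 : ∑ k ∈ S, (|a k| + |aδ|) ≤ ∑ k ∈ S, (|a k| + (|M| + |aδ|)) :=
    Finset.sum_le_sum fun k _ => by linarith [abs_nonneg M]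
  have h3 := mul_le_mul_of_nonneg_left h2 (abs_nonneg C)
  have h4 := abs_sub_abs_le_abs_sub (F y) (F (γ 1))
  rw [abs_sub_comm] at h4
  linarith [le_abs_self M, abs_nonneg aδ]

end Radial

/-! ### Existence of adapted charts. -/

section AdaptedCharts

variable {n : ℕ} {X : Type*} [TopologicalSpace X] [ChartedSpace (Cn n) X] {D : Set X}

theorem trans_mem_maximalAtlas [IsManifold 𝓘(ℂ, Cn n) ω X] {c : OpenPartialHomeomorph X (Cn n)}
    (hc : c ∈ maximalAtlas 𝓘(ℂ, Cn n) ω X) {e : OpenPartialHomeomorph (Cn n) (Cn n)}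
    (he : e ∈ contDiffGroupoid ω 𝓘(ℂ, Cn n)) : c.trans e ∈ maximalAtlas 𝓘(ℂ, Cn n) ω X := by
  rw [IsManifold.mem_maximalAtlas_iff, _root_.mem_maximalAtlas_iff] at hc ⊢
  intro e' he'
  obtain ⟨h1, h2⟩ := hc e' he'
  rw [OpenPartialHomeomorph.trans_symm_eq_symm_trans_symm, OpenPartialHomeomorph.trans_assoc,
    ← OpenPartialHomeomorph.trans_assoc e'.symm]
  exact ⟨(contDiffGroupoid ω 𝓘(ℂ, Cn n)).trans ((contDiffGroupoid ω 𝓘(ℂ, Cn n)).symm he) h1,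
    (contDiffGroupoid ω 𝓘(ℂ, Cn n)).trans h2 he⟩

theorem IsNormalCrossings.exists_isAdapted [IsManifold 𝓘(ℂ, Cn n) ω X]
    (hD : IsNormalCrossings (n := n) D) (x : X) :
    ∃ c r, IsAdapted (n := n) D c r ∧ x ∈ c.source := by
  obtain ⟨c, hc, hx, r, hr, hcut⟩ := hD x
  -- Scaling preserves the coordinate hyperplanes, and this factor puts `x` inside the polydisc of
  -- radius 1/e.
  set ε : ℝ := (Real.exp 1)⁻¹ / (‖c x‖ + 1) with hε
  have hε0 : 0 < ε := by positivity
  have hεC : (ε : ℂ) ≠ 0 := by exact_mod_cast hε0.ne'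
  set e : OpenPartialHomeomorph (Cn n) (Cn n) :=
    (Homeomorph.smulOfNeZero (ε : ℂ) hεC).toOpenPartialHomeomorph with he
  have heG : e ∈ contDiffGroupoid ω 𝓘(ℂ, Cn n) := by
    rw [mem_contDiffGroupoid_iff]
    exact ⟨(contDiff_const_smul (ε : ℂ)).contDiffOn, (contDiff_const_smul ((ε : ℂ)⁻¹)).contDiffOn⟩
  have hval (z : X) : (c.trans e) z = (ε : ℂ) • c z := rfl
  have hsrc : (c.trans e).source = c.source := by simp [he]
  have hcont : ContinuousOn (c.trans e) c.source := hsrc ▸ (c.trans e).continuousOn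
  set s : Set X := c.source ∩ (c.trans e) ⁻¹' (Metric.ball 0 (1 / Real.exp 1)) with hs
  have hso : IsOpen s := hcont.isOpen_inter_preimage c.open_source Metric.isOpen_ball
  refine ⟨(c.trans e).restr s, r, ⟨restr_mem_maximalAtlas _ (trans_mem_maximalAtlas hc heG) hso,
    ⟨hr, fun z hz => ?_⟩, fun z hz j => ?_⟩, ?_⟩
  · rw [OpenPartialHomeomorph.restr_source' _ _ hso] at hz
    rw [hcut z hz.2.1]
    simp only [OpenPartialHomeomorph.restr_apply, hval, Pi.smul_apply, smul_eq_mul, mul_eq_zero,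
      hεC, false_or]
  · rw [OpenPartialHomeomorph.restr_source' _ _ hso] at hz
    have h1 := hz.2.2
    rw [Set.mem_preimage, mem_ball_zero_iff] at h1
    exact (norm_le_pi_norm _ j).trans_lt h1
  · rw [OpenPartialHomeomorph.restr_source' _ _ hso, hsrc]
    refine ⟨hx, hx, ?_⟩
    rw [Set.mem_preimage, mem_ball_zero_iff, hval, norm_smul, Complex.norm_real, Real.norm_eq_abs,
      abs_of_pos hε0, hε, div_mul_eq_mul_div, one_div, div_lt_iff₀ (by positivity)]
    have := inv_pos.2 (Real.exp_pos 1)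
    nlinarith [norm_nonneg (c x)]

end AdaptedCharts

/-! ### The Levi form on the manifold, and positive (1,1)-forms. -/

section Levi

variable {n : ℕ} {X : Type*} [TopologicalSpace X] [ChartedSpace (Cn n) X]

theorem IsPositiveForm.nonneg {η : Form (n := n) X 2} (hη : IsPositiveForm η) (x : X)
    (v : TangentSpace 𝓘(ℝ, Cn n) x) :
    0 ≤ (η x ![v, J x v]).re ∧ (η x ![v, J x v]).im = 0 := by
  by_cases hv : v = 0
  · have h : η x ![v, J x v] = 0 := (η x).map_coord_zero 0 (by simp [hv])
    simp [h]
  · exact ⟨(hη.pos x v hv).1.le, (hη.pos x v hv).2⟩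

variable [IsManifold 𝓘(ℂ, Cn n) ω X] {c : OpenPartialHomeomorph X (Cn n)} {x : X}

/-- The value of `ddᶜf` on `(v, i v)`. -/
noncomputable def leviForm (f : X → ℝ) (x : X) (v : TangentSpace 𝓘(ℝ, Cn n) x) : ℝ :=
  (ddc (n := n) (fun y => (f y : ℂ)) x ![v, J x v]).re

theorem ddc_ofReal_apply (hc : c ∈ maximalAtlas 𝓘(ℂ, Cn n) ω X) (hx : x ∈ c.source) {f : X → ℝ}
    (hf : ∀ᶠ z in 𝓝 x, ContMDiffAt 𝓘(ℝ, Cn n) 𝓘(ℝ, ℝ) ∞ f z) (v : TangentSpace 𝓘(ℝ, Cn n) x) :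
    ddc (n := n) (fun y => (f y : ℂ)) x ![v, J x v] = ((-(4 * Real.pi)⁻¹ *
      lev (fun y => f (c.symm y)) (c x) (chartDeriv c x v)
        (Complex.I • chartDeriv c x v) : ℝ) : ℂ) := by
  have h : chartDeriv c x (J x v) = Complex.I • chartDeriv c x v := chartDeriv_I_smul hc hx v
  rw [ddc, dc_ofReal, extD_mixedOneForm hc _ _ hx hf, h]
  push_cast
  rfl

theorem leviForm_eq (hc : c ∈ maximalAtlas 𝓘(ℂ, Cn n) ω X) (hx : x ∈ c.source) {f : X → ℝ}
    (hf : ∀ᶠ z in 𝓝 x, ContMDiffAt 𝓘(ℝ, Cn n) 𝓘(ℝ, ℝ) ∞ f z) (v : TangentSpace 𝓘(ℝ, Cn n) x) :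
    leviForm f x v = -(4 * Real.pi)⁻¹ *
      lev (fun y => f (c.symm y)) (c x) (chartDeriv c x v) (Complex.I • chartDeriv c x v) := by
  rw [leviForm, ddc_ofReal_apply hc hx hf, Complex.ofReal_re]

theorem im_ddc {f : X → ℝ}
    (hf : ∀ᶠ z in 𝓝 x, ContMDiffAt 𝓘(ℝ, Cn n) 𝓘(ℝ, ℝ) ∞ f z) (v : TangentSpace 𝓘(ℝ, Cn n) x) :
    (ddc (n := n) (fun y => (f y : ℂ)) x ![v, J x v]).im = 0 := by
  rw [ddc_ofReal_apply (subset_maximalAtlas (chart_mem_atlas (Cn n) x)) (mem_chart_source _ x) hf,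
    Complex.ofReal_im]

theorem leviForm_add_const_mul {f g : X → ℝ}
    (hf : ∀ᶠ z in 𝓝 x, ContMDiffAt 𝓘(ℝ, Cn n) 𝓘(ℝ, ℝ) ∞ f z)
    (hg : ∀ᶠ z in 𝓝 x, ContMDiffAt 𝓘(ℝ, Cn n) 𝓘(ℝ, ℝ) ∞ g z) (K : ℝ)
    (v : TangentSpace 𝓘(ℝ, Cn n) x) :
    leviForm (fun z => f z + K * g z) x v = leviForm f x v + K * leviForm g x v := by
  have hc : chartAt (Cn n) x ∈ maximalAtlas 𝓘(ℂ, Cn n) ω X :=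
    subset_maximalAtlas (chart_mem_atlas (Cn n) x)
  have hx := mem_chart_source (Cn n) x
  rw [leviForm_eq hc hx (hf.and hg |>.mono fun z hz => contMDiffAt_add_const_mul hz.1 hz.2 K),
    leviForm_eq hc hx hf, leviForm_eq hc hx hg,
    lev_add_const_mul hc hx hf.self_of_nhds hg.self_of_nhds]
  ring

theorem leviForm_const_mul {g : X → ℝ}
    (hg : ∀ᶠ z in 𝓝 x, ContMDiffAt 𝓘(ℝ, Cn n) 𝓘(ℝ, ℝ) ∞ g z) (K : ℝ)
    (v : TangentSpace 𝓘(ℝ, Cn n) x) :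
    leviForm (fun z => K * g z) x v = K * leviForm g x v := by
  have hc : chartAt (Cn n) x ∈ maximalAtlas 𝓘(ℂ, Cn n) ω X :=
    subset_maximalAtlas (chart_mem_atlas (Cn n) x)
  have hx := mem_chart_source (Cn n) x
  have hKg : ∀ᶠ z in 𝓝 x, ContMDiffAt 𝓘(ℝ, Cn n) 𝓘(ℝ, ℝ) ∞ (fun z => K * g z) z :=
    hg.mono fun z hz => contMDiffAt_const.mul hz
  rw [leviForm_eq hc hx hKg, leviForm_eq hc hx hg, lev_const_mul K
    (contDiffAt_comp_symm hc hx hg.self_of_nhds)]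
  ring

theorem leviForm_neg {g : X → ℝ}
    (hg : ∀ᶠ z in 𝓝 x, ContMDiffAt 𝓘(ℝ, Cn n) 𝓘(ℝ, ℝ) ∞ g z)
    (v : TangentSpace 𝓘(ℝ, Cn n) x) :
    leviForm (fun z => -g z) x v = -leviForm g x v := by
  simpa using leviForm_const_mul hg (-1) v

variable {η : Form (n := n) X 2}

theorem inChart_apply (hc : c ∈ maximalAtlas 𝓘(ℂ, Cn n) ω X) {y : Cn n} (hy : y ∈ c.target)
    (v : TangentSpace 𝓘(ℝ, Cn n) (c.symm y)) :
    inChart c η y ![chartDeriv c (c.symm y) v, Complex.I • chartDeriv c (c.symm y) v] =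
      η (c.symm y) ![v, J (c.symm y) v] := by
  have hs := c.map_target hy
  have h1 (u : Cn n) : chartDerivSymm c y (chartDeriv c (c.symm y) u) = u := by
    have := chartDerivSymm_chartDeriv hc hs u
    rwa [c.right_inv hy] at this
  refine (ContinuousAlternatingMap.compContinuousLinearMap_apply _ _ _).trans ?_
  congr 1
  ext1 i
  fin_cases i
  · exact h1 v
  · have h2 := h1 (Complex.I • (show Cn n from v))
    rw [chartDeriv_I_smul hc hs] at h2
    exact h2

/-- Compactness of the unit sphere gives a lower bound κ for the form frozen at `x`; continuity of
its chart expression costs at most half of it nearby. -/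
theorem IsPositiveForm.lower_bound (hη : IsPositiveForm η) (hc : c ∈ maximalAtlas 𝓘(ℂ, Cn n) ω X)
    (hx : x ∈ c.source) : ∃ κ : ℝ, 0 < κ ∧ ∀ᶠ z in 𝓝 x, ∀ v : TangentSpace 𝓘(ℝ, Cn n) z,
      κ * ‖chartDeriv c z v‖ ^ 2 ≤ (η z ![v, J z v]).re := by
  have hxt := c.map_source hx
  have hcont : ContinuousAt (inChart c η) (c x) :=
    (hη.smooth c hc).continuousOn.continuousAt (c.open_target.mem_nhds hxt)
  set α := inChart c η (c x) with hα
  have hpos : ∀ w : Cn n, w ≠ 0 → 0 < (α ![w, Complex.I • w]).re := fun w hw => by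
    obtain ⟨v, rfl⟩ : ∃ v, chartDeriv c (c.symm (c x)) v = w := by
      refine ⟨chartDerivSymm c (c x) w, ?_⟩
      have := chartDeriv_chartDerivSymm (x := c.symm (c x)) hc (c.map_target hxt) w
      rwa [c.right_inv hxt] at this
    refine lt_of_lt_of_eq ?_ (congrArg Complex.re (inChart_apply (η := η) hc hxt v)).symm
    refine (hη.pos _ _ fun hv => hw ?_).1
    rw [hv]
    exact map_zero (chartDeriv c (c.symm (c x)))
  have hq : Continuous fun w : Cn n => (α ![w, Complex.I • w]).re := by
    refine Complex.continuous_re.comp (α.cont.comp ?_)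
    refine continuous_pi fun i => ?_
    fin_cases i
    · exact continuous_id
    · exact continuous_const_smul Complex.I
  have hmin : ∃ κ : ℝ, 0 < κ ∧ ∀ w : Cn n, κ * ‖w‖ ^ 2 ≤ (α ![w, Complex.I • w]).re := by
    have hsph : ∃ κ : ℝ, 0 < κ ∧ ∀ w ∈ Metric.sphere (0 : Cn n) 1, κ ≤
      (α ![w, Complex.I • w]).re := by
      rcases (Metric.sphere (0 : Cn n) 1).eq_empty_or_nonempty with h | h
      -- The sphere is empty when n = 0, and any positive constant serves.
      · exact ⟨1, one_pos, by simp [h]⟩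
      · obtain ⟨w₀, hw₀, hmin⟩ := (isCompact_sphere (0 : Cn n) 1).exists_isMinOn h hq.continuousOn
        refine ⟨_, hpos w₀ fun h => ?_, fun w hw => hmin hw⟩
        simp [h] at hw₀
    obtain ⟨κ, hκ, hb⟩ := hsph
    refine ⟨κ, hκ, fun w => ?_⟩
    by_cases hw : w = 0
    · have : α ![w, Complex.I • w] = 0 := α.map_coord_zero 0 (by simp [hw])
      rw [this]
      simp [hw]
    · have hn : 0 < ‖w‖ := norm_pos_iff.2 hw
      have h1 := hb ((‖w‖⁻¹ : ℝ) • w) (by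
        rw [mem_sphere_zero_iff_norm, norm_smul, norm_inv, norm_norm, inv_mul_cancel₀ hn.ne'])
      have h2 : α ![(‖w‖⁻¹ : ℝ) • w, Complex.I • (‖w‖⁻¹ : ℝ) • w] =
          ((‖w‖⁻¹ ^ 2 : ℝ) : ℂ) * α ![w, Complex.I • w] := by
        have e : (![(‖w‖⁻¹ : ℝ) • w, Complex.I • (‖w‖⁻¹ : ℝ) • w] : Fin 2 → Cn n) =
            fun i => (fun _ : Fin 2 => ‖w‖⁻¹) i • (![w, Complex.I • w] : Fin 2 → Cn n) i := by
          ext1 i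
          fin_cases i
          · rfl
          · exact smul_comm _ _ _
        rw [e, α.map_smul_univ]
        simp
      rw [h2, Complex.re_ofReal_mul, inv_pow, ← div_eq_inv_mul, le_div_iff₀ (by positivity)] at h1
      exact h1
  obtain ⟨κ, hκ, hb⟩ := hmin
  refine ⟨κ / 2, by positivity, ?_⟩
  have hclose : ∀ᶠ y in 𝓝 (c x), ‖inChart c η y - α‖ < κ / 2 := by
    have := (Metric.continuousAt_iff'.1 hcont) (κ / 2) (by positivity)
    filter_upwards [this] with y hy
    rwa [dist_eq_norm] at hy
  filter_upwards [(c.continuousAt hx).eventually hclose, c.open_source.mem_nhds hx] with z hz hzs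
  suffices h : ∀ v : TangentSpace 𝓘(ℝ, Cn n) (c.symm (c z)),
      κ / 2 * ‖chartDeriv c (c.symm (c z)) v‖ ^ 2 ≤ (η (c.symm (c z)) ![v, J (c.symm
        (c z)) v]).re by
    rwa [c.left_inv hzs] at h
  intro v
  rw [← inChart_apply hc (c.map_source hzs) v]
  set w := chartDeriv c (c.symm (c z)) v
  have h1 := (inChart c η (c z) - α).le_opNorm ![w, Complex.I • w]
  rw [Fin.prod_univ_two] at h1
  simp only [Matrix.cons_val_zero, Matrix.cons_val_one, norm_smul, Complex.norm_I, one_mul] at h1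
  have h2 := (Complex.abs_re_le_norm _).trans h1
  have h3 : ((inChart c η (c z) - α) ![w, Complex.I • w]).re =
    (inChart c η (c z) ![w, Complex.I • w]).re - (α ![w, Complex.I • w]).re := rfl
  rw [h3] at h2
  have h4 := (abs_le.1 h2).1
  have h5 := hb w
  have h6 : ‖inChart c η (c z) - α‖ * (‖w‖ * ‖w‖) ≤ κ / 2 * (‖w‖ * ‖w‖) :=
    mul_le_mul_of_nonneg_right hz.le (by positivity)
  nlinarith

end Levi

/-! ### Global domination of the Poincaré metric, and the resulting bounds on ddᶜ. -/

section Global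

variable {n m : ℕ} {X : Type*} [TopologicalSpace X] [ChartedSpace (Cn n) X]
  {D : Set X} {u : Fin m → X → ℝ} {c : OpenPartialHomeomorph X (Cn n)} {r : ℕ} {x : X}

theorem dZeta_eq_tau (k : Fin n) (x : X) (v : TangentSpace 𝓘(ℝ, Cn n) x) :
    dZeta c r k x v = (tau r k (c x))⁻¹ * chartDeriv c x v k := by
  rw [dZeta_eq, tau]
  split_ifs <;> simp

/-- The form `ddᶜ(-T) + A η` on `(v, i v)`. -/
noncomputable def twistedForm (T : X → ℝ) (η : Form (n := n) X 2) (A : ℝ) (z : X)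
    (v : TangentSpace 𝓘(ℝ, Cn n) z) : ℝ :=
  -leviForm T z v + A * (η z ![v, J z v]).re

theorem twistedForm_mono {T : X → ℝ} {η : Form (n := n) X 2} (hη : IsPositiveForm η) {A A' : ℝ}
    (hA : A ≤ A') (z : X) (v : TangentSpace 𝓘(ℝ, Cn n) z) :
    twistedForm T η A z v ≤ twistedForm T η A' z v :=
  add_le_add_right (mul_le_mul_of_nonneg_right hA (hη.nonneg z v).1) _

variable [IsManifold 𝓘(ℂ, Cn n) ω X]

/-- Bounded coefficients of df mean bounded derivative in the Poincaré metric, so the radial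
estimate applies, and each log log |z_k|⁻¹ that occurs is at most a multiple of T. This explains the
exponent 1. -/
theorem IsLogSystem.locBound_of_deriv (h : IsLogSystem (n := n) D u) (hm : 0 < m)
    (hc : IsAdapted D c r) (hx : x ∈ c.source) {f : X → ℝ}
    (hf : ∀ z ∉ D, ContMDiffAt 𝓘(ℝ, Cn n) 𝓘(ℝ, ℝ) ∞ f z)
    (hg : GeneratedBy (Tame D (logSum u) {0} c) D c r
      (oneForm (dFun (n := n) fun z => (f z : ℂ)))) :
    LocBound D (logSum u) {1} x (fun z => |f z|) := by
  have hT : ∀ z ∉ D, 1 ≤ logSum u z := fun z hz => h.one_le_logSum hm hz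
  obtain ⟨N, hN, C, hC, hb⟩ := hg.bound_oneForm hT (Set.singleton_nonempty 0) hx
  rw [Set.mem_singleton_iff] at hN
  subst hN
  have hev : ∀ᶠ y in 𝓝 (c x), y ∈ c.target ∧ (c.symm y ∉ D →
      ∀ v : Fin 1 → TangentSpace 𝓘(ℝ, Cn n) (c.symm y),
      ‖oneForm (dFun (n := n) fun z => (f z : ℂ)) (c.symm y) v‖ ≤
        C * logSum u (c.symm y) ^ 0 * ∑ k, ‖dZeta c r k (c.symm y) (v 0)‖) :=
    by filter_upwards [c.open_target.mem_nhds (c.map_source hx), eventually_of_chart hx hb]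
      with y h1 h2 using ⟨h1, h2⟩
  obtain ⟨δ₀, hδ₀, hball⟩ := Metric.nhds_basis_closedBall.eventually_iff.1 hev
  -- A radius this small keeps the coordinates that are nonzero at `x` nonzero on the whole ball.
  have hδ : ∀ᶠ δ in 𝓝[>] (0 : ℝ), 0 < δ ∧ δ < δ₀ ∧ δ < 1 ∧ ∀ k, c x k ≠ 0 → δ < ‖c x k‖ := by
    refine (eventually_mem_nhdsWithin (s := Set.Ioi (0 : ℝ))).and (Filter.Eventually.filter_mono
      nhdsWithin_le_nhds ((eventually_lt_nhds hδ₀).and ((eventually_lt_nhds one_pos).and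
        (Filter.eventually_all.2 fun k => ?_))))
    by_cases hk : c x k = 0
    · simp [hk]
    · filter_upwards [eventually_lt_nhds (norm_pos_iff.2 hk)] with δ hδ _ using hδ
  obtain ⟨δ, hδ0, hδδ₀, hδ1, hδk⟩ := hδ.exists
  obtain ⟨M, hM, hMb⟩ := exists_radial_bound (F := fun y => f (c.symm y)) (C := C) (r := r)
    hδ0 hδ1 (fun k _ => (eq_or_ne (c x k) 0).imp_right (hδk k)) (fun y hy hy0 => by
      obtain ⟨hyt, hyb⟩ := hball (Metric.closedBall_subset_closedBall hδδ₀.le hy)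
      have hzD : c.symm y ∉ D := fun hD => by
        obtain ⟨j, hj, hj0⟩ := (hc.cutOut.2 _ (c.map_target hyt)).1 hD
        rw [c.right_inv hyt] at hj0
        exact hy0 j hj hj0
      have hs := c.map_target hyt
      refine ⟨?_, fun w => ?_⟩
      · have := contDiffAt_comp_symm hc.mem_maximalAtlas hs (hf _ hzD)
        rw [c.right_inv hyt] at this
        exact this.differentiableAt (by simp)
      · obtain ⟨v, rfl⟩ : ∃ v, chartDeriv c (c.symm y) v = w :=
          ⟨_, chartDeriv_chartDerivSymm hc.mem_maximalAtlas hs w⟩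
        have h1 := hyb hzD (fun _ => v)
        have h2 := dFun_eq hc.mem_maximalAtlas hs (hf _ hzD) v
        have h3 : oneForm (dFun (n := n) fun z => (f z : ℂ)) (c.symm y) (fun _ => v) =
          dFun (n := n) (fun z => (f z : ℂ)) (c.symm y) v := rfl
        rw [h3, h2, Complex.norm_real, Real.norm_eq_abs, c.right_inv hyt, pow_zero, mul_one] at h1
        refine h1.trans (le_of_eq ?_)
        congr 1
        refine Finset.sum_congr rfl fun k _ => ?_
        have e := congrArg norm (dZeta_eq_tau (c := c) (r := r) k (c.symm y) v)
        rw [c.right_inv hyt] at e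
        exact e)
  have hE : ({1} : Set ℕ).Nonempty := Set.singleton_nonempty 1
  refine LocBound.mono (h := fun z => M + |C| * ∑ k ∈ Finset.univ.filter
    (fun k : Fin n => (k : ℕ) < r ∧ c x k = 0), (|Real.log (Real.log (‖c z k‖⁻¹))| + M)) ?_ ?_
  · refine (LocBound.of_le_const hT hE M (by simp)).add hT (LocBound.const_mul
      (LocBound.sum hT hE _ fun k hk => ?_) (abs_nonneg C))
    refine LocBound.add hT ?_ (LocBound.of_le_const hT hE M (by simp))
    have hkr := (Finset.mem_filter.1 hk).2.1
    obtain ⟨C', hC', hb'⟩ := h.logLog_le_logSum hm hc hx k hkr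
    refine ⟨1, rfl, C', hC', ?_⟩
    filter_upwards [hb', c.open_source.mem_nhds hx] with z hz hzs hzD
    rw [pow_one, abs_of_pos (Real.log_pos (hc.one_lt_log hzs hzD hkr))]
    exact hz hzD
  · filter_upwards [c.open_source.mem_nhds hx, (c.continuousAt hx).eventually
      (Metric.closedBall_mem_nhds (c x) hδ0)] with z hzs hzb hzD
    have := hMb (c z) hzb fun k hk => hc.ne_zero ⟨hzs, hzD⟩ hk
    rwa [c.left_inv hzs] at this

/-- Only `A` has to be uniform, and the form increases with `A`, so compactness allows taking
maxima. The constant `C` and the chart may still depend on the point. -/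
theorem IsLogSystem.exists_twistedForm_lower [CompactSpace X] (h : IsLogSystem (n := n) D u)
    (hD : IsNormalCrossings (n := n) D) {η : Form (n := n) X 2} (hη : IsPositiveForm η) :
    ∃ A : ℝ, 0 ≤ A ∧ ∀ x : X, ∃ c r, IsAdapted (n := n) D c r ∧ x ∈ c.source ∧ ∃ C : ℝ, 0 ≤ C ∧
      ∀ᶠ z in 𝓝 x, z ∉ D → ∀ v, 0 ≤ twistedForm (logSum u) η A z v ∧
        ∑ k, ‖dZeta c r k z v‖ ^ 2 ≤ C * twistedForm (logSum u) η A z v := by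
  suffices hs : ∃ A : ℝ, 0 ≤ A ∧ ∀ x ∈ (Set.univ : Set X), ∃ c r, IsAdapted (n := n) D c r ∧
      x ∈ c.source ∧ ∃ C : ℝ, 0 ≤ C ∧
      ∀ᶠ z in 𝓝 x, z ∉ D → ∀ v, 0 ≤ twistedForm (logSum u) η A z v ∧
        ∑ k, ‖dZeta c r k z v‖ ^ 2 ≤ C * twistedForm (logSum u) η A z v by
    obtain ⟨A, hA, hb⟩ := hs
    exact ⟨A, hA, fun x => hb x (Set.mem_univ x)⟩
  have hmono : ∀ A A' : ℝ, A ≤ A' → ∀ x : X, (∃ c r, IsAdapted (n := n) D c r ∧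
      x ∈ c.source ∧ ∃ C : ℝ, 0 ≤ C ∧
      ∀ᶠ z in 𝓝 x, z ∉ D → ∀ v, 0 ≤ twistedForm (logSum u) η A z v ∧
        ∑ k, ‖dZeta c r k z v‖ ^ 2 ≤ C * twistedForm (logSum u) η A z v) →
      (∃ c r, IsAdapted (n := n) D c r ∧ x ∈ c.source ∧ ∃ C : ℝ, 0 ≤ C ∧
      ∀ᶠ z in 𝓝 x, z ∉ D → ∀ v, 0 ≤ twistedForm (logSum u) η A' z v ∧
        ∑ k, ‖dZeta c r k z v‖ ^ 2 ≤ C * twistedForm (logSum u) η A' z v) := by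
    rintro A A' hAA x ⟨c, r, hc, hx, C, hC, hb⟩
    refine ⟨c, r, hc, hx, C, hC, ?_⟩
    filter_upwards [hb] with z hz hzD v
    have h1 := twistedForm_mono (T := logSum u) hη hAA z v
    exact ⟨(hz hzD v).1.trans h1, (hz hzD v).2.trans (mul_le_mul_of_nonneg_left h1 hC)⟩
  refine isCompact_univ.induction_on (p := fun s => ∃ A : ℝ, 0 ≤ A ∧ ∀ x ∈ s, ∃ c r,
    IsAdapted (n := n) D c r ∧ x ∈ c.source ∧ ∃ C : ℝ, 0 ≤ C ∧
      ∀ᶠ z in 𝓝 x, z ∉ D → ∀ v, 0 ≤ twistedForm (logSum u) η A z v ∧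
        ∑ k, ‖dZeta c r k z v‖ ^ 2 ≤ C * twistedForm (logSum u) η A z v) ?_ ?_ ?_ ?_
  · exact ⟨0, le_rfl, by simp⟩
  · rintro s t hst ⟨A, hA, hb⟩
    exact ⟨A, hA, fun x hx => hb x (hst hx)⟩
  · rintro s t ⟨A, hA, hb⟩ ⟨A', hA', hb'⟩
    refine ⟨max A A', le_max_of_le_left hA, fun x hx => ?_⟩
    rcases hx with hx | hx
    · exact hmono _ _ (le_max_left _ _) x (hb x hx)
    · exact hmono _ _ (le_max_right _ _) x (hb' x hx)
  · intro x _
    obtain ⟨c, r, hc, hx⟩ := hD.exists_isAdapted x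
    obtain ⟨A, C, hA, hC, hb⟩ := h.levi_lower hc hx
    obtain ⟨κ, hκ, hκb⟩ := hη.lower_bound hc.mem_maximalAtlas hx
    have hπ : 0 < 4 * Real.pi := by positivity
    -- The divisor 4π undoes the normalization of ddᶜ, and κ converts the chart norm into η.
    have hall : ∀ᶠ z in 𝓝 x, z ∈ c.source ∧ (z ∉ D → ∀ v,
        0 ≤ twistedForm (logSum u) η (A / (4 * Real.pi * κ)) z v ∧
        ∑ k, ‖dZeta c r k z v‖ ^ 2 ≤ C * (4 * Real.pi) *
          twistedForm (logSum u) η (A / (4 * Real.pi * κ)) z v) := by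
      filter_upwards [hb, hκb, c.open_source.mem_nhds hx] with z h1 h2 hzs
      refine ⟨hzs, fun hzD v => ?_⟩
      obtain ⟨h3, h4⟩ := h1 hzD (chartDeriv c z v)
      have h5 := h2 v
      have h6 : lev (fun y => logSum u (c.symm y)) (c z) (chartDeriv c z v)
          (Complex.I • chartDeriv c z v) + A * ‖chartDeriv c z v‖ ^ 2 ≤
          4 * Real.pi * twistedForm (logSum u) η (A / (4 * Real.pi * κ)) z v := by
        rw [twistedForm, leviForm_eq hc.mem_maximalAtlas hzs (eventually_contMDiffAt h.closed
          (fun z hz => h.contMDiffAt_logSum hz) hzD), mul_add, neg_mul, neg_neg,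
          mul_inv_cancel_left₀ hπ.ne']
        refine add_le_add_right ?_ _
        calc A * ‖chartDeriv c z v‖ ^ 2 = A / κ * (κ * ‖chartDeriv c z v‖ ^ 2) := by field_simp
          _ ≤ A / κ * (η z ![v, J z v]).re := mul_le_mul_of_nonneg_left h5 (by positivity)
          _ = _ := by field_simp
      refine ⟨nonneg_of_mul_nonneg_right (h3.trans h6) hπ, ?_⟩
      simp only [dZeta_eq_tau]
      refine h4.trans ?_
      rw [mul_assoc]
      exact mul_le_mul_of_nonneg_left h6 hC
    -- An estimate valid eventually near `x` is valid eventually near each nearby point, with the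
    -- same chart and constants; this is the neighbourhood required by the compactness induction.
    refine ⟨_, mem_nhdsWithin_of_mem_nhds hall.eventually_nhds, A / (4 * Real.pi * κ),
      by positivity, fun x' hx' => ?_⟩
    exact ⟨c, r, hc, hx'.self_of_nhds.1, C *
      (4 * Real.pi), by positivity, hx'.mono fun z hz => hz.2⟩

theorem IsLogSystem.leviForm_bound [CompactSpace X] (h : IsLogSystem (n := n) D u) (hm : 0 < m)
    {η : Form (n := n) X 2} {A : ℝ}
    (hA : ∀ x : X, ∃ c r, IsAdapted (n := n) D c r ∧ x ∈ c.source ∧ ∃ C : ℝ, 0 ≤ C ∧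
      ∀ᶠ z in 𝓝 x, z ∉ D → ∀ v, 0 ≤ twistedForm (logSum u) η A z v ∧
        ∑ k, ‖dZeta c r k z v‖ ^ 2 ≤ C * twistedForm (logSum u) η A z v)
    {E : Set ℕ} (hE : E.Nonempty) {f : X → ℝ}
    (hf : ∀ c r, IsAdapted (n := n) D c r → GeneratedBy (Tame D (logSum u) E c) D c r
      (ddc (n := n) fun z => (f z : ℂ))) :
    ∃ N ∈ E, ∃ C : ℝ, 0 ≤ C ∧ ∀ z ∉ D, ∀ v,
      |leviForm f z v| ≤ C * logSum u z ^ N * twistedForm (logSum u) η A z v := by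
  have hT : ∀ z ∉ D, 1 ≤ logSum u z := fun z hz => h.one_le_logSum hm hz
  have hpos : ∀ z ∉ D, ∀ v, 0 ≤ twistedForm (logSum u) η A z v := fun z hz v => by
    obtain ⟨c, r, -, -, C, -, hb⟩ := hA z
    exact (hb.self_of_nhds hz v).1
  -- The alternative `z ∈ D` in `P` is there because monotonicity in t is asked at every point,
  -- while the twisted form is known to be nonnegative only off D.
  obtain ⟨N, hN, C, hC, hb⟩ := exists_uniform_of_isCompact (D := D) (T := logSum u) (E := E)
    (P := fun z t => z ∈ D ∨ ∀ v, |leviForm f z v| ≤ t * twistedForm (logSum u) η A z v) hT hE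
    isCompact_univ (fun z s t hst hs => by
      by_cases hz : z ∈ D
      · exact Or.inl hz
      · exact Or.inr fun v => ((hs.resolve_left hz) v).trans
          (mul_le_mul_of_nonneg_right hst (hpos z hz v)))
    (fun x _ => by
      obtain ⟨c, r, hc, hx, C, hC, hb⟩ := hA x
      obtain ⟨N, hN, C', hC', hb'⟩ := (hf c r hc).bound_twoForm hc.mem_maximalAtlas hT hE hx
      refine ⟨N, hN, C' * C, by positivity, ?_⟩
      filter_upwards [hb, hb'] with z h1 h2 hzD
      refine Or.inr fun v => ?_
      have hT0 : 0 ≤ logSum u z ^ N := pow_nonneg (zero_le_one.trans (hT z hzD)) N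
      calc |leviForm f z v| ≤ ‖ddc (n := n) (fun y => (f y : ℂ)) z ![v, J z v]‖ :=
            Complex.abs_re_le_norm _
        _ ≤ C' * logSum u z ^ N * ∑ k, ‖dZeta c r k z v‖ ^ 2 := h2 hzD v
        _ ≤ C' * logSum u z ^ N * (C * twistedForm (logSum u) η A z v) :=
            mul_le_mul_of_nonneg_left (h1 hzD v).2 (by positivity)
        _ = _ := by ring)
  exact ⟨N, hN, C, hC, fun z hz => (hb z (Set.mem_univ z) hz).resolve_left hz⟩

/-- The sum is at most m times its largest term, whose power is one of the summands on the right. It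
passes from powers of T to Θ_N. -/
theorem pow_sum_le_card_mul_sum_pow {a : Fin m → ℝ} (ha : ∀ k, 1 ≤ a k) {N N' : ℕ}
    (hN : N ≤ N') (hm : 0 < m) : (∑ k, a k) ^ N ≤ (m : ℝ) ^ N' * ∑ k, a k ^ N' := by
  have hne : (Finset.univ : Finset (Fin m)).Nonempty := ⟨⟨0, hm⟩, Finset.mem_univ _⟩
  obtain ⟨j, -, hj⟩ := Finset.exists_max_image Finset.univ a hne
  have h1 : ∑ k, a k ≤ m * a j := by
    refine (Finset.sum_le_card_nsmul _ _ (a j) fun k hk => hj k hk).trans ?_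
    simp
  have hsum : 1 ≤ ∑ k, a k := (ha j).trans
    (Finset.single_le_sum (fun k _ => zero_le_one.trans (ha k)) (Finset.mem_univ j))
  calc (∑ k, a k) ^ N ≤ (∑ k, a k) ^ N' := pow_le_pow_right₀ hsum hN
    _ ≤ (m * a j) ^ N' := pow_le_pow_left₀ (zero_le_one.trans hsum) h1 N'
    _ = m ^ N' * a j ^ N' := mul_pow _ _ _
    _ ≤ _ := mul_le_mul_of_nonneg_left (Finset.single_le_sum (f := fun k => a k ^ N')
      (fun k _ => pow_nonneg (zero_le_one.trans (ha k)) _) (Finset.mem_univ j)) (by positivity)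

/-- Only the size of ddᶜφ relative to the twisted form is needed, not its sign. Enlarging `A`, `B`
or the exponent keeps the bound because the twisted form is nonnegative. -/
theorem weightedBound_of_leviForm (h : IsLogSystem (n := n) D u) (hm : 0 < m)
    {η : Form (n := n) X 2} (hη : IsPositiveForm η) {A₀ A B C : ℝ} {N N' : ℕ} {φ : X → ℝ}
    (hpos : ∀ z ∉ D, ∀ v, 0 ≤ twistedForm (logSum u) η A₀ z v)
    (hφs : ∀ z ∉ D, ContMDiffAt 𝓘(ℝ, Cn n) 𝓘(ℝ, ℝ) ∞ φ z)
    (hφ : ∀ z ∉ D, ∀ v,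
      |leviForm φ z v| ≤ C * logSum u z ^ N * twistedForm (logSum u) η A₀ z v)
    (hC : 0 ≤ C) (hA : A₀ ≤ A) (hN : N ≤ N') (hB : C * (m : ℝ) ^ N' ≤ B) :
    WeightedBound D η (fun z => ∑ k, Real.log (u k z) ^ N') (logSum u) A B φ := by
  intro z hz v
  have e1 := eventually_contMDiffAt h.closed hφs hz
  have e2 := eventually_contMDiffAt h.closed (fun z hz => h.contMDiffAt_logSum hz) hz
  have e1' : ∀ᶠ z in 𝓝 z, ContMDiffAt 𝓘(ℝ, Cn n) 𝓘(ℝ, ℝ) ∞ (fun z => -φ z) z :=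
    e1.mono fun z hz => hz.neg
  have e2' : ∀ᶠ z in 𝓝 z, ContMDiffAt 𝓘(ℝ, Cn n) 𝓘(ℝ, ℝ) ∞ (fun z => -logSum u z) z :=
    e2.mono fun z hz => hz.neg
  set ΘN := ∑ k, Real.log (u k z) ^ N'
  have hval : (ddc (n := n) (fun y => ((-φ y : ℝ) : ℂ)) z + (B * ΘN) •
      (ddc (n := n) (fun y => ((-logSum u y : ℝ) : ℂ)) z + A • η z)) ![v, J z v] =
      ddc (n := n) (fun y => ((-φ y : ℝ) : ℂ)) z ![v, J z v] + ((B * ΘN : ℝ) : ℂ) *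
      (ddc (n := n) (fun y => ((-logSum u y : ℝ) : ℂ)) z ![v, J z v] +
        (A : ℂ) * η z ![v, J z v]) := rfl
  rw [hval]
  refine ⟨?_, ?_⟩
  · simp only [Complex.add_re, Complex.re_ofReal_mul]
    have g1 : (ddc (n := n) (fun y => ((-φ y : ℝ) : ℂ)) z ![v, J z v]).re = -leviForm φ z v :=
      leviForm_neg e1 v
    have g2 : (ddc (n := n) (fun y => ((-logSum u y : ℝ) : ℂ)) z ![v, J z v]).re =
      -leviForm (logSum u) z v := leviForm_neg e2 v
    rw [g1, g2]
    change 0 ≤ -leviForm φ z v + B * ΘN * twistedForm (logSum u) η A z v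
    have h1 := (abs_le.1 (hφ z hz v)).2
    have h2 : C * logSum u z ^ N ≤ B * ΘN := by
      have hp := pow_sum_le_card_mul_sum_pow (fun k => h.one_le_log k hz) hN hm
      have hΘ : 0 ≤ ΘN := Finset.sum_nonneg fun k _ =>
        pow_nonneg (zero_le_one.trans (h.one_le_log k hz)) _
      calc C * logSum u z ^ N ≤ C * ((m : ℝ) ^ N' * ΘN) := mul_le_mul_of_nonneg_left hp hC
        _ = C * (m : ℝ) ^ N' * ΘN := by ring
        _ ≤ B * ΘN := mul_le_mul_of_nonneg_right hB hΘ
    have h3 := mul_le_mul h2 (twistedForm_mono (T := logSum u) hη hA z v) (hpos z hz v)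
      (le_trans (mul_nonneg hC (pow_nonneg (zero_le_one.trans (h.one_le_logSum hm hz)) _)) h2)
    linarith
  · simp only [Complex.add_im, Complex.im_ofReal_mul]
    rw [im_ddc e1', im_ddc e2', (hη.nonneg z v).2]
    simp

theorem plainBound_of_leviForm (hD : IsClosed D) {η : Form (n := n) X 2} (hη : IsPositiveForm η)
    {A : ℝ} {φ : X → ℝ} (hφs : ∀ z ∉ D, ContMDiffAt 𝓘(ℝ, Cn n) 𝓘(ℝ, ℝ) ∞ φ z)
    (hφ : ∀ z ∉ D, ∀ v, leviForm φ z v ≤ A * (η z ![v, J z v]).re) : PlainBound D η A φ := by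
  intro z hz v
  have e1 := eventually_contMDiffAt hD hφs hz
  have e1' : ∀ᶠ z in 𝓝 z, ContMDiffAt 𝓘(ℝ, Cn n) 𝓘(ℝ, ℝ) ∞ (fun z => -φ z) z :=
    e1.mono fun z hz => hz.neg
  have hval : (ddc (n := n) (fun y => ((-φ y : ℝ) : ℂ)) z + A • η z) ![v, J z v] =
      ddc (n := n) (fun y => ((-φ y : ℝ) : ℂ)) z ![v, J z v] + (A : ℂ) * η z ![v, J z v] := rfl
  rw [hval]
  refine ⟨?_, ?_⟩
  · have g1 : (ddc (n := n) (fun y => ((-φ y : ℝ) : ℂ)) z ![v, J z v]).re = -leviForm φ z v :=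
      leviForm_neg e1 v
    rw [Complex.add_re, Complex.re_ofReal_mul, g1]
    linarith [hφ z hz v]
  · rw [Complex.add_im, Complex.im_ofReal_mul, im_ddc e1', (hη.nonneg z v).2]
    simp

end Global

/-! ### The decomposition f = φ - ψ for functions with logarithmic models. -/

section Decomposition

variable {n m : ℕ} {X : Type*} [TopologicalSpace X]
  {D : Set X} {u : Fin m → X → ℝ} {c : OpenPartialHomeomorph X (Cn n)} {r : ℕ}

variable [ChartedSpace (Cn n) X] [CompactSpace X] [T2Space X]

theorem IsLogSystem.tame_iff (h : IsLogSystem (n := n) D u) (hm : 0 < m)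
    (hc : IsAdapted (n := n) D c r) {g : X → ℂ} :
    Tame D (logSum u) Set.univ c g ↔ LogLogCoeff D c r g :=
  tame_iff_logLogCoeff (fun _ hz => h.one_le_logSum hm hz)
    (fun _ hz hzD => hc.logLogProd_pos hz hzD)
    (fun _ hx => h.logSum_le_logLogProd hc hx) (fun _ hx => h.logLogProd_le_logSum hm hc hx)

variable [IsManifold 𝓘(ℂ, Cn n) ω X]

theorem IsLogSystem.preLogLog_of_frameBounded (h : IsLogSystem (n := n) D u) (hm : 0 < m)
    {g : X → ℝ} (hg : ∀ x ∉ D, ContMDiffAt 𝓘(ℝ, Cn n) 𝓘(ℝ, ℝ) ∞ g x)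
    (hb : ∀ x, LocBound D (logSum u) Set.univ x fun z => |g z|)
    (hF : ∀ c r, IsAdapted (n := n) D c r → FrameBounded D (logSum u) Set.univ c r g) :
    PreLogLog (n := n) D fun z => (g z : ℂ) where
  smooth := (contMDiffOn_ofReal_iff h.closed).2 hg
  growth c r hc := (h.tame_iff hm hc).1
    { smooth := fun z hz => (contMDiffAt_ofReal (hg z hz.2)).contMDiffWithinAt
      bound := fun x _ => by simpa using hb x }
  growth_del c r hc := by
    rw [del_ofReal, ← GeneratedBy.congr_iff fun g => h.tame_iff hm hc]
    exact (hF c r hc).generated_one (fun _ hz => h.one_le_logSum hm hz) hc hg _ _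
  growth_delbar c r hc := by
    rw [delbar_ofReal, ← GeneratedBy.congr_iff fun g => h.tame_iff hm hc]
    exact (hF c r hc).generated_one (fun _ hz => h.one_le_logSum hm hz) hc hg _ _
  growth_delDelbar c r hc := by
    rw [delDelbar, delbar_ofReal, ← GeneratedBy.congr_iff fun g => h.tame_iff hm hc]
    exact (hF c r hc).generated_two h.closed (fun _ hz => h.one_le_logSum hm hz) hc hg _ _

theorem IsLogSystem.pSingular_of_frameBounded (h : IsLogSystem (n := n) D u) (hm : 0 < m)
    {g : X → ℝ} (hg : ∀ x ∉ D, ContMDiffAt 𝓘(ℝ, Cn n) 𝓘(ℝ, ℝ) ∞ g x)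
    (hF : ∀ c r, IsAdapted (n := n) D c r → FrameBounded D (logSum u) {0} c r g) :
    PSingular (n := n) D fun z => (g z : ℂ) where
  smooth := (contMDiffOn_ofReal_iff h.closed).2 hg
  growth_d c r hc := by
    have hT : ∀ z ∉ D, 1 ≤ logSum u z := fun _ hz => h.one_le_logSum hm hz
    rw [dFun_ofReal, ← GeneratedBy.congr_iff fun g => tame_iff_bddCoeff hT]
    exact (hF c r hc).generated_one hT hc hg _ _
  growth_ddc c r hc := by
    have hT : ∀ z ∉ D, 1 ≤ logSum u z := fun _ hz => h.one_le_logSum hm hz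
    rw [ddc, dc_ofReal, ← GeneratedBy.congr_iff fun g => tame_iff_bddCoeff hT]
    exact (hF c r hc).generated_two h.closed hT hc hg _ _

/-- Closure of log-log coefficients under sums is obtained on the side of powers of T, where
different exponents are merged using T ≥ 1. -/
theorem IsLogSystem.preLogLog_add_const_mul (h : IsLogSystem (n := n) D u) (hm : 0 < m)
    {f g : X → ℝ} (hf : PreLogLog (n := n) D fun z => (f z : ℂ))
    (hg : PreLogLog (n := n) D fun z => (g z : ℂ)) (K : ℝ) :
    PreLogLog (n := n) D fun z => ((f z + K * g z : ℝ) : ℂ) := by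
  have hT : ∀ z ∉ D, 1 ≤ logSum u z := fun _ hz => h.one_le_logSum hm hz
  have hf' := (contMDiffOn_ofReal_iff h.closed).1 hf.smooth
  have hg' := (contMDiffOn_ofReal_iff h.closed).1 hg.smooth
  have hadd : ∀ c r, IsAdapted (n := n) D c r → ∀ a b, LogLogCoeff D c r a → LogLogCoeff D c r b →
      LogLogCoeff D c r fun z => a z + b z := fun c r hc a b ha hb =>
    (h.tame_iff hm hc).1 (((h.tame_iff hm hc).2 ha).add hT ((h.tame_iff hm hc).2 hb))
  have hmul : ∀ c r, IsAdapted (n := n) D c r → ∀ (t : ℂ) a, LogLogCoeff D c r a →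
      LogLogCoeff D c r fun z => t * a z := fun c r hc t a ha =>
    (h.tame_iff hm hc).1 (((h.tame_iff hm hc).2 ha).const_mul t)
  refine ⟨(contMDiffOn_ofReal_iff h.closed).2 fun x hx =>
    contMDiffAt_add_const_mul (hf' x hx) (hg' x hx) K, fun c r hc => ?_, fun c r hc => ?_,
    fun c r hc => ?_, fun c r hc => ?_⟩
  · have := hadd c r hc _ _ (hf.growth c r hc) (hmul c r hc K _ (hg.growth c r hc))
    convert this using 2
    push_cast
    rfl
  · have h1 := hf.growth_del c r hc
    have h2 := hg.growth_del c r hc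
    rw [del_ofReal] at h1 h2 ⊢
    exact GeneratedBy.mixedOneForm_add (hadd c r hc)
      (hmul c r hc) hc.mem_maximalAtlas hf' hg' K h1 h2
  · have h1 := hf.growth_delbar c r hc
    have h2 := hg.growth_delbar c r hc
    rw [delbar_ofReal] at h1 h2 ⊢
    exact GeneratedBy.mixedOneForm_add (hadd c r hc)
      (hmul c r hc) hc.mem_maximalAtlas hf' hg' K h1 h2
  · have h1 := hf.growth_delDelbar c r hc
    have h2 := hg.growth_delDelbar c r hc
    rw [delDelbar, delbar_ofReal] at h1 h2 ⊢
    exact GeneratedBy.extD_add h.closed (hadd c r hc) (hmul c r hc) hc.mem_maximalAtlas hf' hg' K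
      h1 h2

theorem IsLogSystem.pSingular_add_const_mul (h : IsLogSystem (n := n) D u) (hm : 0 < m)
    {f g : X → ℝ} (hf : PSingular (n := n) D fun z => (f z : ℂ))
    (hg : PSingular (n := n) D fun z => (g z : ℂ)) (K : ℝ) :
    PSingular (n := n) D fun z => ((f z + K * g z : ℝ) : ℂ) := by
  have hT : ∀ z ∉ D, 1 ≤ logSum u z := fun _ hz => h.one_le_logSum hm hz
  have hf' := (contMDiffOn_ofReal_iff h.closed).1 hf.smooth
  have hg' := (contMDiffOn_ofReal_iff h.closed).1 hg.smooth
  have hadd : ∀ c : OpenPartialHomeomorph X (Cn n), ∀ a b, BddCoeff D c a → BddCoeff D c b →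
      BddCoeff D c fun z => a z + b z := fun c a b ha hb =>
    (tame_iff_bddCoeff hT).1 (((tame_iff_bddCoeff hT).2 ha).add hT ((tame_iff_bddCoeff hT).2 hb))
  have hmul : ∀ c : OpenPartialHomeomorph X (Cn n), ∀ (t : ℂ) a, BddCoeff D c a →
      BddCoeff D c fun z => t * a z := fun c t a ha =>
    (tame_iff_bddCoeff hT).1 (((tame_iff_bddCoeff hT).2 ha).const_mul t)
  refine ⟨(contMDiffOn_ofReal_iff h.closed).2 fun x hx =>
    contMDiffAt_add_const_mul (hf' x hx) (hg' x hx) K, fun c r hc => ?_, fun c r hc => ?_⟩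
  · have h1 := hf.growth_d c r hc
    have h2 := hg.growth_d c r hc
    rw [dFun_ofReal] at h1 h2 ⊢
    exact GeneratedBy.mixedOneForm_add (hadd c) (hmul c) hc.mem_maximalAtlas hf' hg' K h1 h2
  · have h1 := hf.growth_ddc c r hc
    have h2 := hg.growth_ddc c r hc
    rw [ddc, dc_ofReal] at h1 h2 ⊢
    exact GeneratedBy.extD_add h.closed (hadd c) (hmul c) hc.mem_maximalAtlas hf' hg' K h1 h2

theorem IsLogSystem.generatedBy_ddc (h : IsLogSystem (n := n) D u) (hm : 0 < m)
    {f : X → ℝ} (hf : PreLogLog (n := n) D fun z => (f z : ℂ)) (hc : IsAdapted (n := n) D c r) :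
    GeneratedBy (Tame D (logSum u) Set.univ c) D c r (ddc (n := n) fun z => (f z : ℂ)) := by
  have h1 := hf.growth_delDelbar c r hc
  rw [delDelbar, delbar_ofReal, ← GeneratedBy.congr_iff fun g => h.tame_iff hm hc] at h1
  rw [ddc, dc_ofReal]
  exact h1.extD_mixedOneForm_of h.closed (fun a g hg => hg.const_mul a) hc.mem_maximalAtlas
    (by simp) ((contMDiffOn_ofReal_iff h.closed).1 hf.smooth)

theorem IsLogSystem.exists_abs_le (h : IsLogSystem (n := n) D u) (hm : 0 < m)
    (hD : IsNormalCrossings (n := n) D)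
    {f : X → ℝ} (hf : PreLogLog (n := n) D fun z => (f z : ℂ)) :
    ∃ (M : ℕ) (K : ℝ), 0 ≤ K ∧ ∀ z ∉ D, |f z| ≤ K * logSum u z ^ M := by
  obtain ⟨M, -, K, hK, hb⟩ := exists_bound_of_isCompact (h := fun z => |f z|)
    (fun _ hz => h.one_le_logSum hm hz)
    Set.univ_nonempty isCompact_univ (fun x _ => by
      obtain ⟨c, r, hc, hx⟩ := hD.exists_isAdapted x
      simpa using ((h.tame_iff hm hc).2 (hf.growth c r hc)).bound x hx)
  exact ⟨M, K, hK, fun z hz => hb z (Set.mem_univ z) hz⟩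

theorem IsLogSystem.exists_abs_le_of_pSingular (h : IsLogSystem (n := n) D u) (hm : 0 < m)
    (hD : IsNormalCrossings (n := n) D)
    {f : X → ℝ} (hf : PSingular (n := n) D fun z => (f z : ℂ)) :
    ∃ K : ℝ, 0 ≤ K ∧ ∀ z ∉ D, |f z| ≤ K * logSum u z := by
  have hT : ∀ z ∉ D, 1 ≤ logSum u z := fun _ hz => h.one_le_logSum hm hz
  obtain ⟨M, hM, K, hK, hb⟩ := exists_bound_of_isCompact (h := fun z => |f z|) hT
    (Set.singleton_nonempty 1) isCompact_univ (fun x _ => by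
      obtain ⟨c, r, hc, hx⟩ := hD.exists_isAdapted x
      have h1 := hf.growth_d c r hc
      rw [← GeneratedBy.congr_iff fun g => tame_iff_bddCoeff hT] at h1
      exact h.locBound_of_deriv hm hc hx ((contMDiffOn_ofReal_iff h.closed).1 hf.smooth) h1)
  rw [Set.mem_singleton_iff] at hM
  subst hM
  exact ⟨K, hK, fun z hz => by simpa using hb z (Set.mem_univ z) hz⟩

theorem IsLogSystem.preLogLog_pow (h : IsLogSystem (n := n) D u) (hm : 0 < m) (M : ℕ) :
    PreLogLog (n := n) D fun z => ((logSum u z ^ M : ℝ) : ℂ) := by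
  have hT : ∀ z ∉ D, 1 ≤ logSum u z := fun _ hz => h.one_le_logSum hm hz
  refine h.preLogLog_of_frameBounded hm (fun x hx => (h.contMDiffAt_logSum hx).pow M) (fun x => ?_)
    fun c r hc => (h.frameBounded_logSum hm hc).pow hT hc (fun x hx => h.contMDiffAt_logSum hx) M
  refine ⟨M, Set.mem_univ _, 1, zero_le_one, Filter.Eventually.of_forall fun z hz => ?_⟩
  change |logSum u z ^ M| ≤ _
  rw [abs_of_nonneg (pow_nonneg (zero_le_one.trans (hT z hz)) M), one_mul]

theorem IsLogSystem.exists_decomposition_of_pSingular (h : IsLogSystem (n := n) D u) (hm : 0 < m)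
    (hD : IsNormalCrossings (n := n) D) {η : Form (n := n) X 2} (hη : IsPositiveForm η)
    {f : X → ℝ} (hf : PreLogLog (n := n) D fun z => (f z : ℂ))
    (hp : PSingular (n := n) D fun z => (f z : ℂ)) :
    ∃ (φ ψ : X → ℝ) (A B : ℝ),
      PreLogLog (n := n) D (fun x => (φ x : ℂ)) ∧ PreLogLog (n := n) D (fun x => (ψ x : ℂ)) ∧
      (∀ x ∉ D, 0 ≤ φ x) ∧ (∀ x ∉ D, 0 ≤ ψ x) ∧ 0 ≤ A ∧ 0 ≤ B ∧ (∀ x ∉ D, f x = φ x - ψ x) ∧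
      WeightedBound D η (fun z => ∑ k, Real.log (u k z) ^ 0) (logSum u) A B φ ∧
      WeightedBound D η (fun z => ∑ k, Real.log (u k z) ^ 0) (logSum u) A B ψ ∧
      PSingular (n := n) D (fun x => (φ x : ℂ)) ∧ PSingular (n := n) D (fun x => (ψ x : ℂ)) ∧
      PlainBound D η A φ ∧ PlainBound D η A ψ := by
  have hT : ∀ z ∉ D, 1 ≤ logSum u z := fun _ hz => h.one_le_logSum hm hz
  have hTs : ∀ z ∉ D, ContMDiffAt 𝓘(ℝ, Cn n) 𝓘(ℝ, ℝ) ∞ (logSum u) z :=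
    fun _ hz => h.contMDiffAt_logSum hz
  have hfs := (contMDiffOn_ofReal_iff h.closed).1 hf.smooth
  obtain ⟨A₀, hA₀, hlow⟩ := h.exists_twistedForm_lower hD hη
  have hpos : ∀ z ∉ D, ∀ v, 0 ≤ twistedForm (logSum u) η A₀ z v := fun z hz v => by
    obtain ⟨c, r, -, -, C, -, hb⟩ := hlow z
    exact (hb.self_of_nhds hz v).1
  have hlevi : ∀ g : X → ℝ, PSingular (n := n) D (fun z => (g z : ℂ)) →
      ∃ C : ℝ, 0 ≤ C ∧ ∀ z ∉ D, ∀ v,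
        |leviForm g z v| ≤ C * logSum u z ^ 0 * twistedForm (logSum u) η A₀ z v := fun g hg => by
    obtain ⟨N, hN, C, hC, hb⟩ := h.leviForm_bound hm hlow (Set.singleton_nonempty 0) fun c r hc =>
      (GeneratedBy.congr_iff fun g => tame_iff_bddCoeff hT).2 (hg.growth_ddc c r hc)
    rw [Set.mem_singleton_iff] at hN
    subst hN
    exact ⟨C, hC, hb⟩
  obtain ⟨K₁, hK₁, hfb⟩ := h.exists_abs_le_of_pSingular hm hD hp
  obtain ⟨Cf, hCf, hfl⟩ := hlevi f hp
  have hTP : PreLogLog (n := n) D fun z => (logSum u z : ℂ) := by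
    simpa using h.preLogLog_pow hm 1
  have hTS : PSingular (n := n) D fun z => (logSum u z : ℂ) :=
    h.pSingular_of_frameBounded hm hTs fun c r hc => h.frameBounded_logSum hm hc
  -- `K₁` makes f + K T nonnegative; `Cf` lets K T absorb ddᶜf, since ddᶜf ≤ Cf (ddᶜ(-T) + A₀ η).
  set K := K₁ + Cf with hK
  have hK0 : 0 ≤ K := by positivity
  have hφS := h.pSingular_add_const_mul hm hp hTS (1 + K)
  have hψS := h.pSingular_add_const_mul hm hTS hTS K
  obtain ⟨Cφ, hCφ, hφl⟩ := hlevi _ hφS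
  obtain ⟨Cψ, hCψ, hψl⟩ := hlevi _ hψS
  have hφs : ∀ z ∉ D, ContMDiffAt 𝓘(ℝ, Cn n) 𝓘(ℝ, ℝ) ∞ (fun z => f z + (1 + K) * logSum u z) z :=
    fun z hz => contMDiffAt_add_const_mul (hfs z hz) (hTs z hz) _
  have hψs : ∀ z ∉ D, ContMDiffAt 𝓘(ℝ, Cn n) 𝓘(ℝ, ℝ) ∞ (fun z => logSum u z + K * logSum u z) z :=
    fun z hz => contMDiffAt_add_const_mul (hTs z hz) (hTs z hz) _
  have hAA : A₀ ≤ (1 + K) * A₀ := by nlinarith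
  -- Semipositivity of ddᶜ(-T) + A₀ η, multiplied by 1 + K, is the plain bound for ψ, which dictates
  -- `A`. With exponent 0 the factor m⁰ is 1, so `B` only has to exceed both constants.
  refine ⟨fun z => f z + (1 + K) * logSum u z, fun z => logSum u z + K * logSum u z, (1 + K) * A₀,
    Cφ + Cψ, h.preLogLog_add_const_mul hm hf hTP (1 + K), h.preLogLog_add_const_mul hm hTP hTP K,
    fun z hz => ?_, fun z hz => ?_, by positivity, by positivity, fun z _ => by ring,
    weightedBound_of_leviForm h hm hη hpos hφs hφl hCφ hAA le_rfl (by simpa using hCψ),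
    weightedBound_of_leviForm h hm hη hpos hψs hψl hCψ hAA le_rfl (by simpa using hCφ),
    hφS, hψS, plainBound_of_leviForm h.closed hη hφs fun z hz v => ?_,
    plainBound_of_leviForm h.closed hη hψs fun z hz v => ?_⟩
  · have h1 := (abs_le.1 (hfb z hz)).1
    have h2 := hT z hz
    simp only [hK]
    nlinarith
  · have h2 := hT z hz
    change 0 ≤ logSum u z + K * logSum u z
    positivity
  · have e := leviForm_add_const_mul (eventually_contMDiffAt h.closed hfs hz)
      (eventually_contMDiffAt h.closed hTs hz) (1 + K) v
    have h1 := (abs_le.1 (hfl z hz v)).2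
    have h2 := hpos z hz v
    rw [e]
    simp only [twistedForm, pow_zero, mul_one] at h1 h2
    nlinarith
  · have e := leviForm_add_const_mul (eventually_contMDiffAt h.closed hTs hz)
      (eventually_contMDiffAt h.closed hTs hz) K v
    have h2 := hpos z hz v
    rw [e]
    simp only [twistedForm] at h2
    nlinarith

theorem IsLogSystem.exists_decomposition_of_preLogLog (h : IsLogSystem (n := n) D u) (hm : 0 < m)
    (hD : IsNormalCrossings (n := n) D) {η : Form (n := n) X 2} (hη : IsPositiveForm η)
    {f : X → ℝ} (hf : PreLogLog (n := n) D fun z => (f z : ℂ)) :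
    ∃ (φ ψ : X → ℝ) (A B : ℝ) (N : ℕ),
      PreLogLog (n := n) D (fun x => (φ x : ℂ)) ∧ PreLogLog (n := n) D (fun x => (ψ x : ℂ)) ∧
      (∀ x ∉ D, 0 ≤ φ x) ∧ (∀ x ∉ D, 0 ≤ ψ x) ∧ 0 ≤ A ∧ 0 ≤ B ∧ (∀ x ∉ D, f x = φ x - ψ x) ∧
      WeightedBound D η (fun z => ∑ k, Real.log (u k z) ^ N) (logSum u) A B φ ∧
      WeightedBound D η (fun z => ∑ k, Real.log (u k z) ^ N) (logSum u) A B ψ := by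
  have hT : ∀ z ∉ D, 1 ≤ logSum u z := fun _ hz => h.one_le_logSum hm hz
  obtain ⟨A₀, hA₀, hlow⟩ := h.exists_twistedForm_lower hD hη
  have hpos : ∀ z ∉ D, ∀ v, 0 ≤ twistedForm (logSum u) η A₀ z v := fun z hz v => by
    obtain ⟨c, r, -, -, C, -, hb⟩ := hlow z
    exact (hb.self_of_nhds hz v).1
  have hlevi : ∀ g : X → ℝ, PreLogLog (n := n) D (fun z => (g z : ℂ)) →
      ∃ (N : ℕ) (C : ℝ), 0 ≤ C ∧ ∀ z ∉ D, ∀ v,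
        |leviForm g z v| ≤ C * logSum u z ^ N * twistedForm (logSum u) η A₀ z v := fun g hg => by
    obtain ⟨N, -, C, hC, hb⟩ := h.leviForm_bound hm hlow Set.univ_nonempty fun c r hc =>
      h.generatedBy_ddc hm hg hc
    exact ⟨N, C, hC, hb⟩
  obtain ⟨M, K, hK, hfb⟩ := h.exists_abs_le hm hD hf
  have hTP := h.preLogLog_pow hm M
  have hφP := h.preLogLog_add_const_mul hm hf hTP (1 + K)
  have hψP := h.preLogLog_add_const_mul hm hTP hTP K
  obtain ⟨Nφ, Cφ, hCφ, hφl⟩ := hlevi _ hφP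
  obtain ⟨Nψ, Cψ, hCψ, hψl⟩ := hlevi _ hψP
  set N := max Nφ Nψ
  have hmN : (0 : ℝ) ≤ (m : ℝ) ^ N := by positivity
  -- The factor mᴺ pays for replacing a power of T by Θ_N.
  refine ⟨_, _, A₀, (Cφ + Cψ) * (m : ℝ) ^ N, N, hφP, hψP,
    fun z hz => ?_, fun z hz => ?_, hA₀, by positivity, fun z _ => by ring,
    weightedBound_of_leviForm h hm hη hpos ((contMDiffOn_ofReal_iff h.closed).1 hφP.smooth) hφl hCφ
      le_rfl (le_max_left _ _) (mul_le_mul_of_nonneg_right (by linarith) hmN),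
    weightedBound_of_leviForm h hm hη hpos ((contMDiffOn_ofReal_iff h.closed).1 hψP.smooth) hψl hCψ
      le_rfl (le_max_right _ _) (mul_le_mul_of_nonneg_right (by linarith) hmN)⟩
  · have h1 := (abs_le.1 (hfb z hz)).1
    have h2 : 0 ≤ logSum u z ^ M := pow_nonneg (zero_le_one.trans (hT z hz)) M
    linarith
  · have h2 : 0 ≤ logSum u z ^ M := pow_nonneg (zero_le_one.trans (hT z hz)) M
    positivity

end Decomposition

/-! ### Smooth hypersurfaces inside D are coordinate hyperplanes of adapted charts. -/

section Coordinates

variable {n : ℕ}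

theorem eqOn_zero_of_mul_eq_zero {U : Set (Cn n)} (hU : IsPreconnected U) (hUo : IsOpen U)
    {f g : Cn n → ℂ} (hf : AnalyticOnNhd ℂ f U) (hg : AnalyticOnNhd ℂ g U)
    (h : ∀ y ∈ U, f y * g y = 0) : Set.EqOn f 0 U ∨ Set.EqOn g 0 U := by
  by_contra! hne
  obtain ⟨hf0, hg0⟩ := hne
  obtain ⟨y, hy, hfy⟩ : ∃ y ∈ U, f y ≠ 0 := by
    by_contra! h0
    exact hf0 h0
  refine hg0 (hg.eqOn_zero_of_preconnected_of_eventuallyEq_zero hU hy ?_)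
  filter_upwards [(hf y hy).continuousAt.eventually_ne hfy, hUo.mem_nhds hy] with z hz hzU
  exact (mul_eq_zero.1 (h z hzU)).resolve_left hz

theorem exists_eqOn_zero_of_prod_eq_zero {U : Set (Cn n)} (hU : IsPreconnected U) (hUo : IsOpen U)
    (hne : U.Nonempty) {ι : Type*} (s : Finset ι) {f : ι → Cn n → ℂ}
    (hf : ∀ i ∈ s, AnalyticOnNhd ℂ (f i) U) (h : ∀ y ∈ U, ∏ i ∈ s, f i y = 0) :
    ∃ i ∈ s, Set.EqOn (f i) 0 U := by
  classical
  induction s using Finset.induction_on with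
  | empty =>
    obtain ⟨y, hy⟩ := hne
    simpa using h y hy
  | insert i s hi ih =>
    simp only [Finset.prod_insert hi] at h
    rcases eqOn_zero_of_mul_eq_zero hU hUo (hf i (Finset.mem_insert_self i s))
      (Finset.analyticOnNhd_fun_prod s fun j hj => hf j
        (Finset.mem_insert_of_mem hj)) h with h1 | h1
    · exact ⟨i, Finset.mem_insert_self i s, h1⟩
    · obtain ⟨j, hj, hj'⟩ := ih (fun j hj => hf j (Finset.mem_insert_of_mem hj)) h1
      exact ⟨j, Finset.mem_insert_of_mem hj, hj'⟩

variable {X : Type*} [TopologicalSpace X] [ChartedSpace (Cn n) X]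
  {D S : Set X} {c : OpenPartialHomeomorph X (Cn n)} {r : ℕ} {x : X}

/-- The product of the coordinates defining D vanishes on S, which is locally a connected manifold.
Analytic functions there form an integral domain, so a single coordinate vanishes on S near `x`. -/
theorem IsSmoothHypersurface.exists_coord_eq_zero (hS : IsSmoothHypersurface (n := n) S)
    (hSD : S ⊆ D) (hc : IsAdapted (n := n) D c r) (hx : x ∈ c.source) (hxS : x ∈ S) :
    ∃ i : Fin n, (i : ℕ) < r ∧ ∀ᶠ z in 𝓝 x, z ∈ S → c z i = 0 := by
  obtain ⟨w, hw, hxw, j, hj⟩ := hS.2 x hxS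
  have hev : ∀ᶠ y in 𝓝 (w x), y ∈ w.target ∧ w.symm y ∈ c.source := by
    filter_upwards [w.open_target.mem_nhds (w.map_source hxw),
      eventually_of_chart hxw (c.open_source.mem_nhds hx)] with y h1 h2 using ⟨h1, h2⟩
  obtain ⟨ε, hε, hball⟩ := Metric.nhds_basis_ball.eventually_iff.1 hev
  have hwx : w x j = 0 := (hj x hxw).1 hxS
  -- Composing with this projection onto the hyperplane y_j = 0, which maps the sup-norm ball into
  -- itself, replaces functions on S by functions on an open ball of ℂⁿ.
  set p : Cn n → Cn n := fun y => Function.update y j 0 with hp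
  have hpB : ∀ y ∈ Metric.ball (w x) ε, p y ∈ Metric.ball (w x) ε := fun y hy => by
    rw [mem_ball_iff_norm] at hy ⊢
    refine lt_of_le_of_lt ((pi_norm_le_iff_of_nonneg (norm_nonneg _)).2 fun l => ?_) hy
    by_cases hl : l = j
    · subst hl
      simp [hp, hwx]
    · simpa [hp, hl] using norm_le_pi_norm (y - w x) l
  have hpd : ContDiff ℂ ω p := contDiff_pi.2 fun l => by
    by_cases hl : l = j
    · subst hl
      simpa [hp] using contDiff_const
    · simpa [hp, hl] using contDiff_apply ℂ ℂ l
  have hpS : ∀ y ∈ Metric.ball (w x) ε, w.symm (p y) ∈ S := fun y hy => by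
    obtain ⟨h1, -⟩ := hball (hpB y hy)
    rw [hj _ (w.map_target h1), w.right_inv h1]
    simp [hp]
  obtain ⟨i, hi, hi0⟩ := exists_eqOn_zero_of_prod_eq_zero (U := Metric.ball (w x) ε)
    (convex_ball _ _).isPreconnected Metric.isOpen_ball ⟨w x, Metric.mem_ball_self hε⟩
    (Finset.univ.filter fun i : Fin n => (i : ℕ) < r) (f := fun i y => c (w.symm (p y)) i)
    (fun i _ y hy => by
      obtain ⟨h1, h2⟩ := hball (hpB y hy)
      have h3 := contDiffAt_coordChange hw hc.mem_maximalAtlas (w.map_target h1) h2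
      rw [w.right_inv h1] at h3
      exact (contDiffAt_pi.1 (ContDiffAt.comp y h3 hpd.contDiffAt) i).analyticAt)
    (fun y hy => by
      obtain ⟨i, hi, hi0⟩ := (hc.cutOut.2 _ (hball (hpB y hy)).2).1 (hSD (hpS y hy))
      exact Finset.prod_eq_zero (Finset.mem_filter.2 ⟨Finset.mem_univ i, hi⟩) hi0)
  refine ⟨i, (Finset.mem_filter.1 hi).2, ?_⟩
  filter_upwards [w.open_source.mem_nhds hxw, (w.continuousAt hxw).eventually
    (Metric.ball_mem_nhds (w x) hε)] with z hzw hzB hzS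
  have h1 : p (w z) = w z := by
    rw [hp, Function.update_eq_self_iff]
    exact ((hj z hzw).1 hzS).symm
  have := hi0 hzB
  simpa [h1, w.left_inv hzw] using this

theorem contDiffAt_comp_symm_of_holomorphic (hc : c ∈ maximalAtlas 𝓘(ℂ, Cn n) ω X)
    (hx : x ∈ c.source) {q : X → ℂ}
    (hq : ContMDiffAt 𝓘(ℂ, Cn n) 𝓘(ℂ, ℂ) ω q x) : ContDiffAt ℂ ω (fun y => q (c.symm y)) (c x) := by
  rw [← contMDiffAt_iff_contDiffAt]
  refine ContMDiffAt.comp (c x) (g := q) ?_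
    (contMDiffAt_symm_of_mem_maximalAtlas hc (c.map_source hx))
  rwa [c.left_inv hx]

/-- If both factors vanished at `x`, so would the differential of the product, yet dz_i is nowhere
zero. -/
theorem ne_zero_of_coord_eq_mul (hc : c ∈ maximalAtlas 𝓘(ℂ, Cn n) ω X) (hx : x ∈ c.source)
    {i : Fin n} {q σ : X → ℂ} (hq : ContMDiffAt 𝓘(ℂ, Cn n) 𝓘(ℂ, ℂ) ω q x)
    (hσ : ContMDiffAt 𝓘(ℂ, Cn n) 𝓘(ℂ, ℂ) ω σ x) (hσ0 : σ x = 0)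
    (h : ∀ᶠ z in 𝓝 x, c z i = q z * σ z) : q x ≠ 0 := by
  intro hq0
  have h1 := (contDiffAt_comp_symm_of_holomorphic hc hx hq).differentiableAt (by simp)
  have h2 := (contDiffAt_comp_symm_of_holomorphic hc hx hσ).differentiableAt (by simp)
  have h3 := h1.hasFDerivAt.mul h2.hasFDerivAt
  have h4 : (fun y : Cn n => y i) =ᶠ[𝓝 (c x)] fun y => q (c.symm y) * σ (c.symm y) := by
    filter_upwards [eventually_of_chart hx h, c.open_target.mem_nhds
      (c.map_source hx)] with y hy hyt
    rwa [c.right_inv hyt] at hy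
  have h5 := (h3.congr_of_eventuallyEq h4).unique
    (ContinuousLinearMap.proj (R := ℂ) (φ := fun _ : Fin n => ℂ) i).hasFDerivAt
  have h6 := DFunLike.congr_fun h5 (Pi.single i 1)
  simp [c.left_inv hx, hq0, hσ0] at h6

variable [IsManifold 𝓘(ℂ, Cn n) ω X]

/-- This is the smooth part of log ‖s‖⁻². Off the divisor q is the section in a trivialization and t
= -2; on it q is the unit z_i/σ and t = 2. -/
theorem eventually_contDiffAt_log_sub (hc : c ∈ maximalAtlas 𝓘(ℂ, Cn n) ω X) (hx : x ∈ c.source)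
    {q : X → ℂ} {H : X → ℝ} (hq : ContMDiffAt 𝓘(ℂ, Cn n) 𝓘(ℂ, ℂ) ω q x) (hq0 : q x ≠ 0)
    (hH : ∀ᶠ z in 𝓝 x, ContMDiffAt 𝓘(ℝ, Cn n) 𝓘(ℝ, ℝ) ∞ H z ∧ 0 < H z) (t : ℝ) :
    ∀ᶠ y in 𝓝 (c x),
      ContDiffAt ℝ ∞ (fun y => t * Real.log ‖q (c.symm y)‖ - Real.log (H (c.symm y))) y := by
  have h1 := contDiffAt_comp_symm_of_holomorphic hc hx hq
  have h2 : ∀ᶠ y in 𝓝 (c x), q (c.symm y) ≠ 0 :=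
    h1.continuousAt.eventually_ne (by rwa [c.left_inv hx])
  filter_upwards [h1.eventually (by simp), h2, eventually_of_chart hx hH,
    c.open_target.mem_nhds (c.map_source hx)] with y h3 h4 h5 hyt
  have h6 := contDiffAt_comp_symm hc (c.map_target hyt) h5.1
  rw [c.right_inv hyt] at h6
  have h7 : ContDiffAt ℝ ∞ (fun y => q (c.symm y)) y := (h3.restrict_scalars ℝ).of_le le_top
  exact (contDiffAt_const.mul ((h7.norm ℝ h4).log (norm_ne_zero_iff.2 h4))).sub (h6.log h5.2.ne')

end Coordinates

/-! ### Logarithmic models of log ‖s‖⁻² for a section with smooth divisor. -/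

section LineBundle

variable {n : ℕ} {X : Type*} [TopologicalSpace X] [ChartedSpace (Cn n) X]
  {L : X → Type*} [∀ x, AddCommGroup (L x)]
  [∀ x, TopologicalSpace (L x)] [TopologicalSpace (Bundle.TotalSpace ℂ L)] [FiberBundle ℂ L]
  {D S : Set X} {c : OpenPartialHomeomorph X (Cn n)} {r : ℕ} {x : X}

/-- Off S the ideal of germs vanishing on S contains 1, and the section generates it. -/
theorem HasDivisor.ne_zero {s : ∀ x, L x} (hs : HasDivisor (n := n) s S) (hS : IsClosed S)
    (hx : x ∉ S) : (trivializationAt ℂ L x ⟨x, s x⟩).2 ≠ 0 := by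
  obtain ⟨q, -, hq⟩ := hs.2 x (fun _ => 1) contMDiffAt_const (by
    filter_upwards [hS.isOpen_compl.mem_nhds hx] with y hy hyS using (hy hyS).elim)
  intro h0
  have := hq.self_of_nhds
  rw [h0, mul_zero] at this
  exact one_ne_zero this

variable [∀ x, Module ℂ (L x)] [VectorBundle ℂ ℂ L]

theorem HermitianMetric.normSq_eq (h : HermitianMetric (n := n) L)
    (e : Bundle.Trivialization ℂ (Bundle.TotalSpace.proj : Bundle.TotalSpace ℂ L → X))
    [MemTrivializationAtlas e] {x : X} (hx : x ∈ e.baseSet) (v : L x) :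
    h.normSq v = ‖(e ⟨x, v⟩).2‖ ^ 2 * (h.inner x (e.symm x 1) (e.symm x 1)).re := by
  set a := (e ⟨x, v⟩).2 with ha
  have h1 : v = a • e.symm x 1 := by
    have h2 : e.symm x a = v := by rw [ha]; exact e.symm_apply_apply_mk hx v
    have h3 : e.symmₗ ℂ x (a • 1) = a • e.symmₗ ℂ x 1 := map_smul _ _ _
    rw [smul_eq_mul, mul_one] at h3
    rw [e.coe_symmₗ hx] at h3
    exact h2.symm.trans h3
  have h4 : h.inner x v v = (‖a‖ ^ 2 : ℝ) * h.inner x (e.symm x 1) (e.symm x 1) := by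
    rw [h1, map_smul, map_smulₛₗ, LinearMap.smul_apply, smul_eq_mul, smul_eq_mul, ← mul_assoc,
      ← Complex.normSq_eq_norm_sq, Complex.normSq_eq_conj_mul_self]
    ring
  rw [HermitianMetric.normSq, h4, Complex.re_ofReal_mul]

theorem HermitianMetric.frame_pos (h : HermitianMetric (n := n) L)
    (e : Bundle.Trivialization ℂ (Bundle.TotalSpace.proj : Bundle.TotalSpace ℂ L → X))
    [MemTrivializationAtlas e] {x : X} (hx : x ∈ e.baseSet) :
    0 < (h.inner x (e.symm x 1) (e.symm x 1)).re := by
  refine h.pos x _ fun h0 => ?_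
  have h1 := e.apply_mk_symm hx (1 : ℂ)
  rw [h0] at h1
  have h2 : (e ⟨x, (0 : L x)⟩).2 = 0 := (e.linear ℂ hx).map_zero
  rw [h1] at h2
  exact one_ne_zero h2

theorem HermitianMetric.eventually_frame (h : HermitianMetric (n := n) L) (x : X) :
    ∀ᶠ z in 𝓝 x, ContMDiffAt 𝓘(ℝ, Cn n) 𝓘(ℝ, ℝ) ∞ (fun z =>
      (h.inner z ((trivializationAt ℂ L x).symm z 1) ((trivializationAt ℂ L x).symm z 1)).re) z ∧
      0 < (h.inner z ((trivializationAt ℂ L x).symm z 1)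
        ((trivializationAt ℂ L x).symm z 1)).re := by
  filter_upwards [(trivializationAt ℂ L x).open_baseSet.mem_nhds
    (FiberBundle.mem_baseSet_trivializationAt' x)] with z hz
  exact ⟨(h.smooth (trivializationAt ℂ L x)).contMDiffAt
    ((trivializationAt ℂ L x).open_baseSet.mem_nhds hz), h.frame_pos _ hz⟩

variable [IsManifold 𝓘(ℂ, Cn n) ω X]

theorem regularIn_neg_log_normSq (h : HermitianMetric (n := n) L) {s : ∀ x, L x}
    (hs : HolomorphicSection (n := n) s) (hdiv : HasDivisor (n := n) s S) (hS : IsClosed S)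
    (hc : c ∈ maximalAtlas 𝓘(ℂ, Cn n) ω X) (hx : x ∈ c.source) (hxS : x ∉ S) :
    RegularIn D c x fun z => Real.log (h.normSq (s z))⁻¹ := by
  have hσ := (Bundle.contMDiffAt_section x).1 (hs x)
  have hσ0 := hdiv.ne_zero hS hxS
  refine ⟨_, eventually_contDiffAt_log_sub hc hx hσ hσ0 (h.eventually_frame x) (-2), ?_⟩
  filter_upwards [c.open_source.mem_nhds hx, hσ.continuousAt.eventually_ne hσ0,
    (trivializationAt ℂ L x).open_baseSet.mem_nhds (FiberBundle.mem_baseSet_trivializationAt' x)]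
    with z hzs hz0 hzb _
  have h1 := h.frame_pos (trivializationAt ℂ L x) hzb
  rw [c.left_inv hzs, h.normSq_eq (trivializationAt ℂ L x) hzb, Real.log_inv,
    Real.log_mul (pow_ne_zero 2 (norm_ne_zero_iff.2 hz0)) h1.ne', Real.log_pow]
  push_cast
  ring

/-- A coordinate z_i vanishing on S is a multiple qσ of the section, by the ideal property, and
comparison of differentials makes q a unit. Thus log |σ| differs from log |z_i| by a smooth
function. -/
theorem exists_logPoleIn (h : HermitianMetric (n := n) L) {s : ∀ x, L x}
    (hs : HolomorphicSection (n := n) s) (hdiv : HasDivisor (n := n) s S)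
    (hS : IsSmoothHypersurface (n := n) S) (hSD : S ⊆ D)
    (hc : IsAdapted (n := n) D c r) (hx : x ∈ c.source) (hxS : x ∈ S) :
    ∃ i : Fin n, (i : ℕ) < r ∧ (∀ᶠ z in 𝓝 x, z ∈ S → c z i = 0) ∧
      LogPoleIn D c i x fun z => Real.log (h.normSq (s z))⁻¹ := by
  obtain ⟨i, hi, hi0⟩ := hS.exists_coord_eq_zero hSD hc hx hxS
  refine ⟨i, hi, hi0, ?_⟩
  have hσ := (Bundle.contMDiffAt_section x).1 (hs x)
  have hci : ContMDiffAt 𝓘(ℂ, Cn n) 𝓘(ℂ, ℂ) ω (fun z => c z i) x :=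
    ContMDiffAt.comp x (g := fun y : Cn n => y i) (contDiff_apply ℂ ℂ i).contMDiff.contMDiffAt
      (contMDiffAt_of_mem_maximalAtlas hc.mem_maximalAtlas hx)
  obtain ⟨q, hq, hqe⟩ := hdiv.2 x _ hci hi0
  have hσ0 : (trivializationAt ℂ L x ⟨x, s x⟩).2 = 0 := by
    rw [hdiv.1 x hxS]
    exact ((trivializationAt ℂ L x).linear ℂ (FiberBundle.mem_baseSet_trivializationAt' x)).map_zero
  have hq0 := ne_zero_of_coord_eq_mul hc.mem_maximalAtlas hx hq hσ hσ0 hqe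
  refine ⟨_, eventually_contDiffAt_log_sub hc.mem_maximalAtlas hx hq hq0
    (h.eventually_frame x) 2, ?_⟩
  filter_upwards [c.open_source.mem_nhds hx, hq.continuousAt.eventually_ne hq0, hqe,
    (trivializationAt ℂ L x).open_baseSet.mem_nhds (FiberBundle.mem_baseSet_trivializationAt' x)]
    with z hzs hz0 hze hzb hzD
  have h1 := h.frame_pos (trivializationAt ℂ L x) hzb
  have hzi : c z i ≠ 0 := hc.ne_zero ⟨hzs, hzD⟩ hi
  have hσz : (trivializationAt ℂ L x ⟨z, s z⟩).2 ≠ 0 := fun h0 => hzi (by rw [hze, h0, mul_zero])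
  rw [c.left_inv hzs, h.normSq_eq (trivializationAt ℂ L x) hzb, Real.log_inv,
    Real.log_mul (pow_ne_zero 2 (norm_ne_zero_iff.2 hσz)) h1.ne', Real.log_pow, hze, norm_mul,
    Real.log_mul (norm_ne_zero_iff.2 hz0) (norm_ne_zero_iff.2 hσz)]
  push_cast
  ring

end LineBundle

/-! ### The functions log ‖s_k‖⁻² of a simple normal crossings divisor. -/

section LogSystem

variable {n m : ℕ} {X : Type*} [TopologicalSpace X] [ChartedSpace (Cn n) X]
  [IsManifold 𝓘(ℂ, Cn n) ω X] {D : Set X} {Dk : Fin m → Set X}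
  {L : Fin m → X → Type*} [∀ k x, AddCommGroup (L k x)] [∀ k x, Module ℂ (L k x)]
  [∀ k x, TopologicalSpace (L k x)] [∀ k, TopologicalSpace (Bundle.TotalSpace ℂ (L k))]
  [∀ k, FiberBundle ℂ (L k)] [∀ k, VectorBundle ℂ ℂ (L k)]

theorem IsSNCDecomposition.isLogSystem (hD : IsSNCDecomposition (n := n) D Dk)
    {s : ∀ k x, L k x} (hs : ∀ k, HolomorphicSection (n := n) (s k))
    (hdiv : ∀ k, HasDivisor (n := n) (s k) (Dk k)) (h : ∀ k, HermitianMetric (n := n) (L k))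
    (hnorm : ∀ k x, (h k).normSq (s k x) ≤ Real.exp (-Real.exp 1)) :
    IsLogSystem (n := n) D fun k x => Real.log ((h k).normSq (s k x))⁻¹ := by
  have hsub : ∀ k, Dk k ⊆ D := fun k => by rw [hD.eq_iUnion]; exact Set.subset_iUnion _ k
  have hcl : IsClosed D := by
    rw [hD.eq_iUnion]
    exact isClosed_iUnion_of_finite fun k => (hD.smooth k).1
  have hreg : ∀ k {c : OpenPartialHomeomorph X (Cn n)}, c ∈ maximalAtlas 𝓘(ℂ, Cn n) ω X →
      ∀ {x}, x ∈ c.source → x ∉ Dk k →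
      RegularIn D c x fun z => Real.log ((h k).normSq (s k z))⁻¹ := fun k c hc x hx hxk =>
    regularIn_neg_log_normSq (h k) (hs k) (hdiv k) (hD.smooth k).1 hc hx hxk
  refine ⟨hcl, fun k z hz => ?_, fun k z hz => ?_, fun c r hc x hx k => ?_,
    fun c r hc x hx i hi hi0 => ?_⟩
  · have h0 := (hdiv k).ne_zero (hD.smooth k).1 fun hzk => hz (hsub k hzk)
    have hb := FiberBundle.mem_baseSet_trivializationAt' (F := ℂ) (E := L k) z
    have hpos : 0 < (h k).normSq (s k z) := by
      rw [(h k).normSq_eq (trivializationAt ℂ (L k) z) hb]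
      have := (h k).frame_pos (trivializationAt ℂ (L k) z) hb
      positivity
    rw [Real.log_inv, le_neg]
    exact (Real.log_le_iff_le_exp hpos).2 (hnorm k z)
  · have hc : chartAt (Cn n) z ∈ maximalAtlas 𝓘(ℂ, Cn n) ω X :=
      subset_maximalAtlas (chart_mem_atlas (Cn n) z)
    have hx := mem_chart_source (Cn n) z
    obtain ⟨b, hb, hub⟩ := hreg k hc hx fun hzk => hz (hsub k hzk)
    refine (contMDiffAt_comp_chart hc hx hb.self_of_nhds).congr_of_eventuallyEq ?_
    filter_upwards [hub, hcl.isOpen_compl.mem_nhds hz] with y h1 h2 using h1 h2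
  · by_cases hxk : x ∈ Dk k
    · obtain ⟨i, hi, -, hp⟩ := exists_logPoleIn (h k) (hs k) (hdiv k) (hD.smooth k)
          (hsub k) hc hx hxk
      exact Or.inr ⟨i, hi, hp⟩
    · exact Or.inl (hreg k hc.mem_maximalAtlas hx hxk)
  · have hev : ∀ᶠ z in 𝓝 x, z ∈ c.source ∧ ∀ k, z ∈ Dk k → ∃ l : Fin n, c z l = 0 ∧
        LogPoleIn D c l x fun z => Real.log ((h k).normSq (s k z))⁻¹ := by
      refine Filter.Eventually.and (c.open_source.mem_nhds hx) (Filter.eventually_all.2 fun k => ?_)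
      by_cases hxk : x ∈ Dk k
      · obtain ⟨l, -, hl, hp⟩ :=
          exists_logPoleIn (h k) (hs k) (hdiv k) (hD.smooth k) (hsub k) hc hx hxk
        filter_upwards [hl] with z hz hzk using ⟨l, hz hzk, hp⟩
      · filter_upwards [(hD.smooth k).1.isOpen_compl.mem_nhds hxk] with z hz hzk
        exact (hz hzk).elim
    -- To find the component containing the branch z_i = 0, move to a nearby point of that branch
    -- with all other coordinates nonzero. It lies on some D_k, and the only coordinate that can
    -- then vanish on D_k is z_i.
    set y : ℂ → Cn n := fun t l => if l = i then 0 else c x l + t with hy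
    have hyc : Filter.Tendsto y (𝓝[≠] 0) (𝓝 (c x)) := by
      have hcont : Continuous y := continuous_pi fun l => by
        by_cases hl : l = i
        · simpa [hy, hl] using continuous_const
        · simp only [hy, hl, if_false]
          fun_prop
      have hy0 : y 0 = c x := by
        ext l
        by_cases hl : l = i
        · simp [hy, hl, hi0]
        · simp [hy, hl]
      have := hcont.tendsto 0
      rw [hy0] at this
      exact this.mono_left nhdsWithin_le_nhds
    have hne : ∀ᶠ t in 𝓝[≠] (0 : ℂ), ∀ l, l ≠ i → c x l + t ≠ 0 := by
      refine Filter.eventually_all.2 fun l => ?_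
      by_cases hl : c x l = 0
      · filter_upwards [self_mem_nhdsWithin] with t ht _
        simpa [hl] using ht
      · have : ContinuousAt (fun t => c x l + t) 0 := by fun_prop
        filter_upwards [nhdsWithin_le_nhds (this.eventually_ne
          (by simpa using hl))] with t ht _ using ht
    obtain ⟨t, ⟨⟨hts, htk⟩, htt⟩, htn⟩ := (((hyc.eventually (eventually_of_chart hx hev)).and
      (hyc.eventually (c.open_target.mem_nhds (c.map_source hx)))).and hne).exists
    have hmem : c.symm (y t) ∈ D := (hc.cutOut.2 _ hts).2 ⟨i, hi, by
      rw [c.right_inv htt]; simp [hy]⟩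
    rw [hD.eq_iUnion, Set.mem_iUnion] at hmem
    obtain ⟨k, hk⟩ := hmem
    obtain ⟨l, hl, hp⟩ := htk k hk
    rw [c.right_inv htt] at hl
    by_cases hli : l = i
    · subst hli
      exact ⟨k, hp⟩
    · simp only [hy, hli, if_false] at hl
      exact (htn l hli hl).elim

end LogSystem

end LogLog

theorem theorem4p2 {n m : ℕ} (hm : 0 < m)
    {X : Type*} [TopologicalSpace X] [T2Space X] [CompactSpace X]
    [ChartedSpace (LogLog.Cn n) X] [IsManifold 𝓘(ℂ, LogLog.Cn n) ω X]
    -- a divisor with simple normal crossings and its irreducible components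
    (D : Set X) (Dk : Fin m → Set X) (hD : LogLog.IsSNCDecomposition (n := n) D Dk)
    -- the holomorphic line bundles `O(D_k)` with their sections `s_k` and smooth hermitian metrics
    (L : Fin m → X → Type*) [∀ k x, AddCommGroup (L k x)] [∀ k x, Module ℂ (L k x)]
    [∀ k x, TopologicalSpace (L k x)] [∀ k, TopologicalSpace (Bundle.TotalSpace ℂ (L k))]
    [∀ k, FiberBundle ℂ (L k)] [∀ k, VectorBundle ℂ ℂ (L k)]
    [∀ k, ContMDiffVectorBundle ω ℂ (L k) 𝓘(ℂ, LogLog.Cn n)]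
    (s : ∀ k x, L k x) (hs : ∀ k, LogLog.HolomorphicSection (n := n) (s k))
    (hdiv : ∀ k, LogLog.HasDivisor (n := n) (s k) (Dk k))
    (h : ∀ k, LogLog.HermitianMetric (n := n) (L k))
    (hnorm : ∀ k x, (h k).normSq (s k x) ≤ Real.exp (-Real.exp 1))
    -- a smooth positive `(1,1)`-form
    (η : LogLog.Form (n := n) X 2) (hη : LogLog.IsPositiveForm η)
    -- a real pre-log-log function
    (f : X → ℝ) (hf : LogLog.PreLogLog (n := n) D (fun x => (f x : ℂ))) :
    ∃ (φ ψ : X → ℝ) (A B : ℝ) (N : ℕ),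
      LogLog.PreLogLog (n := n) D (fun x => (φ x : ℂ)) ∧
      LogLog.PreLogLog (n := n) D (fun x => (ψ x : ℂ)) ∧
      (∀ x ∉ D, 0 ≤ φ x) ∧ (∀ x ∉ D, 0 ≤ ψ x) ∧ 0 ≤ A ∧ 0 ≤ B ∧
      (∀ x ∉ D, f x = φ x - ψ x) ∧
      LogLog.WeightedBound D η (LogLog.Theta h s N) (LogLog.Theta h s 1) A B φ ∧
      LogLog.WeightedBound D η (LogLog.Theta h s N) (LogLog.Theta h s 1) A B ψ ∧
      (LogLog.PSingular (n := n) D (fun x => (f x : ℂ)) →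
        N = 0 ∧
        LogLog.PSingular (n := n) D (fun x => (φ x : ℂ)) ∧
        LogLog.PSingular (n := n) D (fun x => (ψ x : ℂ)) ∧
        LogLog.PlainBound D η A φ ∧ LogLog.PlainBound D η A ψ) := by 
  have hsys := hD.isLogSystem hs hdiv h hnorm
  have h1 : LogLog.Theta h s 1 =
      LogLog.logSum fun k x => Real.log ((h k).normSq (s k x))⁻¹ := by
    funext x
    simp [LogLog.Theta, LogLog.logSum]
  rw [h1]
  -- The additional conclusions concern the same witnesses, so the case distinction has to precede
  -- their choice.
  by_cases hp : LogLog.PSingular (n := n) D fun x => (f x : ℂ)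
  · obtain ⟨φ, ψ, A, B, g1, g2, g3, g4, g5, g6, g7, g8, g9, g10⟩ :=
      hsys.exists_decomposition_of_pSingular hm hD.normalCrossings hη hf hp
    exact ⟨φ, ψ, A, B, 0, g1, g2, g3, g4, g5, g6, g7, g8, g9, fun _ => ⟨rfl, g10⟩⟩
  · obtain ⟨φ, ψ, A, B, N, g1, g2, g3, g4, g5, g6, g7, g8, g9⟩ :=
      hsys.exists_decomposition_of_preLogLog hm hD.normalCrossings hη hf
    exact ⟨φ, ψ, A, B, N, g1, g2, g3, g4, g5, g6, g7, g8, g9, fun h => (hp h).elim⟩
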